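/- **Notation.** Partitions are identified with Young diagrams; $\lambda'$ is the conjugate, $|\lambda|$ the weight, $l(\lambda)$ the length, $\subseteq$ containment of diagrams. Let $N\ge 1$ and $p,q\ge 0$ be integers. For $\lambda\subseteq(N^p)$ put $\tilde\lambda=(p-\lambda'_N,\dots,p-\lambda'_1)$. For a sequence of one-variable polynomials $\varphi_0,\varphi_1,\dots$ and $l(\lambda)\le n$ let $$\varPhi_\lambda(x_1,\dots,x_n)=\frac{\det[\varphi_{\lambda_i+n-i}(x_j)]_{i,j=1}^n}{\prod_{i<j}(x_i-x_j)},$$ a polynomial in $x_1,\dots,x_n$. It is the Schur polynomial $S_\lambda$ if $\varphi_m=x^m$ (and $S_\lambda(x_1,\dots,x_n)=0$ if $l(\lambda)>n$), and it is $\mathcal H_\lambda$, $\mathcal L^{(\gamma)}_\lambda$, $\mathcal J^{(\gamma_1,\gamma_2)}_\lambda$ if $\varphi_m$ is, respectively, the monic Hermite polynomial $H_m$ orthogonal with respect to $e^{-x^2/2}$, the Laguerre polynomial $L_m^{(\gamma)}(x)=\sum_{j=0}^m(-1)^j\frac{\Gamma(m+\gamma+1)}{\Gamma(j+\gamma+1)(m-j)!\,j!}x^j$,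 or the Jacobi polynomial $J_m^{(\gamma_1,\gamma_2)}(x)=\sum_{j=0}^m\frac{(-1)^j}{j!(m-j)!}(m+\gamma_1+\gamma_2+1)_j\frac{\Gamma(m+\gamma_1+1)}{\Gamma(j+\gamma_1+1)}x^j$ on $[0,1]$, with $(a)_j=a(a+1)\cdots(a+j-1)$. For $l(\mu)\le N$ put $$C_\mu(N)=\prod_{j=1}^N\frac{(\mu_j+N-j)!}{(N-j)!},\qquad G_\mu(N,\gamma)=\prod_{j=1}^N\Gamma(\mu_j+N-j+\gamma+1),$$ and, with $a_{jk}=\mu_j-\nu_k-j+k$ and entries understood to be $0$ when $a_{jk}<0$, $$D^{(H)}_{\mu\nu}=\det\Big[\mathbb 1_{a_{jk}\ \mathrm{even}}\tfrac{1}{(a_{jk}/2)!}\Big]_{j,k=1}^{l(\mu)},\quad D^{(L)}_{\mu\nu}=\det\Big[\tfrac1{a_{jk}!}\Big]_{j,k=1}^{l(\mu)},\quad \mathcal D^{(J)}_{\mu\nu}=\det\Big[\tfrac{1}{a_{jk}!\,\Gamma(2N+\mu_j+\nu_k-j-k+\gamma_1+\gamma_2+2)}\Big]_{j,k=1}^{N}.$$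 An $N\times N$ GUE, LUE (parameter $\gamma>-1$) or JUE (parameters $\gamma_1,\gamma_2>-1$) matrix $M$ is a random Hermitian matrix whose eigenvalues have joint density proportional to $\prod_{i<j}(x_i-x_j)^2\prod_i w(x_i)$, with $w(x)=e^{-x^2/2}$ on $\mathbb R$, $w(x)=x^\gamma e^{-x}$ on $(0,\infty)$, or $w(x)=x^{\gamma_1}(1-x)^{\gamma_2}$ on $(0,1)$, respectively; $\mathbb E^{(H)}_N,\mathbb E^{(L)}_N,\mathbb E^{(J)}_N$ are the expectations. **Proposition.** Let $t=(t_1,\dots,t_p)\in\mathbb C^p$, and let $T_1,\dots,T_q$ be variables. Expand $\prod_j\det(t_j-M)/\prod_k\det(T_k-M)$ as a formal power series in $T_1^{-1},\dots,T_q^{-1}$, using $1/\det(T_k-M)=T_k^{-N}/\det(1-T_k^{-1}M)$, and take the expectation coefficient by coefficient. All coefficients are integrable, every monomial in the $T_k^{-1}$ occurs in only finitely many terms of each sum below, and, as formal power series in $T_1^{-1},\dots,T_q^{-1}$, $$\mathbb E^{(H)}_N\!\left[\frac{\prod_{j=1}^p\det(t_j-M)}{\prod_{k=1}^q\det(T_k-M)}\right]=\prod_{k=1}^q\frac1{T_k^N}\sum_{(\lambda,\mu,\nu)}\frac{(-1)^{|\nu|}}{2^{(|\mu|-|\nu|)/2}}\,C_\mu(N)\,D^{(H)}_{\mu\nu}\,\mathcal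 H_\lambda(t)\,S_\mu(T^{-1}),$$ $$\mathbb E^{(L)}_N\!\left[\frac{\prod_{j=1}^p\det(t_j-M)}{\prod_{k=1}^q\det(T_k-M)}\right]=\prod_{j=N}^{p+N-1}(-1)^jj!\ \prod_{k=1}^q\frac1{T_k^N}\sum_{(\lambda,\mu,\nu)}\frac{G_\mu(N,\gamma)}{G_0(N,\gamma)}\frac{C_\mu(N)}{C_\nu(N)}\,D^{(L)}_{\mu\nu}\,\mathcal L^{(\gamma)}_\lambda(t)\,S_\mu(T^{-1}),$$ $$\mathbb E^{(J)}_N\!\left[\frac{\prod_{j=1}^p\det(t_j-M)}{\prod_{k=1}^q\det(T_k-M)}\right]=\prod_{j=N}^{p+N-1}(-1)^jj!\,\frac{\Gamma(j+\gamma_1+\gamma_2+1)}{\Gamma(2j+\gamma_1+\gamma_2+1)}\ \prod_{k=0}^{N-1}\Gamma(2k+\gamma_1+\gamma_2+2)\ \prod_{l=1}^q\frac1{T_l^N}\sum_{(\lambda,\mu,\nu)}\frac{G_\mu(N,\gamma_1)}{G_0(N,\gamma_1)}\frac{G_\nu(N,\gamma_2)}{G_0(N,\gamma_2)}\frac{C_\mu(N)}{C_\nu(N)}\,\mathcal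 D^{(J)}_{\mu\nu}\,\mathcal J^{(\gamma_1,\gamma_2)}_\lambda(t)\,S_\mu(T^{-1}).$$ Each sum runs over all triples of partitions with $\lambda\subseteq(N^p)$, $\nu=\tilde\lambda$, $l(\mu)\le N$ and $\nu\subseteq\mu$. -/

import Mathlib

open MeasureTheory

noncomputable section

namespace UnitaryEnsemble

/-! ### Partitions

A partition is a `YoungDiagram`; `lam.rowLen i` is the part with (0-based) index `i`,
`lam.colLen 0` is the length, `lam.card` the weight, `≤` the containment of diagrams. -/

/-- The rectangular partition `(N^p)`: `p` rows of length `N`. -/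
def rect (p N : ℕ) : YoungDiagram where
  cells := Finset.range p ×ˢ Finset.range N
  isLowerSet := by
    rintro ⟨a, b⟩ ⟨c, d⟩ h hab
    simp only [Finset.coe_product, Finset.coe_range, Set.mem_prod, Set.mem_Iio] at *
    exact ⟨lt_of_le_of_lt h.1 hab.1, lt_of_le_of_lt h.2 hab.2⟩

/-- For `lam ⊆ (N^p)`, the partition `(p - lam'_N, …, p - lam'_1)`, where `lam'` is the conjugate
partition: the cells of the complement of `lam` in the rectangle, rotated and transposed. -/
def tilde (p N : ℕ) (lam : YoungDiagram) : YoungDiagram where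
  cells := (Finset.range N ×ˢ Finset.range p).filter
    fun c => (p - 1 - c.2, N - 1 - c.1) ∉ lam
  isLowerSet := by
    rintro ⟨a, b⟩ ⟨c, d⟩ h hab
    have h1 : c ≤ a := h.1
    have h2 : d ≤ b := h.2
    simp only [Finset.coe_filter, Finset.mem_product, Finset.mem_range, Set.mem_ofPred_eq] at *
    refine ⟨⟨by omega, by omega⟩, fun hm => hab.2 (lam.up_left_mem ?_ ?_ hm)⟩ <;> omega

/-- The rows of `tilde p N lam` are the numbers `p - lam'_{N+1-i}` (here with 0-based `i`). -/
theorem rowLen_tilde (p N : ℕ) (lam : YoungDiagram) (i : ℕ) (hi : i < N) :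
    (tilde p N lam).rowLen i = p - lam.colLen (N - 1 - i) := by
  have key : ∀ j, j < (tilde p N lam).rowLen i ↔ j < p - lam.colLen (N - 1 - i) := by
    intro j
    rw [← YoungDiagram.mem_iff_lt_rowLen, ← YoungDiagram.mem_cells]
    simp only [tilde, Finset.mem_filter, Finset.mem_product, Finset.mem_range,
      YoungDiagram.mem_iff_lt_colLen]
    omega
  exact le_antisymm (le_of_not_gt fun h => lt_irrefl _ ((key _).1 h))
    (le_of_not_gt fun h => lt_irrefl _ ((key _).2 h))

/-! ### Multivariate polynomials given by a quotient of determinants -/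

/-- The Vandermonde product `∏_{i<j} (x_i - x_j)`. -/
def vandermonde (n : ℕ) : MvPolynomial (Fin n) ℝ :=
  ∏ i : Fin n, ∏ j ∈ Finset.Ioi i, (MvPolynomial.X i - MvPolynomial.X j)

/-- The determinant of the matrix `φ_{lam_i + n - i}(x_j)`, `i, j = 1, …, n`. -/
def alternant (φ : ℕ → Polynomial ℝ) (n : ℕ) (lam : YoungDiagram) : MvPolynomial (Fin n) ℝ :=
  Matrix.det (Matrix.of fun i j : Fin n =>
    Polynomial.aeval (MvPolynomial.X j : MvPolynomial (Fin n) ℝ)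
      (φ (lam.rowLen i + (n - 1 - i))))

/-- Newton interpolation of a polynomial at the first `m` nodes of `x`, with remainder. -/
theorem newton_expansion {R : Type*} [CommRing R] (x : ℕ → R) (f : Polynomial R) (m : ℕ) :
    ∃ (c : ℕ → R) (g : Polynomial R),
      f = (∑ k ∈ Finset.range m, Polynomial.C (c k) *
        ∏ l ∈ Finset.range k, (Polynomial.X - Polynomial.C (x l))) +
        g * ∏ l ∈ Finset.range m, (Polynomial.X - Polynomial.C (x l)) := by
  induction m with
  | zero => exact ⟨0, f, by simp⟩
  | succ m ih =>
    obtain ⟨c, g, h⟩ := ih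
    refine ⟨Function.update c m (g.eval (x m)), g /ₘ (Polynomial.X - Polynomial.C (x m)), ?_⟩
    have hg : (Polynomial.X - Polynomial.C (x m)) * (g /ₘ (Polynomial.X - Polynomial.C (x m))) +
        Polynomial.C (g.eval (x m)) = g := by
      have h1 := Polynomial.modByMonic_add_div g (Polynomial.X - Polynomial.C (x m))
      rw [Polynomial.modByMonic_X_sub_C_eq_C_eval] at h1
      rw [add_comm]
      exact h1
    rw [Finset.sum_range_succ, Finset.prod_range_succ]
    have hs : ∀ k ∈ Finset.range m, Function.update c m (g.eval (x m)) k = c k := by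
      intro k hk
      exact Function.update_of_ne (Finset.mem_range.1 hk).ne _ _
    rw [Finset.sum_congr rfl fun k hk => by rw [hs k hk], Function.update_self]
    nth_rewrite 1 [h, ← hg]
    ring

theorem vandermonde_dvd_alternant (φ : ℕ → Polynomial ℝ) (n : ℕ) (lam : YoungDiagram) :
    vandermonde n ∣ alternant φ n lam := by
  let x : ℕ → MvPolynomial (Fin n) ℝ := fun i =>
    if h : i < n then MvPolynomial.X ⟨i, h⟩ else 0
  have hx : ∀ i : Fin n, x i = MvPolynomial.X i := fun i => by simp [x]
  choose c g hcg using fun i : Fin n => newton_expansion x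
    ((φ (lam.rowLen i + (n - 1 - i))).map (algebraMap ℝ (MvPolynomial (Fin n) ℝ))) n
  let U : Matrix (Fin n) (Fin n) (MvPolynomial (Fin n) ℝ) :=
    Matrix.of fun k j => ∏ l ∈ Finset.range k, (x j - x l)
  let A : Matrix (Fin n) (Fin n) (MvPolynomial (Fin n) ℝ) := Matrix.of fun i k => c i k
  have hmul : (Matrix.of fun i j : Fin n =>
      Polynomial.aeval (MvPolynomial.X j : MvPolynomial (Fin n) ℝ)
        (φ (lam.rowLen i + (n - 1 - i)))) = A * U := by
    ext1 i j
    have h0 : ∏ l ∈ Finset.range n, (x j - x l) = 0 :=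
      Finset.prod_eq_zero (Finset.mem_range.2 j.2) (sub_self _)
    rw [Matrix.of_apply, ← hx j, Polynomial.aeval_def, ← Polynomial.eval_map, hcg i,
      Matrix.mul_apply]
    simp only [Polynomial.eval_add, Polynomial.eval_mul, Polynomial.eval_finsetSum,
      Polynomial.eval_prod, Polynomial.eval_sub, Polynomial.eval_X, Polynomial.eval_C, h0,
      mul_zero, add_zero]
    rw [Finset.sum_range]
    rfl
  have hU : U.det = ∏ i : Fin n, ∏ l ∈ Finset.range i, (x i - x l) := by
    apply Matrix.det_of_isUpperTriangular
    intro k j hkj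
    exact Finset.prod_eq_zero (Finset.mem_range.2 hkj) (sub_self _)
  have hV : vandermonde n ∣ U.det := by
    have h1 : vandermonde n =
        ∏ i : Fin n, ∏ l ∈ Finset.Iio i, (MvPolynomial.X l - MvPolynomial.X i) := by
      unfold vandermonde
      exact Finset.prod_comm' (by simp)
    rw [h1, hU]
    refine Finset.prod_dvd_prod_of_dvd _ _ fun i _ => ?_
    have h2 : ∏ l ∈ Finset.range i, (x i - x l) =
        ∏ l ∈ Finset.Iio i, (x i - x (l : ℕ)) := by
      refine Eq.trans ?_ (Finset.prod_map (Finset.Iio i) Fin.valEmbedding fun l => x i - x l)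
      congr 1
      ext l
      simp only [Finset.mem_range, Finset.mem_map, Finset.mem_Iio, Fin.valEmbedding_apply]
      exact ⟨fun h => ⟨⟨l, h.trans i.2⟩, h, rfl⟩, by rintro ⟨a, h, rfl⟩; exact h⟩
    rw [h2]
    refine Finset.prod_dvd_prod_of_dvd _ _ fun l _ => ?_
    rw [hx, hx, ← neg_sub, neg_dvd]
  unfold alternant
  rw [hmul, Matrix.det_mul]
  exact hV.mul_left _

/-- The multivariate polynomial `Φ_lam(x_1, …, x_n) = det[φ_{lam_i + n - i}(x_j)] / Δ(x)` attached
to a sequence `φ_0, φ_1, …` of polynomials in one variable, for partitions with at most `n` parts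
(and `0` for longer partitions): the exact quotient in the polynomial ring. -/
def multiPoly (φ : ℕ → Polynomial ℝ) (n : ℕ) (lam : YoungDiagram) : MvPolynomial (Fin n) ℝ :=
  if lam.colLen 0 ≤ n then (vandermonde_dvd_alternant φ n lam).choose else 0

theorem vandermonde_mul_multiPoly (φ : ℕ → Polynomial ℝ) (n : ℕ) (lam : YoungDiagram)
    (h : lam.colLen 0 ≤ n) : vandermonde n * multiPoly φ n lam = alternant φ n lam := by
  rw [multiPoly, if_pos h]
  exact (vandermonde_dvd_alternant φ n lam).choose_spec.symm

/-- The Schur polynomial `S_lam(x_1, …, x_n)`. -/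
def schur (n : ℕ) (lam : YoungDiagram) : MvPolynomial (Fin n) ℝ :=
  multiPoly (fun k => Polynomial.X ^ k) n lam

/-- Monic Hermite polynomials, orthogonal with respect to `exp (-x²/2)`. -/
def hermitePoly (n : ℕ) : Polynomial ℝ :=
  (Polynomial.hermite n).map (Int.castRingHom ℝ)

/-- The Laguerre polynomial `L_n^{(γ)}`. -/
def laguerrePoly (γ : ℝ) (n : ℕ) : Polynomial ℝ :=
  ∑ j ∈ Finset.range (n + 1),
    Polynomial.C ((-1) ^ j * (Real.Gamma (n + γ + 1) /
      (Real.Gamma (j + γ + 1) * (n - j).factorial * j.factorial))) * Polynomial.X ^ j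

/-- The Jacobi polynomial `J_n^{(γ₁,γ₂)}` on `[0,1]`. The quotient
`Γ(n + j + γ₁ + γ₂ + 1) / Γ(n + γ₁ + γ₂ + 1)` is written as a rising factorial, which is its
value also in the case `n = 0`, `γ₁ + γ₂ = -1`, where both Gamma functions have a pole. -/
def jacobiPoly (γ₁ γ₂ : ℝ) (n : ℕ) : Polynomial ℝ :=
  ∑ j ∈ Finset.range (n + 1),
    Polynomial.C ((-1) ^ j / (j.factorial * (n - j).factorial) *
      (ascPochhammer ℝ j).eval (n + γ₁ + γ₂ + 1) *
      (Real.Gamma (n + γ₁ + 1) / Real.Gamma (j + γ₁ + 1))) * Polynomial.X ^ j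

/-- The multivariate Hermite polynomial `𝓗_lam(t_1, …, t_p)`. -/
def multiHermite {p : ℕ} (lam : YoungDiagram) (t : Fin p → ℂ) : ℂ :=
  MvPolynomial.aeval t (multiPoly hermitePoly p lam)

/-- The multivariate Laguerre polynomial `𝓛_lam^{(γ)}(t_1, …, t_p)`. -/
def multiLaguerre {p : ℕ} (γ : ℝ) (lam : YoungDiagram) (t : Fin p → ℂ) : ℂ :=
  MvPolynomial.aeval t (multiPoly (laguerrePoly γ) p lam)

/-- The multivariate Jacobi polynomial `𝓙_lam^{(γ₁,γ₂)}(t_1, …, t_p)`. -/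
def multiJacobi {p : ℕ} (γ₁ γ₂ : ℝ) (lam : YoungDiagram) (t : Fin p → ℂ) : ℂ :=
  MvPolynomial.aeval t (multiPoly (jacobiPoly γ₁ γ₂) p lam)

/-! ### Constants (for partitions with at most `N` parts) -/

/-- `C_lam(N) = ∏_{j=1}^N (lam_j + N - j)! / (N - j)!`. -/
def constC (N : ℕ) (lam : YoungDiagram) : ℝ :=
  ∏ j : Fin N, ((lam.rowLen j + (N - 1 - j)).factorial : ℝ) / ((N - 1 - j).factorial : ℝ)

/-- `G_lam(N, γ) = ∏_{j=1}^N Γ(lam_j + N - j + γ + 1)`. -/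
def constG (N : ℕ) (γ : ℝ) (lam : YoungDiagram) : ℝ :=
  ∏ j : Fin N, Real.Gamma (lam.rowLen j + (N - ((j : ℕ) + 1)) + γ + 1)

/-- The integer `mu_j - nu_k - j + k`. -/
def shift (mu nu : YoungDiagram) (j k : ℕ) : ℤ :=
  (mu.rowLen j : ℤ) - nu.rowLen k - j + k

/-- `D^{(H)}_{mu nu}`, the determinant of `1_{a even} / (a/2)!`, `a = mu_j - nu_k - j + k`,
with the convention that `1/m! = 0` for negative `m`. -/
def detH (mu nu : YoungDiagram) : ℝ :=
  Matrix.det (Matrix.of fun j k : Fin (mu.colLen 0) =>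
    if 0 ≤ shift mu nu j k ∧ Even (shift mu nu j k) then
      (((shift mu nu j k).toNat / 2).factorial : ℝ)⁻¹ else 0)

/-- `D^{(L)}_{mu nu}`, the determinant of `1_{a ≥ 0} / a!`, `a = mu_j - nu_k - j + k`. -/
def detL (mu nu : YoungDiagram) : ℝ :=
  Matrix.det (Matrix.of fun j k : Fin (mu.colLen 0) =>
    if 0 ≤ shift mu nu j k then ((shift mu nu j k).toNat.factorial : ℝ)⁻¹ else 0)

/-- `𝓓^{(J)}_{mu nu}`, the `N × N` determinant of
`1_{a ≥ 0} / (a! Γ(2N + mu_j + nu_k - j - k + γ₁ + γ₂ + 2))`, `a = mu_j - nu_k - j + k`. -/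
def detJ (N : ℕ) (γ₁ γ₂ : ℝ) (mu nu : YoungDiagram) : ℝ :=
  Matrix.det (Matrix.of fun j k : Fin N =>
    if 0 ≤ shift mu nu j k then
      (((shift mu nu j k).toNat.factorial : ℝ) *
        Real.Gamma (2 * N + mu.rowLen j + nu.rowLen k - ((j : ℕ) + 1) - ((k : ℕ) + 1)
          + γ₁ + γ₂ + 2))⁻¹
    else 0)

/-! ### The ensembles -/

/-- The Gaussian weight. -/
def gaussianWeight (x : ℝ) : ℝ := Real.exp (-x ^ 2 / 2)

/-- The Laguerre weight. -/
def laguerreWeight (γ : ℝ) (x : ℝ) : ℝ := if 0 < x then x ^ γ * Real.exp (-x) else 0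

/-- The Jacobi weight. -/
def jacobiWeight (γ₁ γ₂ : ℝ) (x : ℝ) : ℝ :=
  if 0 < x ∧ x < 1 then x ^ γ₁ * (1 - x) ^ γ₂ else 0

/-- The measure on `ℝ^N` with density `∏_{i<j} (x_i - x_j)² ∏_i w(x_i)`. -/
def unnormalizedLaw (w : ℝ → ℝ) (N : ℕ) : Measure (Fin N → ℝ) :=
  volume.withDensity fun x => ENNReal.ofReal
    ((∏ i : Fin N, ∏ j ∈ Finset.Ioi i, (x i - x j) ^ 2) * ∏ i, w (x i))

/-- The probability measure on `ℝ^N` with density proportional to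
`∏_{i<j} (x_i - x_j)² ∏_i w(x_i)`. -/
def eigenvalueLaw (w : ℝ → ℝ) (N : ℕ) : Measure (Fin N → ℝ) :=
  (unnormalizedLaw w N Set.univ)⁻¹ • unnormalizedLaw w N

/-- `M` is a random Hermitian `N × N` matrix whose (unordered) eigenvalues have the joint law
`eigenvalueLaw w N`: every event that does not depend on the labelling of the eigenvalues has
the probability given by that law. -/
structure IsEnsemble {Ω : Type*} [MeasurableSpace Ω] (P : Measure Ω) (w : ℝ → ℝ) {N : ℕ}
    (M : Ω → Matrix (Fin N) (Fin N) ℂ) : Prop where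
  measurable : ∀ i j, Measurable fun ω => M ω i j
  isHermitian : ∀ ω, (M ω).IsHermitian
  law : ∀ A : Set (Fin N → ℝ), MeasurableSet A →
    (∀ (σ : Equiv.Perm (Fin N)) (x : Fin N → ℝ), x ∈ A → x ∘ σ ∈ A) →
    P {ω | (isHermitian ω).eigenvalues ∈ A} = eigenvalueLaw w N A

/-! ### Formal power series in `T_1⁻¹, …, T_q⁻¹` -/

/-- The expansion of `∏_j det(t_j - M) / ∏_k det(T_k - M)` as a formal power series in the
variables `T_k⁻¹`, which are the variables `X k` of the ring of power series; that is,
`1 / det(T_k - M) = T_k^{-N} / det(1 - T_k⁻¹ M)`. -/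
def charRatio {N p : ℕ} (t : Fin p → ℂ) (q : ℕ) (M : Matrix (Fin N) (Fin N) ℂ) :
    MvPowerSeries (Fin q) ℂ :=
  MvPowerSeries.C (∏ j, (Matrix.scalar (Fin N) (t j) - M).det) *
    ∏ k : Fin q, (MvPowerSeries.X k ^ N *
      (1 - (MvPowerSeries.X k : MvPowerSeries (Fin q) ℂ) • M.map MvPowerSeries.C).det⁻¹)

/-- In the fraction field of the ring of power series, where `T_k = (X k)⁻¹`, the series
`charRatio t q M` is the quotient `∏_j det(t_j - M) / ∏_k det(T_k - M)`. -/
theorem charRatio_eq {N p : ℕ} (t : Fin p → ℂ) (q : ℕ) (M : Matrix (Fin N) (Fin N) ℂ) :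
    let φ := algebraMap (MvPowerSeries (Fin q) ℂ) (FractionRing (MvPowerSeries (Fin q) ℂ))
    φ (charRatio t q M) =
      (∏ j, φ (MvPowerSeries.C (Matrix.scalar (Fin N) (t j) - M).det)) /
        ∏ k : Fin q, (Matrix.scalar (Fin N) (φ (MvPowerSeries.X k))⁻¹ -
          M.map (fun a => φ (MvPowerSeries.C a))).det := by
  intro φ
  have hX : ∀ k : Fin q, φ (MvPowerSeries.X k) ≠ 0 := fun k => by
    rw [Ne, FaithfulSMul.algebraMap_eq_zero_iff]
    intro h0
    have h1 := congrArg (MvPowerSeries.coeff (Finsupp.single k 1)) h0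
    rw [MvPowerSeries.coeff_index_single_self_X, map_zero] at h1
    exact one_ne_zero h1
  unfold charRatio
  rw [map_mul, map_prod, map_prod, map_prod, div_eq_mul_inv, ← Finset.prod_inv_distrib]
  congr 1
  refine Finset.prod_congr rfl fun k _ => ?_
  set B : Matrix (Fin N) (Fin N) (MvPowerSeries (Fin q) ℂ) :=
    1 - (MvPowerSeries.X k : MvPowerSeries (Fin q) ℂ) • M.map MvPowerSeries.C with hB
  have hc : MvPowerSeries.constantCoeff B.det ≠ 0 := by
    have : (MvPowerSeries.constantCoeff (σ := Fin q) (R := ℂ)).mapMatrix B = 1 := by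
      ext i j
      simp [hB, Matrix.one_apply, apply_ite]
    rw [RingHom.map_det, this]
    simp
  have hinv : φ B.det * φ B.det⁻¹ = 1 := by
    rw [← map_mul, MvPowerSeries.mul_inv_cancel _ hc, map_one]
  have hmat : Matrix.scalar (Fin N) (φ (MvPowerSeries.X k))⁻¹ -
      M.map (fun a => φ (MvPowerSeries.C a)) =
      (φ (MvPowerSeries.X k))⁻¹ • φ.mapMatrix B := by
    ext i j
    by_cases h : i = j
    · subst h
      simp [hB, mul_sub, hX k]
    · simp [hB, h, hX k]
  rw [hmat, Matrix.det_smul, ← RingHom.map_det, Fintype.card_fin, mul_inv, map_mul, map_pow,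
    inv_pow, inv_inv]
  congr 1
  exact eq_inv_of_mul_eq_one_right hinv

/-- The expectation of a random formal power series, coefficient by coefficient. -/
def expectation {Ω : Type*} [MeasurableSpace Ω] (P : Measure Ω) {q : ℕ}
    (F : Ω → MvPowerSeries (Fin q) ℂ) : MvPowerSeries (Fin q) ℂ :=
  fun d => ∫ ω, MvPowerSeries.coeff d (F ω) ∂P

/-- All coefficients are integrable, so that `expectation P F` is meaningful. -/
def HasExpectation {Ω : Type*} [MeasurableSpace Ω] (P : Measure Ω) {q : ℕ}
    (F : Ω → MvPowerSeries (Fin q) ℂ) : Prop :=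
  ∀ d, Integrable (fun ω => MvPowerSeries.coeff d (F ω)) P

/-- `S` is the sum of the family `f` of formal power series: every monomial occurs in only finitely
many members of the family, and its coefficients add up to its coefficient in `S`. -/
def HasFormalSum {ι : Type*} {q : ℕ} (f : ι → MvPowerSeries (Fin q) ℂ)
    (S : MvPowerSeries (Fin q) ℂ) : Prop :=
  ∀ d, (Function.support fun i => MvPowerSeries.coeff d (f i)).Finite ∧
    ∑ᶠ i, MvPowerSeries.coeff d (f i) = MvPowerSeries.coeff d S

/-- The Schur polynomial `S_mu(T_1⁻¹, …, T_q⁻¹)` as a power series in the `T_k⁻¹`. -/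
def schurInv (q : ℕ) (mu : YoungDiagram) : MvPowerSeries (Fin q) ℂ :=
  ((MvPolynomial.map (algebraMap ℝ ℂ) (schur q mu) : MvPolynomial (Fin q) ℂ) :
    MvPowerSeries (Fin q) ℂ)

/-- The index set of the triple sum: partitions `lam ⊆ (N^p)`, `mu` and `nu ⊆ mu` with
`tilde lam = nu`, where `mu` has at most `N` parts. -/
structure Triple (p N : ℕ) where
  lam : YoungDiagram
  mu : YoungDiagram
  nu : YoungDiagram
  lam_le : lam ≤ rect p N
  tilde_eq : tilde p N lam = nu
  nu_le : nu ≤ mu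
  length_le : mu.colLen 0 ≤ N

end UnitaryEnsemble

end

noncomputable section

namespace UnitaryEnsemble

/-! ### Diagrams in a box and strictly decreasing sequences -/

/-! Write x_1, …, x_N for the eigenvalues, Δ for the Vandermonde product and X_k for 1/T_k. The
joint density contains Δ(x) twice, and each copy absorbs one half of the ratio.

One copy goes to the numerator. Up to leading coefficients, Δ(t) Δ(x) ∏ (t_j - x_i) is a single
determinant of size p + N in φ_0, …, φ_{p+N-1}. Laplace expansion along the p rows belonging to t
gives a signed sum over λ ⊆ (N^p) of Φ_λ(t) det[φ_{ν_i+N-i}(x_j)] with ν = λ̃, because the exponents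
of λ and of λ̃ together fill {0, …, p+N-1}. This is `dual_cauchy`. The other copy goes to the
denominator: Δ(x) ∏ 1/(1 - x_i X_k) is the sum over μ of det[x_j^{μ_i+N-i}] S_μ(X). This is
`cauchy_identity`, obtained from the Jacobi–Trudi formula `schurInv_eq_det`.

What remains is the integral of a product of two determinants against a product weight. Andréief's
identity `integral_det_mul_det` makes it N! times the determinant of the moments ∫ x^{μ_i+N-i}
φ_{ν_j+N-j} w. By orthogonality a moment vanishes if the power of x is below the degree of φ, and
then the determinant vanishes unless ν ⊆ μ (`det_eq_zero_of_not_le`): this produces the triples. The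
normalisation is the case μ = ν = ∅, where the determinant is triangular.

Thus `IsOrthogonal.expectation_charRatio` treats all three ensembles at once, and they differ only
in their moments. Each moment is a row factor times a column factor times a function of the shift
μ_j - ν_k - j + k (in the Jacobi case also of the sum of the exponents), so its determinant splits
into the stated constants.

No limits are interchanged: S_μ(X) has no terms of degree below μ_1, so a fixed monomial sees only
finitely many μ. The law of the eigenvalues is given on permutation-invariant events only, which
suffices because the coefficients are symmetric functions of the eigenvalues. -/

theorem rowLen_eq_zero_of_colLen_le {lam : YoungDiagram} {i : ℕ} (h : lam.colLen 0 ≤ i) :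
    lam.rowLen i = 0 := by
  by_contra h0
  have h1 : (i, 0) ∈ lam := YoungDiagram.mem_iff_lt_rowLen.2 (Nat.pos_of_ne_zero h0)
  rw [YoungDiagram.mem_iff_lt_colLen] at h1
  omega

theorem rowLen_pos_of_lt_colLen {lam : YoungDiagram} {i : ℕ} (h : i < lam.colLen 0) :
    0 < lam.rowLen i :=
  YoungDiagram.mem_iff_lt_rowLen.1 (YoungDiagram.mem_iff_lt_colLen.2 h)

theorem le_iff_rowLen_le {lam mu : YoungDiagram} :
    lam ≤ mu ↔ ∀ i, lam.rowLen i ≤ mu.rowLen i := by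
  constructor
  · intro h i
    by_contra hlt
    have h1 : (i, mu.rowLen i) ∈ lam := YoungDiagram.mem_iff_lt_rowLen.2 (not_le.1 hlt)
    exact lt_irrefl _ (YoungDiagram.mem_iff_lt_rowLen.1 (h h1))
  · rintro h ⟨i, j⟩ hc
    exact YoungDiagram.mem_iff_lt_rowLen.2 ((YoungDiagram.mem_iff_lt_rowLen.1 hc).trans_le (h i))

theorem eq_of_rowLen_eq {lam mu : YoungDiagram} (h : ∀ i, lam.rowLen i = mu.rowLen i) :
    lam = mu :=
  le_antisymm (le_iff_rowLen_le.2 fun i => (h i).le) (le_iff_rowLen_le.2 fun i => (h i).ge)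

theorem mem_rect {p N : ℕ} {c : ℕ × ℕ} : c ∈ rect p N ↔ c.1 < p ∧ c.2 < N := by
  rw [← YoungDiagram.mem_cells]
  simp [rect]

theorem le_rect_iff {n L : ℕ} {lam : YoungDiagram} :
    lam ≤ rect n L ↔ lam.colLen 0 ≤ n ∧ ∀ i, lam.rowLen i ≤ L := by
  constructor
  · intro h
    constructor
    · by_contra hlt
      exact lt_irrefl n (mem_rect.1 (h (YoungDiagram.mem_iff_lt_colLen.2 (not_le.1 hlt)))).1
    · intro i
      by_contra hlt
      exact lt_irrefl L (mem_rect.1 (h (YoungDiagram.mem_iff_lt_rowLen.2 (not_le.1 hlt)))).2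
  · rintro ⟨h1, h2⟩ ⟨i, j⟩ hc
    have h3 : j < lam.rowLen i := YoungDiagram.mem_iff_lt_rowLen.1 hc
    refine mem_rect.2 ⟨?_, h3.trans_le (h2 i)⟩
    by_contra hi
    rw [rowLen_eq_zero_of_colLen_le (h1.trans (not_lt.1 hi))] at h3
    exact Nat.not_lt_zero _ h3

theorem finite_le_rect (n L : ℕ) : {lam : YoungDiagram | lam ≤ rect n L}.Finite := by
  refine Set.Finite.of_finite_image (f := YoungDiagram.cells)
    ((Finset.finite_toSet (rect n L).cells.powerset).subset ?_) ?_
  · rintro _ ⟨lam, h, rfl⟩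
    exact Finset.mem_coe.2 (Finset.mem_powerset.2 (YoungDiagram.cells_subset_iff.2 h))
  · intro a _ b _ h
    exact YoungDiagram.ext h

/-- The partitions contained in the rectangle `(L^n)`. -/
def boxes (n L : ℕ) : Finset YoungDiagram := (finite_le_rect n L).toFinset

theorem mem_boxes {n L : ℕ} {lam : YoungDiagram} : lam ∈ boxes n L ↔ lam ≤ rect n L := by
  simp [boxes]

/-- The exponents `lam_i + n - i`, with 0-based `i`. -/
def expo (n : ℕ) (lam : YoungDiagram) (i : Fin n) : ℕ := lam.rowLen i + (n - 1 - i)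

theorem rowLen_bot (i : ℕ) : (⊥ : YoungDiagram).rowLen i = 0 := by
  by_contra h
  exact YoungDiagram.notMem_bot _
    (YoungDiagram.mem_iff_lt_rowLen.2 (Nat.pos_of_ne_zero h) : (i, 0) ∈ _)

theorem expo_bot (n : ℕ) (i : Fin n) : expo n ⊥ i = n - 1 - i := by
  simp [expo, rowLen_bot]

theorem expo_strictAnti (n : ℕ) (lam : YoungDiagram) : StrictAnti (expo n lam) := by
  intro i j hij
  have h1 := lam.rowLen_anti i j (le_of_lt hij)
  have h2 : (i : ℕ) < j := hij
  have h3 := j.2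
  unfold expo
  omega

theorem expo_lt {n L : ℕ} {lam : YoungDiagram} (h : lam ≤ rect n L) (i : Fin n) :
    expo n lam i < n + L := by
  have h1 := (le_rect_iff.1 h).2 i
  have h2 := i.2
  unfold expo
  omega

theorem eq_of_expo_eq {n : ℕ} {lam mu : YoungDiagram} (hl : lam.colLen 0 ≤ n)
    (hm : mu.colLen 0 ≤ n) (h : expo n lam = expo n mu) : lam = mu := by
  refine eq_of_rowLen_eq fun i => ?_
  by_cases hi : i < n
  · have := congrFun h ⟨i, hi⟩
    simp only [expo] at this
    omega
  · rw [rowLen_eq_zero_of_colLen_le (hl.trans (not_lt.1 hi)),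
      rowLen_eq_zero_of_colLen_le (hm.trans (not_lt.1 hi))]

/-- A strictly decreasing sequence of naturals drops by at least 1 at each step, so `s i - (n - 1 -
i)` is nonnegative and weakly decreasing: these are the rows. -/
theorem exists_expo_eq {n L : ℕ} {s : Fin n → ℕ} (hs : StrictAnti s) (hL : ∀ i, s i < n + L) :
    ∃ lam ∈ boxes n L, expo n lam = s := by
  have hgap : ∀ i j : Fin n, i ≤ j → s j + (j - i : ℕ) ≤ s i := by
    intro i j
    obtain ⟨j, hj⟩ := j
    induction j with
    | zero =>
      intro hij
      have : i = ⟨0, hj⟩ := le_antisymm hij (Fin.mk_le_of_le_val (Nat.zero_le _))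
      subst this
      simp
    | succ j ih =>
      intro hij
      rcases eq_or_lt_of_le hij with h | h
      · subst h
        simp
      · have h1 := ih (by omega) (Nat.lt_succ_iff.1 h)
        have h2 : s ⟨j + 1, hj⟩ < s ⟨j, by omega⟩ := hs (Nat.lt_succ_self j)
        have h3 : (i : ℕ) < j + 1 := h
        simp only at h1 ⊢
        omega
  have hlow : ∀ i : Fin n, n - 1 - i ≤ s i := by
    intro i
    have h := hgap i ⟨n - 1, by have := i.2; omega⟩ (Fin.mk_le_of_le_val (by simp; omega))
    simp only at h
    omega
  let lam : YoungDiagram :=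
    { cells := (Finset.range n ×ˢ Finset.range L).filter
        fun c => ∀ h : c.1 < n, c.2 + (n - 1 - c.1) < s ⟨c.1, h⟩
      isLowerSet := by
        rintro ⟨a, b⟩ ⟨c, d⟩ h hab
        have h1 : c ≤ a := h.1
        have h2 : d ≤ b := h.2
        simp only [Finset.coe_filter, Finset.mem_product, Finset.mem_range,
          Set.mem_ofPred_eq] at *
        refine ⟨⟨by omega, by omega⟩, fun hc => ?_⟩
        have h3 := hab.2 hab.1.1
        have h4 := hgap ⟨c, hc⟩ ⟨a, hab.1.1⟩ h1
        simp only at h4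
        omega }
  have hrow : ∀ i : Fin n, lam.rowLen i = s i - (n - 1 - i) := by
    intro i
    have key : ∀ j, j < lam.rowLen i ↔ j < s i - (n - 1 - i) := by
      intro j
      rw [← YoungDiagram.mem_iff_lt_rowLen, ← YoungDiagram.mem_cells]
      simp only [lam, Finset.mem_filter, Finset.mem_product, Finset.mem_range]
      have h1 := hL i
      have h2 := hgap ⟨0, by have := i.2; omega⟩ i (Fin.mk_le_of_le_val (Nat.zero_le _))
      have h3 := hL ⟨0, by have := i.2; omega⟩
      have h4 := i.2
      simp only at h2
      constructor
      · rintro ⟨-, h⟩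
        have := h i.2
        simp only [Fin.eta] at this
        omega
      · intro h
        exact ⟨⟨i.2, by omega⟩, fun _ => by simp only [Fin.eta]; omega⟩
    exact le_antisymm (le_of_not_gt fun h => lt_irrefl _ ((key _).1 h))
      (le_of_not_gt fun h => lt_irrefl _ ((key _).2 h))
  refine ⟨lam, mem_boxes.2 ?_, ?_⟩
  · intro c hc
    rw [← YoungDiagram.mem_cells] at hc
    simp only [lam, Finset.mem_filter, Finset.mem_product, Finset.mem_range] at hc
    exact mem_rect.2 hc.1
  · funext i
    have := hlow i
    simp only [expo, hrow]
    omega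

/-! ### Expanding alternating maps over partitions -/

/-- A sum over all sequences reduces to a sum over partitions and permutations if the
non-injective sequences do not contribute. -/
theorem sum_piFinset_eq_sum_boxes {R : Type*} [AddCommMonoid R] {n L : ℕ}
    (F : (Fin n → ℕ) → R) (hF : ∀ r, ¬ Function.Injective r → F r = 0) :
    ∑ r ∈ Fintype.piFinset (fun _ : Fin n => Finset.range (n + L)), F r =
      ∑ lam ∈ boxes n L, ∑ σ : Equiv.Perm (Fin n), F (expo n lam ∘ σ) := by
  rw [← Finset.sum_product']
  symm
  refine Finset.sum_of_injOn (fun x : YoungDiagram × Equiv.Perm (Fin n) => expo n x.1 ∘ x.2)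
    ?_ ?_ ?_ fun _ _ => rfl
  · rintro ⟨lam, σ⟩ h1 ⟨mu, τ⟩ h2 h
    simp only [Finset.coe_product, Set.mem_prod, Finset.mem_coe, mem_boxes] at h1 h2
    simp only at h
    have hr : Set.range (expo n lam) = Set.range (expo n mu) := by
      rw [← σ.surjective.range_comp (expo n lam), h, τ.surjective.range_comp]
    have he := ((expo_strictAnti n lam).range_inj (expo_strictAnti n mu)).1 hr
    have hlm := eq_of_expo_eq (le_rect_iff.1 h1.1).1 (le_rect_iff.1 h2.1).1 he
    subst hlm
    refine Prod.ext rfl (Equiv.ext fun i => ?_)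
    exact (expo_strictAnti n lam).injective (congrFun h i)
  · rintro ⟨lam, σ⟩ h1
    simp only [Finset.coe_product, Set.mem_prod, Finset.mem_coe, mem_boxes] at h1
    simp only [Fintype.coe_piFinset, Set.mem_pi, Finset.coe_range, Set.mem_Iio,
      Function.comp_apply]
    exact fun i _ => expo_lt h1.1 _
  · intro r hr hn
    apply hF
    intro hinj
    apply hn
    simp only [Fintype.mem_piFinset, Finset.mem_range] at hr
    -- Sorting is increasing; composing with the reversal makes the sequence decreasing, as
    -- exponents of partitions are.
    let τ : Equiv.Perm (Fin n) := Fin.revPerm.trans (Tuple.sort r)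
    have hanti : StrictAnti (r ∘ τ) := by
      have hm : StrictMono (r ∘ Tuple.sort r) :=
        (Tuple.monotone_sort r).strictMono_of_injective (hinj.comp (Tuple.sort r).injective)
      intro i j hij
      exact hm (Fin.rev_lt_rev.2 hij)
    obtain ⟨lam, hl, he⟩ := exists_expo_eq hanti (L := L) fun i => hr _
    refine ⟨(lam, τ⁻¹), ?_, ?_⟩
    · simp [hl]
    · simp only [he]
      funext i
      simp

/-- Expansion of an alternating map along a spanning sequence. -/
theorem alternatingMap_sum_range {R E F : Type*} [CommRing R] [AddCommGroup E] [Module R E]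
    [AddCommGroup F] [Module R F] {n L : ℕ} (g : E [⋀^Fin n]→ₗ[R] F) (a : Fin n → ℕ → R)
    (b : ℕ → E) :
    g (fun i => ∑ c ∈ Finset.range (n + L), a i c • b c) =
      ∑ lam ∈ boxes n L, Matrix.det (Matrix.of fun i j => a i (expo n lam j)) •
        g (fun j => b (expo n lam j)) := by
  have h1 := g.toMultilinearMap.map_sum_finset (fun i c => a i c • b c)
    (fun _ => Finset.range (n + L))
  simp only [AlternatingMap.coe_multilinearMap] at h1
  rw [h1, sum_piFinset_eq_sum_boxes]
  · refine Finset.sum_congr rfl fun lam _ => ?_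
    rw [← Matrix.det_transpose, Matrix.det_apply, Finset.sum_smul]
    refine Finset.sum_congr rfl fun σ _ => ?_
    have h2 := g.toMultilinearMap.map_smul_univ (fun i => a i (expo n lam (σ i)))
      (fun i => b (expo n lam (σ i)))
    simp only [AlternatingMap.coe_multilinearMap] at h2
    have h3 := g.map_perm (fun j => b (expo n lam j)) σ
    simp only [Function.comp_def] at h3 ⊢
    rw [h2, h3]
    simp only [Matrix.transpose_apply, Matrix.of_apply]
    rw [smul_comm, smul_assoc]
  · intro r hr
    have h2 := g.toMultilinearMap.map_smul_univ (fun i => a i (r i)) (fun i => b (r i))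
    simp only [AlternatingMap.coe_multilinearMap] at h2
    rw [h2, g.map_eq_zero_of_not_injective, smul_zero]
    exact fun h => hr fun i j hij => h (congrArg b hij)

/-! ### Determinants indexed by a skew diagram -/

/-- Beyond the length of `mu` both diagrams have empty rows, so the last row of the larger matrix is
(0, …, 0, 1). -/
theorem det_skew_succ {R : Type*} [CommRing R] (e : ℤ → R) (h0 : e 0 = 1)
    (hneg : ∀ a < 0, e a = 0) {mu nu : YoungDiagram} (h : nu ≤ mu) {n : ℕ}
    (hn : mu.colLen 0 ≤ n) :
    Matrix.det (Matrix.of fun j k : Fin (n + 1) => e (shift mu nu j k)) =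
      Matrix.det (Matrix.of fun j k : Fin n => e (shift mu nu j k)) := by
  have hmu : mu.rowLen n = 0 := rowLen_eq_zero_of_colLen_le hn
  have hnu : nu.rowLen n = 0 := Nat.le_zero.1 (hmu ▸ le_iff_rowLen_le.1 h n)
  rw [Matrix.det_succ_row _ (Fin.last n), Fin.sum_univ_castSucc]
  have hz : ∀ k : Fin n, e (shift mu nu (Fin.last n : Fin (n + 1)) (k.castSucc : Fin (n + 1))) = 0 := by
    intro k
    apply hneg
    have := k.2
    simp only [shift, Fin.val_last, Fin.val_castSucc, hmu]
    omega
  have ho : e (shift mu nu (Fin.last n : Fin (n + 1)) (Fin.last n : Fin (n + 1))) = 1 := by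
    simp [shift, hmu, hnu, h0]
  simp only [Matrix.of_apply, hz, ho, mul_zero, zero_mul, Finset.sum_const_zero, zero_add, mul_one,
    Fin.succAbove_last]
  rw [Even.neg_one_pow ⟨_, rfl⟩, one_mul]
  rfl

/-- Determinants defined with size l(μ) can hence be compared with the N × N ones coming from
Andréief's identity, and Jacobi–Trudi determinants can be taken at any convenient size. -/
theorem det_skew_eq {R : Type*} [CommRing R] (e : ℤ → R) (h0 : e 0 = 1)
    (hneg : ∀ a < 0, e a = 0) {mu nu : YoungDiagram} (h : nu ≤ mu) {n : ℕ}
    (hn : mu.colLen 0 ≤ n) :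
    Matrix.det (Matrix.of fun j k : Fin n => e (shift mu nu j k)) =
      Matrix.det (Matrix.of fun j k : Fin (mu.colLen 0) => e (shift mu nu j k)) := by
  induction n, hn using Nat.le_induction with
  | base => rfl
  | succ n hn ih => rw [det_skew_succ e h0 hneg h hn, ih]

/-- If ν_r > μ_r, then all entries with column k ≤ r and row j ≥ r vanish, since μ_j ≤ μ_r < ν_r ≤
ν_k. A permutation avoiding this block would inject the r + 1 columns k ≤ r into the r rows above r.
-/
theorem det_eq_zero_of_not_le {R : Type*} [CommRing R] {n : ℕ} {mu nu : YoungDiagram}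
    (A : Matrix (Fin n) (Fin n) R) (hA : ∀ j k : Fin n, shift mu nu j k < 0 → A j k = 0)
    (hnu : nu.colLen 0 ≤ n) (h : ¬ nu ≤ mu) : A.det = 0 := by
  rw [le_iff_rowLen_le] at h
  push Not at h
  obtain ⟨r, hr⟩ := h
  have hrn : r < n := by
    by_contra hge
    rw [rowLen_eq_zero_of_colLen_le (hnu.trans (not_lt.1 hge))] at hr
    exact Nat.not_lt_zero _ hr
  rw [Matrix.det_apply]
  refine Finset.sum_eq_zero fun σ _ => ?_
  suffices hj : ∃ k : Fin n, (k : ℕ) ≤ r ∧ r ≤ (σ k : ℕ) by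
    obtain ⟨k, h1, h2⟩ := hj
    rw [Finset.prod_eq_zero (Finset.mem_univ k), smul_zero]
    apply hA
    have h3 := mu.rowLen_anti r (σ k) h2
    have h4 := nu.rowLen_anti k r h1
    unfold shift
    omega
  by_contra! hcon
  have hcard := Finset.card_le_card_of_injOn (s := Finset.Iic (⟨r, hrn⟩ : Fin n))
    (t := Finset.Iio (⟨r, hrn⟩ : Fin n)) σ
    (fun k hk => by
      simp only [Finset.coe_Iic, Set.mem_Iic, Finset.coe_Iio, Set.mem_Iio] at hk ⊢
      exact hcon k hk)
    σ.injective.injOn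
  simp only [Fin.card_Iic, Fin.card_Iio] at hcard
  omega

theorem det_skew_self {R : Type*} [CommRing R] {n : ℕ} {mu : YoungDiagram}
    (A : Matrix (Fin n) (Fin n) R) (hA : ∀ j k : Fin n, shift mu mu j k < 0 → A j k = 0) :
    A.det = ∏ j, A j j := by
  apply Matrix.det_of_isUpperTriangular
  intro j k hkj
  apply hA
  have h1 : (k : ℕ) < j := hkj
  have h2 := mu.rowLen_anti k j h1.le
  unfold shift
  omega

theorem det_skew_bot {R : Type*} [CommRing R] (e : ℤ → R) (h0 : e 0 = 1)
    (hneg : ∀ a < 0, e a = 0) (n : ℕ) :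
    Matrix.det (Matrix.of fun j k : Fin n => e (shift ⊥ ⊥ j k)) = 1 := by
  refine (det_skew_self (mu := ⊥) (Matrix.of fun j k : Fin n => e (shift ⊥ ⊥ j k))
    fun j k h => hneg _ h).trans (Finset.prod_eq_one fun j _ => ?_)
  have : shift ⊥ ⊥ (j : ℕ) j = 0 := by
    simp [shift]
  rw [Matrix.of_apply, this, h0]

theorem expo_sub_expo (n : ℕ) (mu nu : YoungDiagram) (j k : Fin n) :
    ((expo n mu j : ℕ) : ℤ) - expo n nu k = shift mu nu j k := by
  have := j.2
  have := k.2
  unfold expo shift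
  omega

theorem expo_lt_iff_shift (n : ℕ) (mu nu : YoungDiagram) (j k : Fin n) :
    expo n mu j < expo n nu k ↔ shift mu nu j k < 0 := by
  rw [← expo_sub_expo]
  omega

/-! ### The complementary diagram -/

theorem tilde_colLen_le (p N : ℕ) (lam : YoungDiagram) : (tilde p N lam).colLen 0 ≤ N := by
  by_contra h
  have h1 := YoungDiagram.mem_iff_lt_colLen.2 (not_le.1 h)
  rw [← YoungDiagram.mem_cells] at h1
  simp [tilde] at h1

/-- The cell in row i and column N - 1 - k decides which exponent is larger: if it lies in λ, then
λ_i ≥ N - k and the column has length at least i + 1; otherwise both bounds reverse. The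
unsimplified row index is the one occurring in `tilde`. -/
theorem mem_iff_lt_tilde (p N : ℕ) {lam : YoungDiagram} (i : Fin p) (k : Fin N) :
    (p - 1 - (p - 1 - (i : ℕ)), N - 1 - (k : ℕ)) ∈ lam ↔
      expo N (tilde p N lam) k < expo p lam i := by
  have hi := i.2
  have hk := k.2
  have h1 := YoungDiagram.mem_iff_lt_rowLen (μ := lam) (i := i) (j := N - 1 - k)
  have h2 := YoungDiagram.mem_iff_lt_colLen (μ := lam) (i := i) (j := N - 1 - k)
  have h3 := h1.symm.trans h2
  have e1 : p - 1 - (p - 1 - (i : ℕ)) = i := by omega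
  rw [e1, h1]
  unfold expo
  rw [rowLen_tilde p N lam k hk]
  omega

/-- Along the boundary path of λ in the rectangle, vertical steps carry the exponents of λ and
horizontal steps those of λ̃. The two sets are therefore disjoint, and by counting complementary in
{0, …, p+N-1} when λ fits in the rectangle. -/
theorem expo_ne_expo_tilde (p N : ℕ) {lam : YoungDiagram} (i : Fin p) (k : Fin N) :
    expo p lam i ≠ expo N (tilde p N lam) k := by
  have hi := i.2
  have hk := k.2
  have h1 := YoungDiagram.mem_iff_lt_rowLen (μ := lam) (i := i) (j := N - 1 - k)
  have h2 := YoungDiagram.mem_iff_lt_colLen (μ := lam) (i := i) (j := N - 1 - k)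
  have h3 := h1.symm.trans h2
  unfold expo
  rw [rowLen_tilde p N lam k hk]
  omega

theorem tilde_le_rect (p N : ℕ) (lam : YoungDiagram) : tilde p N lam ≤ rect N p := by
  intro c hc
  rw [← YoungDiagram.mem_cells] at hc
  simp only [tilde, Finset.mem_filter, Finset.mem_product, Finset.mem_range] at hc
  exact mem_rect.2 hc.1

/-- The exponents of `lam`, followed by those of `tilde p N lam`. -/
def joinExpo (p N : ℕ) (lam : YoungDiagram) : Fin (p + N) → ℕ :=
  Fin.append (expo p lam) (expo N (tilde p N lam))

theorem joinExpo_lt {p N : ℕ} {lam : YoungDiagram} (h : lam ≤ rect p N) (r : Fin (p + N)) :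
    joinExpo p N lam r < p + N := by
  refine Fin.addCases (fun i => ?_) (fun k => ?_) r
  · simp only [joinExpo, Fin.append_left]
    exact expo_lt h i
  · simp only [joinExpo, Fin.append_right]
    have := expo_lt (tilde_le_rect p N lam) k
    omega

theorem joinExpo_injective (p N : ℕ) (lam : YoungDiagram) :
    Function.Injective (joinExpo p N lam) := by
  intro r s
  refine Fin.addCases (fun i => ?_) (fun k => ?_) r <;>
    refine Fin.addCases (fun j => ?_) (fun l => ?_) s <;>
    simp only [joinExpo, Fin.append_left, Fin.append_right] <;> intro h
  · rw [(expo_strictAnti p lam).injective h]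
  · exact absurd h (expo_ne_expo_tilde p N i l)
  · exact absurd h.symm (expo_ne_expo_tilde p N j k)
  · rw [(expo_strictAnti N _).injective h]

/-- The permutation of the columns that moves those with exponents in `lam` to the front. -/
def joinPerm {p N : ℕ} {lam : YoungDiagram} (h : lam ≤ rect p N) : Equiv.Perm (Fin (p + N)) :=
  Equiv.ofBijective (fun r => Fin.rev ⟨joinExpo p N lam r, joinExpo_lt h r⟩)
    (Finite.injective_iff_bijective.1 fun _ _ hrs =>
      joinExpo_injective p N lam (Fin.mk.inj (Fin.rev_injective hrs)))

theorem rev_joinPerm {p N : ℕ} {lam : YoungDiagram} (h : lam ≤ rect p N) (r : Fin (p + N)) :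
    ((Fin.rev (joinPerm h r) : Fin (p + N)) : ℕ) = joinExpo p N lam r := by
  simp [joinPerm]

/-- The inversions between the two blocks correspond to the cells of the rectangle outside λ, which
become the cells of λ̃ after rotation and transposition. This is the source of the sign (-1)^{|ν|}.
-/
theorem card_tilde (p N : ℕ) (lam : YoungDiagram) :
    (Finset.univ.filter fun c : Fin p × Fin N =>
      expo p lam c.1 < expo N (tilde p N lam) c.2).card = (tilde p N lam).card := by
  refine Finset.card_bij (fun c _ => ((c.2 : ℕ), p - 1 - (c.1 : ℕ))) ?_ ?_ ?_
  · rintro ⟨i, k⟩ hc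
    simp only [Finset.mem_filter, Finset.mem_univ, true_and] at hc
    have hi := i.2
    simp only [tilde, Finset.mem_filter, Finset.mem_product, Finset.mem_range]
    refine ⟨⟨k.2, by omega⟩, ?_⟩
    rw [mem_iff_lt_tilde p N i k]
    exact not_lt.2 hc.le
  · rintro ⟨i, k⟩ _ ⟨j, l⟩ _ h
    simp only [Prod.mk.injEq] at h
    have hi := i.2
    have hj := j.2
    exact Prod.ext (Fin.ext (by simp only; omega)) (Fin.ext h.1)
  · rintro ⟨a, b⟩ hc
    simp only [tilde, Finset.mem_filter, Finset.mem_product, Finset.mem_range] at hc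
    have ha := hc.1.1
    have hb := hc.1.2
    refine ⟨(⟨p - 1 - b, by omega⟩, ⟨a, ha⟩), ?_, ?_⟩
    · simp only [Finset.mem_filter, Finset.mem_univ, true_and]
      have h1 := mem_iff_lt_tilde p N (lam := lam) ⟨p - 1 - b, by omega⟩ ⟨a, ha⟩
      have e1 : p - 1 - (p - 1 - (p - 1 - b)) = p - 1 - b := by omega
      simp only [e1] at h1
      have h2 := (not_congr h1).1 hc.2
      exact lt_of_le_of_ne (not_lt.1 h2) (expo_ne_expo_tilde p N _ _)
    · exact Prod.ext rfl (by simp only; omega)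

theorem castAdd_lt_castAdd_iff {p N : ℕ} (i j : Fin p) :
    Fin.castAdd N i < Fin.castAdd N j ↔ i < j := Iff.rfl

theorem castAdd_lt_natAdd_iff {p N : ℕ} (i : Fin p) (j : Fin N) :
    Fin.castAdd N i < Fin.natAdd p j ↔ True := by
  refine iff_of_true ?_ trivial
  rw [Fin.lt_def, Fin.val_castAdd, Fin.val_natAdd]
  omega

theorem natAdd_lt_castAdd_iff {p N : ℕ} (i : Fin p) (j : Fin N) :
    Fin.natAdd p j < Fin.castAdd N i ↔ False := by
  refine iff_of_false ?_ id
  rw [Fin.lt_def, Fin.val_castAdd, Fin.val_natAdd]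
  omega

theorem natAdd_lt_natAdd_iff {p N : ℕ} (i j : Fin N) :
    Fin.natAdd p i < Fin.natAdd p j ↔ i < j := by
  rw [Fin.lt_def, Fin.val_natAdd, Fin.val_natAdd, Fin.lt_def]
  omega

/-- Both blocks of exponents are decreasing, so inversions occur only between an exponent of λ and
one of λ̃. -/
theorem sign_joinPerm {p N : ℕ} {lam : YoungDiagram} (h : lam ≤ rect p N) :
    (joinPerm h).sign = (-1) ^ (tilde p N lam).card := by
  have hlt : ∀ r s, joinPerm h r < joinPerm h s ↔ joinExpo p N lam s < joinExpo p N lam r := by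
    intro r s
    rw [← Fin.rev_lt_rev, Fin.lt_def, rev_joinPerm, rev_joinPerm]
  have h1 : ∀ r : Fin (p + N), ∏ s ∈ Finset.Ioi r,
      (if joinPerm h r < joinPerm h s then (1 : ℤˣ) else -1) =
      ∏ s, if r < s then if joinExpo p N lam s < joinExpo p N lam r then (1 : ℤˣ) else -1 else 1 := by
    intro r
    rw [← Finset.prod_filter]
    refine Finset.prod_congr (by ext; simp) fun s _ => by simp only [hlt]
  have hS : ∀ i j : Fin p, (if i < j then
      if expo p lam j < expo p lam i then (1 : ℤˣ) else -1 else 1) = 1 := by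
    intro i j
    split_ifs with h1 h2
    · rfl
    · exact absurd (expo_strictAnti p lam h1) h2
    · rfl
  have hT : ∀ i j : Fin N, (if i < j then
      if expo N (tilde p N lam) j < expo N (tilde p N lam) i then (1 : ℤˣ) else -1 else 1) = 1 := by
    intro i j
    split_ifs with h1 h2
    · rfl
    · exact absurd (expo_strictAnti N _ h1) h2
    · rfl
  rw [Equiv.Perm.sign_eq_prod_prod_Ioi, Finset.prod_congr rfl fun r _ => h1 r, Fin.prod_univ_add]
  simp only [Fin.prod_univ_add, joinExpo, Fin.append_left, Fin.append_right]
  simp only [castAdd_lt_castAdd_iff, castAdd_lt_natAdd_iff, natAdd_lt_castAdd_iff,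
    natAdd_lt_natAdd_iff, hS, hT, if_true, if_false, Finset.prod_const_one, one_mul, mul_one]
  rw [← card_tilde, ← Finset.prod_const, Finset.prod_filter, ← Finset.univ_product_univ,
    Finset.prod_product]
  refine Finset.prod_congr rfl fun i _ => Finset.prod_congr rfl fun k _ => ?_
  have hne := expo_ne_expo_tilde p N (lam := lam) i k
  by_cases h2 : expo p lam i < expo N (tilde p N lam) k
  · rw [if_neg (not_lt.2 h2.le), if_pos h2]
  · rw [if_pos (lt_of_le_of_ne (not_lt.1 h2) hne.symm), if_neg h2]

/-! ### Determinants of polynomials -/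

/-- The Vandermonde product `∏_{i<j} (x_i - x_j)` of a family of elements of a ring. -/
def vdm {R : Type*} [CommRing R] {n : ℕ} (x : Fin n → R) : R :=
  ∏ i, ∏ j ∈ Finset.Ioi i, (x i - x j)

/-- The determinant of the matrix `φ_{lam_i + n - i}(x_j)`. -/
def altDet {R : Type*} [CommRing R] [Algebra ℝ R] (φ : ℕ → Polynomial ℝ) (n : ℕ)
    (lam : YoungDiagram) (x : Fin n → R) : R :=
  Matrix.det (Matrix.of fun i j => Polynomial.aeval (x j) (φ (expo n lam i)))

theorem vandermonde_eq_vdm (n : ℕ) : vandermonde n = vdm MvPolynomial.X := rfl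

theorem alternant_eq_altDet (φ : ℕ → Polynomial ℝ) (n : ℕ) (lam : YoungDiagram) :
    alternant φ n lam = altDet φ n lam MvPolynomial.X := rfl

theorem map_vdm {R S : Type*} [CommRing R] [CommRing S] (f : R →+* S) {n : ℕ} (x : Fin n → R) :
    f (vdm x) = vdm fun i => f (x i) := by
  simp [vdm, map_prod]

theorem map_altDet {R S : Type*} [CommRing R] [CommRing S] [Algebra ℝ R] [Algebra ℝ S]
    (f : R →ₐ[ℝ] S) (φ : ℕ → Polynomial ℝ) {n : ℕ} (lam : YoungDiagram) (x : Fin n → R) :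
    f (altDet φ n lam x) = altDet φ n lam fun i => f (x i) := by
  rw [altDet, AlgHom.map_det, altDet]
  congr 1
  ext i j
  simp [Polynomial.aeval_algHom_apply]

theorem vdm_aeval_multiPoly {R : Type*} [CommRing R] [Algebra ℝ R] (φ : ℕ → Polynomial ℝ) {n : ℕ}
    {lam : YoungDiagram} (h : lam.colLen 0 ≤ n) (x : Fin n → R) :
    vdm x * MvPolynomial.aeval x (multiPoly φ n lam) = altDet φ n lam x := by
  have h1 := congrArg (MvPolynomial.aeval x) (vandermonde_mul_multiPoly φ n lam h)
  rw [map_mul, vandermonde_eq_vdm, alternant_eq_altDet, map_altDet] at h1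
  have h2 := map_vdm (MvPolynomial.aeval (R := ℝ) x : MvPolynomial (Fin n) ℝ →+* R)
    MvPolynomial.X
  simp only [RingHom.coe_coe, MvPolynomial.aeval_X] at h1 h2
  rw [← h2, h1]

theorem vdm_ne_zero {R : Type*} [CommRing R] [IsDomain R] {n : ℕ} {x : Fin n → R}
    (hx : Function.Injective x) : vdm x ≠ 0 :=
  Finset.prod_ne_zero_iff.2 fun _ _ => Finset.prod_ne_zero_iff.2 fun _ hj =>
    sub_ne_zero.2 fun h => (Finset.mem_Ioi.1 hj).ne (hx h)

theorem vdm_eq_prod_ite {R : Type*} [CommRing R] {n : ℕ} (x : Fin n → R) :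
    vdm x = ∏ i, ∏ j, if i < j then x i - x j else 1 := by
  refine Finset.prod_congr rfl fun i _ => ?_
  rw [← Finset.prod_filter]
  exact Finset.prod_congr (by ext; simp) fun _ _ => rfl

/-- The mixed pairs contribute exactly the product of characteristic polynomials, which is why Δ(y)
Δ(x) ∏ (y_j - x_i) is a single determinant. -/
theorem vdm_append {R : Type*} [CommRing R] {p N : ℕ} (y : Fin p → R) (x : Fin N → R) :
    vdm (Fin.append y x) = vdm y * vdm x * ∏ j, ∏ i, (y j - x i) := by
  simp only [vdm_eq_prod_ite, Fin.prod_univ_add, Fin.append_left, Fin.append_right,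
    castAdd_lt_castAdd_iff, castAdd_lt_natAdd_iff, natAdd_lt_castAdd_iff,
    natAdd_lt_natAdd_iff,
    if_true, if_false, Finset.prod_const_one, Finset.prod_mul_distrib]
  ring

/-- The passage from monomials to φ is triangular with the leading coefficients on the diagonal.
Reversing the columns puts high degrees first, which yields ∏ (x_i - x_j) over i < j without a sign.
-/
theorem det_rev_eq_vdm {R : Type*} [CommRing R] [Algebra ℝ R] {φ : ℕ → Polynomial ℝ}
    (hφ : ∀ k, (φ k).natDegree ≤ k) {n : ℕ} (x : Fin n → R) :
    Matrix.det (Matrix.of fun i j : Fin n => Polynomial.aeval (x i) (φ (Fin.rev j : Fin n))) =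
      algebraMap ℝ R (∏ k ∈ Finset.range n, (φ k).coeff k) * vdm x := by
  rw [← Matrix.det_submatrix_equiv_self Fin.revPerm]
  have h1 := Matrix.eval_matrixOfPolynomials_eq_vandermonde_mul_matrixOfPolynomials
    (fun i => x (Fin.rev i)) (fun j : Fin n => (φ j).map (algebraMap ℝ R))
    fun i => (Polynomial.natDegree_map_le).trans (hφ i)
  have h2 : (Matrix.of fun i j : Fin n => Polynomial.aeval (x i) (φ (Fin.rev j : Fin n))).submatrix
      Fin.revPerm Fin.revPerm = Matrix.of fun i j : Fin n =>
        ((φ j).map (algebraMap ℝ R)).eval (x (Fin.rev i)) := by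
    ext i j
    simp only [Matrix.submatrix_apply, Matrix.of_apply, Fin.revPerm_apply, Fin.rev_rev,
      Polynomial.aeval_def, Polynomial.eval_map]
  rw [h2, h1, Matrix.det_mul, Matrix.det_vandermonde, mul_comm]
  congr 1
  · rw [Matrix.det_of_isUpperTriangular, Finset.prod_range, map_prod]
    · simp
    · intro i j hij
      simp only [Matrix.of_apply, Polynomial.coeff_map]
      have hij' : (j : ℕ) < i := hij
      rw [Polynomial.coeff_eq_zero_of_natDegree_lt ((hφ j).trans_lt hij'), map_zero]
  · have h3 : (∏ i : Fin n, ∏ j ∈ Finset.Ioi i, (x (Fin.rev j) - x (Fin.rev i))) =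
        ∏ i : Fin n, ∏ j, if i < j then x (Fin.rev j) - x (Fin.rev i) else 1 := by
      refine Finset.prod_congr rfl fun i _ => ?_
      rw [← Finset.prod_filter]
      exact Finset.prod_congr (by ext; simp) fun _ _ => rfl
    rw [h3, vdm_eq_prod_ite, Finset.prod_comm]
    refine Fintype.prod_equiv Fin.revPerm _ _ fun j => Fintype.prod_equiv Fin.revPerm _ _ fun i => ?_
    simp only [Fin.revPerm_apply, Fin.rev_lt_rev]

/-! ### Laplace expansion along p rows and the dual Cauchy identity -/

theorem append_update_left {α : Type*} {p N : ℕ} (v : Fin p → α) (B : Fin N → α) (i : Fin p)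
    (c : α) : Fin.append (Function.update v i c) B =
      Function.update (Fin.append v B) (Fin.castAdd N i) c := by
  funext r
  refine Fin.addCases (fun j => ?_) (fun k => ?_) r
  · rw [Fin.append_left]
    by_cases h : j = i
    · subst h
      simp
    · rw [Function.update_of_ne h, Function.update_of_ne
        (fun h' => h (Fin.castAdd_injective p N h')), Fin.append_left]
  · rw [Fin.append_right, Function.update_of_ne, Fin.append_right]
    intro h
    have h1 := congrArg Fin.val h
    simp only [Fin.val_natAdd, Fin.val_castAdd] at h1
    omega

/-- The determinant of a matrix as an alternating function of its first rows. -/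
def appendDet {R : Type*} [CommRing R] {p N : ℕ} (B : Fin N → Fin (p + N) → R) :
    (Fin (p + N) → R) [⋀^Fin p]→ₗ[R] R where
  toFun v := Matrix.det (Matrix.of (Fin.append v B))
  map_update_add' := by
    intro inst v i a b
    have hu : ∀ c, Fin.append (Function.update v i c) B =
        Function.update (Fin.append v B) (Fin.castAdd N i) c := by
      intro c
      rw [Subsingleton.elim inst (instDecidableEqFin p)]
      exact append_update_left _ _ _ _
    simp only [hu]
    exact Matrix.detRowAlternating.map_update_add _ _ _ _
  map_update_smul' := by
    intro inst v i a b
    have hu : ∀ c, Fin.append (Function.update v i c) B =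
        Function.update (Fin.append v B) (Fin.castAdd N i) c := by
      intro c
      rw [Subsingleton.elim inst (instDecidableEqFin p)]
      exact append_update_left _ _ _ _
    simp only [hu]
    exact Matrix.detRowAlternating.map_update_smul _ _ _ _
  map_eq_zero_of_eq' := by
    intro v i j h hij
    refine Matrix.det_zero_of_row_eq (i := Fin.castAdd N i) (j := Fin.castAdd N j)
      (fun h' => hij (Fin.castAdd_injective p N h')) ?_
    funext s
    simp [h]

theorem appendDet_apply {R : Type*} [CommRing R] {p N : ℕ} (B : Fin N → Fin (p + N) → R)
    (v : Fin p → Fin (p + N) → R) :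
    appendDet B v = Matrix.det (Matrix.of (Fin.append v B)) := rfl

/-- The indicator function of the column of exponent `c`, if columns are ordered by decreasing
exponents. -/
def colUnit (R : Type*) [CommRing R] (m : ℕ) (c : ℕ) : Fin m → R :=
  fun s => if (Fin.rev s : ℕ) = c then 1 else 0

theorem sum_smul_colUnit {R : Type*} [CommRing R] {m : ℕ} (a : ℕ → R) :
    ∑ c ∈ Finset.range m, a c • colUnit R m c = fun s => a (Fin.rev s : Fin m) := by
  funext s
  simp only [Finset.sum_apply, Pi.smul_apply, colUnit, smul_eq_mul, mul_ite, mul_one, mul_zero]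
  rw [Finset.sum_ite_eq, if_pos (Finset.mem_range.2 (Fin.rev s).2)]

/-- One term of the Laplace expansion: the first p rows are unit vectors at the exponents of λ.
Moving these columns to the front gives a block triangular matrix with an identity block, and the
columns left over are those of λ̃. -/
theorem appendDet_colUnit {R : Type*} [CommRing R] {p N : ℕ} (a : Fin N → ℕ → R)
    {lam : YoungDiagram} (h : lam ≤ rect p N) :
    appendDet (fun k s => a k (Fin.rev s : Fin (p + N)))
        (fun j => colUnit R (p + N) (expo p lam j)) =
      (-1) ^ (tilde p N lam).card *
        Matrix.det (Matrix.of fun i k => a k (expo N (tilde p N lam) i)) := by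
  have h1 := Matrix.det_permute' (joinPerm h) (Matrix.of (Fin.append
    (fun j => colUnit R (p + N) (expo p lam j)) (fun k s => a k (Fin.rev s : Fin (p + N)))))
  have h2 : ((Matrix.of (Fin.append (fun j => colUnit R (p + N) (expo p lam j))
      (fun k s => a k (Fin.rev s : Fin (p + N))))).submatrix id (joinPerm h)).det =
      Matrix.det (Matrix.of fun i k => a k (expo N (tilde p N lam) i)) := by
    rw [← Matrix.det_submatrix_equiv_self finSumFinEquiv, ← Matrix.det_transpose (Matrix.of _)]
    have h3 : ((Matrix.of (Fin.append (fun j => colUnit R (p + N) (expo p lam j))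
      (fun k s => a k (Fin.rev s : Fin (p + N))))).submatrix id (joinPerm h)).submatrix
        finSumFinEquiv finSumFinEquiv = Matrix.fromBlocks 1 0
        (Matrix.of fun k i => a k (expo p lam i))
        (Matrix.of fun i k => a k (expo N (tilde p N lam) i)).transpose := by
      ext (i | k) (j | l)
      · simp only [Matrix.submatrix_apply, finSumFinEquiv_apply_left, id, Matrix.of_apply,
          Fin.append_left, colUnit, rev_joinPerm, joinExpo, Matrix.fromBlocks_apply₁₁,
          Matrix.one_apply]
        exact if_congr ⟨fun h => ((expo_strictAnti p lam).injective h).symm, fun h => by rw [h]⟩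
          rfl rfl
      · simp only [Matrix.submatrix_apply, finSumFinEquiv_apply_left, finSumFinEquiv_apply_right,
          id, Matrix.of_apply,
          Fin.append_left, Fin.append_right, colUnit, rev_joinPerm, joinExpo,
          Matrix.fromBlocks_apply₁₂, Matrix.zero_apply]
        exact if_neg (expo_ne_expo_tilde p N i l).symm
      · simp only [Matrix.submatrix_apply, finSumFinEquiv_apply_left, finSumFinEquiv_apply_right,
          id, Matrix.of_apply, Fin.append_left, Fin.append_right, rev_joinPerm, joinExpo,
          Matrix.fromBlocks_apply₂₁]
      · simp only [Matrix.submatrix_apply, finSumFinEquiv_apply_right,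
          id, Matrix.of_apply, Fin.append_right, rev_joinPerm, joinExpo,
          Matrix.fromBlocks_apply₂₂, Matrix.transpose_apply]
    rw [h3, Matrix.det_fromBlocks_zero₁₂, Matrix.det_one, one_mul]
  rw [h2, sign_joinPerm] at h1
  rw [appendDet_apply, h1]
  push_cast
  rw [← mul_assoc, ← pow_add, Even.neg_one_pow ⟨_, rfl⟩, one_mul]

/-- The dual Cauchy identity for a sequence of polynomials, in alternating form. -/
theorem dual_cauchy_altDet {R : Type*} [CommRing R] [Algebra ℝ R] {φ : ℕ → Polynomial ℝ}
    (hφ : ∀ k, (φ k).natDegree ≤ k) {p N : ℕ} (y : Fin p → R) (x : Fin N → R) :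
    algebraMap ℝ R (∏ k ∈ Finset.range (p + N), (φ k).coeff k) *
        (vdm y * vdm x * ∏ j, ∏ i, (y j - x i)) =
      ∑ lam ∈ boxes p N, (-1) ^ (tilde p N lam).card *
        (altDet φ p lam y * altDet φ N (tilde p N lam) x) := by
  rw [← vdm_append, ← det_rev_eq_vdm hφ]
  -- The determinant is alternating in its first p rows; expanding these in the unit rows `colUnit`
  -- is the Laplace expansion.
  have h1 := alternatingMap_sum_range (n := p) (L := N)
    (appendDet (fun k s => Polynomial.aeval (x k) (φ (Fin.rev s : Fin (p + N)))))
    (fun i c => Polynomial.aeval (y i) (φ c)) (colUnit R (p + N))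
  simp only [sum_smul_colUnit (R := R) fun c => Polynomial.aeval (y _) (φ c)] at h1
  have h2 : (Matrix.of fun i j : Fin (p + N) => Polynomial.aeval (Fin.append y x i)
      (φ (Fin.rev j : Fin (p + N)))) = Matrix.of (Fin.append
        (fun j s => Polynomial.aeval (y j) (φ (Fin.rev s : Fin (p + N))))
        (fun k s => Polynomial.aeval (x k) (φ (Fin.rev s : Fin (p + N))))) := by
    ext r s
    refine Fin.addCases (fun i => ?_) (fun k => ?_) r <;> simp
  rw [h2, ← appendDet_apply, h1]
  refine Finset.sum_congr rfl fun lam hl => ?_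
  rw [appendDet_colUnit (fun k c => Polynomial.aeval (x k) (φ c)) (mem_boxes.1 hl),
    smul_eq_mul, ← Matrix.det_transpose, mul_left_comm]
  rfl

/-- The dual Cauchy identity for a sequence of polynomials. -/
theorem dual_cauchy {φ : ℕ → Polynomial ℝ} (hφ : ∀ k, (φ k).natDegree ≤ k) {p N : ℕ}
    (t : Fin p → ℂ) (x : Fin N → ℝ) :
    ((∏ k ∈ Finset.range (p + N), (φ k).coeff k : ℝ) : ℂ) *
        ((∏ j, ∏ i, (t j - (x i : ℂ))) * (vdm x : ℝ)) =
      ∑ lam ∈ boxes p N, (-1) ^ (tilde p N lam).card *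
        (MvPolynomial.aeval t (multiPoly φ p lam) * (altDet φ N (tilde p N lam) x : ℝ)) := by
  -- The t_j may coincide, so the Vandermonde factor is cancelled over indeterminates, where it is
  -- nonzero in a domain, and t is substituted afterwards.
  have h1 := dual_cauchy_altDet (R := MvPolynomial (Fin p) ℝ) hφ MvPolynomial.X
    fun i => MvPolynomial.C (x i)
  have h2 : vdm (fun i => (MvPolynomial.C (x i) : MvPolynomial (Fin p) ℝ)) =
      MvPolynomial.C (vdm x) := (map_vdm MvPolynomial.C x).symm
  have h3 : ∀ nu, altDet φ N nu (fun i => (MvPolynomial.C (x i) : MvPolynomial (Fin p) ℝ)) =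
      MvPolynomial.C (altDet φ N nu x) := fun nu =>
    (map_altDet (Algebra.ofId ℝ (MvPolynomial (Fin p) ℝ)) φ nu x).symm
  have h4 : (MvPolynomial.C (∏ k ∈ Finset.range (p + N), (φ k).coeff k) :
      MvPolynomial (Fin p) ℝ) * ((∏ j, ∏ i, (MvPolynomial.X j - MvPolynomial.C (x i))) *
        MvPolynomial.C (vdm x)) = ∑ lam ∈ boxes p N, (-1) ^ (tilde p N lam).card *
        (multiPoly φ p lam * MvPolynomial.C (altDet φ N (tilde p N lam) x)) := by
    apply mul_left_cancel₀ (vdm_ne_zero (MvPolynomial.X_injective (σ := Fin p) (R := ℝ)))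
    rw [Finset.mul_sum, ← h2]
    refine (Eq.trans (by rw [MvPolynomial.algebraMap_eq]; ring) h1).trans
      (Finset.sum_congr rfl fun lam hl => ?_)
    rw [h3, ← alternant_eq_altDet,
      ← vandermonde_mul_multiPoly φ p lam (le_rect_iff.1 (mem_boxes.1 hl)).1, vandermonde_eq_vdm]
    ring
  have h5 := congrArg (MvPolynomial.aeval t) h4
  simp only [map_mul, map_prod, map_sub, map_sum, map_pow, map_neg, map_one, MvPolynomial.aeval_X,
    MvPolynomial.aeval_C, Complex.coe_algebraMap] at h5
  rw [← h5]
  push_cast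
  rfl

/-! ### Complete symmetric series and the Cauchy identity -/

/-- The series in the variables `X k`, `k ∈ s`, whose coefficients are given by the degree. -/
def degSeries {q : ℕ} (s : Finset (Fin q)) (u : ℕ → ℂ) : MvPowerSeries (Fin q) ℂ :=
  fun d => if d.support ⊆ s then u d.degree else 0

theorem coeff_degSeries {q : ℕ} (s : Finset (Fin q)) (u : ℕ → ℂ) (d : Fin q →₀ ℕ) :
    MvPowerSeries.coeff d (degSeries s u) = if d.support ⊆ s then u d.degree else 0 := rfl

/-- Monomials without X_k give the first term; the others are X_k times a monomial of degree one
less, whence the shift of `u`. -/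
theorem degSeries_insert {q : ℕ} {s : Finset (Fin q)} {k : Fin q} (hk : k ∉ s) (u : ℕ → ℂ) :
    degSeries (insert k s) u =
      degSeries s u + MvPowerSeries.X k * degSeries (insert k s) fun n => u (n + 1) := by
  ext d
  rw [map_add, MvPowerSeries.X, MvPowerSeries.coeff_monomial_mul]
  simp only [coeff_degSeries, one_mul]
  by_cases hd : d k = 0
  · have h1 : ¬ Finsupp.single k 1 ≤ d := by
      rw [Finsupp.single_le_iff]
      omega
    have h2 : d.support ⊆ insert k s ↔ d.support ⊆ s :=
      Finset.subset_insert_iff_of_notMem (by simpa using hd)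
    rw [if_neg h1, add_zero]
    simp only [h2]
  · have h1 : Finsupp.single k 1 ≤ d := by
      rw [Finsupp.single_le_iff]
      omega
    have h2 : ¬ d.support ⊆ s := fun h => hk (h (Finsupp.mem_support_iff.2 hd))
    have h3 : (d - Finsupp.single k 1) + Finsupp.single k 1 = d := tsub_add_cancel_of_le h1
    have h4 : (d - Finsupp.single k 1).degree + 1 = d.degree := by
      conv_rhs => rw [← h3]
      rw [map_add, Finsupp.degree_single]
    have h5 : (d - Finsupp.single k 1).support ⊆ insert k s ↔ d.support ⊆ insert k s := by
      constructor
      · intro h l hl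
        by_cases hlk : l = k
        · exact hlk ▸ Finset.mem_insert_self _ _
        · apply h
          rw [Finsupp.mem_support_iff] at hl ⊢
          rwa [Finsupp.tsub_apply, Finsupp.single_eq_of_ne hlk, tsub_zero]
      · exact fun h => Finsupp.support_tsub.trans h
    rw [if_pos h1, if_neg h2, zero_add]
    simp only [h5, h4]

theorem degSeries_empty {q : ℕ} (u : ℕ → ℂ) :
    degSeries (∅ : Finset (Fin q)) u = MvPowerSeries.C (u 0) := by
  ext d
  rw [coeff_degSeries, MvPowerSeries.coeff_C]
  by_cases hd : d = 0
  · subst hd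
    simp
  · rw [if_neg hd, if_neg]
    rwa [Finset.subset_empty, Finsupp.support_eq_empty]

/-- The generating series of the powers of `x`, which is `∏ (1 - x X_k)⁻¹`. -/
def geomSeries (q : ℕ) (x : ℂ) : MvPowerSeries (Fin q) ℂ := degSeries Finset.univ fun n => x ^ n

/-- For u_n = x^n the shift of `u` is multiplication by x, so the factor 1 - x X_k removes the
variable X_k; removing all of them leaves 1. -/
theorem prod_mul_geomSeries (q : ℕ) (x : ℂ) :
    (∏ k : Fin q, (1 - MvPowerSeries.C x * MvPowerSeries.X k)) * geomSeries q x = 1 := by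
  suffices h : ∀ s : Finset (Fin q), (∏ k ∈ s, (1 - MvPowerSeries.C x * MvPowerSeries.X k)) *
      degSeries s (fun n => x ^ n) = 1 from h _
  intro s
  induction s using Finset.induction_on with
  | empty => simp [degSeries_empty]
  | insert k s hk ih =>
    have h1 := degSeries_insert hk fun n => x ^ n
    have h2 : degSeries (insert k s) (fun n => x ^ (n + 1)) =
        MvPowerSeries.C x * degSeries (insert k s) fun n => x ^ n := by
      ext d
      rw [MvPowerSeries.coeff_C_mul, coeff_degSeries, coeff_degSeries]
      split_ifs
      · ring
      · ring
    rw [h2] at h1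
    have h3 : (1 - MvPowerSeries.C x * MvPowerSeries.X k) * degSeries (insert k s) (fun n => x ^ n)
        = degSeries s fun n => x ^ n := by
      linear_combination h1
    rw [Finset.prod_insert hk, mul_comm (1 - _), mul_assoc, h3, ih]

/-- The complete symmetric polynomial of degree `m` in the variables `X k`, `k ∈ s`. -/
def completeSymm {q : ℕ} (s : Finset (Fin q)) (m : ℕ) : MvPowerSeries (Fin q) ℂ :=
  degSeries s fun n => if n = m then 1 else 0

/-- The generating series of the complete symmetric polynomials. -/
def completeGen {q : ℕ} (s : Finset (Fin q)) : PowerSeries (MvPowerSeries (Fin q) ℂ) :=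
  PowerSeries.mk (completeSymm s)

/-- This is h_m(s ∪ {k}) = h_m(s) + X_k h_{m-1}(s ∪ {k}) in generating form. -/
theorem completeGen_insert {q : ℕ} {s : Finset (Fin q)} {k : Fin q} (hk : k ∉ s) :
    completeGen (insert k s) * (1 - PowerSeries.C (MvPowerSeries.X k) * PowerSeries.X) =
      completeGen s := by
  ext1 m
  rw [mul_sub, mul_one, map_sub, mul_left_comm, PowerSeries.coeff_C_mul]
  cases m with
  | zero =>
    rw [PowerSeries.coeff_zero_mul_X, mul_zero, sub_zero]
    simp only [completeGen, PowerSeries.coeff_mk, completeSymm]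
    rw [degSeries_insert hk]
    have : degSeries (insert k s) (fun n => if n + 1 = 0 then (1 : ℂ) else 0) = 0 := by
      ext d
      simp [coeff_degSeries]
    rw [this, mul_zero, add_zero]
  | succ m =>
    rw [PowerSeries.coeff_succ_mul_X]
    simp only [completeGen, PowerSeries.coeff_mk, completeSymm]
    rw [degSeries_insert hk]
    simp only [Nat.add_right_cancel_iff]
    ring

theorem completeGen_empty (q : ℕ) : completeGen (∅ : Finset (Fin q)) = 1 := by
  ext1 m
  rw [completeGen, PowerSeries.coeff_mk, completeSymm, degSeries_empty, PowerSeries.coeff_one]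
  by_cases h : m = 0
  · simp [h]
  · simp [h, Ne.symm h]

theorem completeGen_union {q : ℕ} (s t : Finset (Fin q)) (h : Disjoint s t) :
    completeGen (s ∪ t) *
        ∏ k ∈ t, (1 - PowerSeries.C (MvPowerSeries.X k) * PowerSeries.X) = completeGen s := by
  induction t using Finset.induction_on with
  | empty => simp
  | insert k t hk ih =>
    rw [Finset.disjoint_insert_right] at h
    rw [Finset.prod_insert hk, ← mul_assoc, Finset.union_insert, completeGen_insert, ih h.2]
    rw [Finset.mem_union]
    tauto

theorem coeff_completeGen_singleton {q : ℕ} (k : Fin q) (m : ℕ) :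
    PowerSeries.coeff m (completeGen {k}) = (MvPowerSeries.X k : MvPowerSeries (Fin q) ℂ) ^ m := by
  have h1 := completeGen_insert (Finset.notMem_empty k)
  rw [completeGen_empty, mul_sub, mul_one, insert_empty_eq] at h1
  induction m with
  | zero =>
    have := congrArg (PowerSeries.coeff 0) h1
    rw [map_sub, mul_left_comm, PowerSeries.coeff_C_mul, PowerSeries.coeff_zero_mul_X, mul_zero,
      sub_zero] at this
    rw [this]
    simp
  | succ m ih =>
    have := congrArg (PowerSeries.coeff (m + 1)) h1
    rw [map_sub, mul_left_comm, PowerSeries.coeff_C_mul, PowerSeries.coeff_succ_mul_X, ih,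
      PowerSeries.coeff_one, if_neg (Nat.succ_ne_zero m)] at this
    rw [sub_eq_zero.1 this]
    ring

/-- Complete symmetric polynomials, indexed by all integers. -/
def completeInt (q : ℕ) (a : ℤ) : MvPowerSeries (Fin q) ℂ :=
  if 0 ≤ a then completeSymm Finset.univ a.toNat else 0

theorem coeff_completeInt {q : ℕ} (a : ℤ) (d : Fin q →₀ ℕ) :
    MvPowerSeries.coeff d (completeInt q a) = if (d.degree : ℤ) = a then 1 else 0 := by
  unfold completeInt
  split_ifs with h1 h2 h2
  · rw [completeSymm, coeff_degSeries, if_pos (Finset.subset_univ _), if_pos (by omega)]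
  · rw [completeSymm, coeff_degSeries, if_pos (Finset.subset_univ _), if_neg (by omega)]
  · omega
  · simp

theorem completeInt_zero (q : ℕ) : completeInt q 0 = 1 := by
  ext d
  rw [coeff_completeInt, MvPowerSeries.coeff_one]
  refine if_congr ?_ rfl rfl
  rw [Nat.cast_eq_zero, Finsupp.degree_eq_zero_iff]

theorem completeInt_neg (q : ℕ) (a : ℤ) (h : a < 0) : completeInt q a = 0 :=
  if_neg (not_le.2 h)

/-- The entry (i, j) is the complete symmetric polynomial of degree `expo n mu i - (n - 1 - j)`, so
the sum is a convolution. The degree bound ensures that the n columns meet every nonzero coefficient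
of `f`. -/
theorem sum_completeInt_mul_coeff {q n : ℕ} (mu : YoungDiagram) (i : Fin n)
    (f : Polynomial (MvPowerSeries (Fin q) ℂ)) (hf : f.natDegree < n) :
    ∑ j : Fin n, completeInt q (shift mu ⊥ i j) * f.coeff (n - 1 - j) =
      PowerSeries.coeff (expo n mu i) (completeGen Finset.univ * (f : PowerSeries _)) := by
  rw [mul_comm (completeGen _), PowerSeries.coeff_mul,
    Finset.Nat.sum_antidiagonal_eq_sum_range_succ
      (fun a b => PowerSeries.coeff a (f : PowerSeries _) *
        PowerSeries.coeff b (completeGen (Finset.univ : Finset (Fin q))))]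
  have h1 : ∑ j : Fin n, completeInt q (shift mu ⊥ i j) * f.coeff (n - 1 - j) =
      ∑ a ∈ Finset.range n, f.coeff a * completeInt q (expo n mu i - a) := by
    rw [Finset.sum_range]
    refine Fintype.sum_equiv Fin.revPerm _ _ fun j => ?_
    have h2 : ((Fin.rev j : Fin n) : ℕ) = n - 1 - j := by
      rw [Fin.val_rev]
      omega
    rw [Fin.revPerm_apply, h2, mul_comm]
    congr 2
    have := i.2
    have := j.2
    simp only [shift, rowLen_bot, expo]
    omega
  have h2 : ∀ m, n ≤ m → ∑ a ∈ Finset.range n, f.coeff a * completeInt q (expo n mu i - a) =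
      ∑ a ∈ Finset.range m, f.coeff a * completeInt q (expo n mu i - a) := by
    intro m hm
    refine Finset.sum_subset (Finset.range_subset_range.2 hm) fun a _ ha => ?_
    rw [Polynomial.coeff_eq_zero_of_natDegree_lt, zero_mul]
    rw [Finset.mem_range] at ha
    omega
  rw [h1, h2 _ (le_max_left n (expo n mu i + 1))]
  symm
  refine (Finset.sum_congr rfl fun a ha => ?_).trans (Finset.sum_subset
    (Finset.range_subset_range.2 (le_max_right n (expo n mu i + 1))) fun a _ ha => ?_)
  · rw [Finset.mem_range] at ha
    rw [Polynomial.coeff_coe, completeGen, PowerSeries.coeff_mk, completeInt, if_pos (by omega)]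
    congr 2
    omega
  · rw [Finset.mem_range] at ha
    rw [completeInt_neg, mul_zero]
    omega

/-- The polynomial `∏_{k ∈ s} (1 - X_k Y)` in the variable `Y`. -/
def elemGen {q : ℕ} (s : Finset (Fin q)) : Polynomial (MvPowerSeries (Fin q) ℂ) :=
  ∏ k ∈ s, (1 - Polynomial.C (MvPowerSeries.X k) * Polynomial.X)

theorem coe_elemGen {q : ℕ} (s : Finset (Fin q)) :
    (elemGen s : PowerSeries (MvPowerSeries (Fin q) ℂ)) =
      ∏ k ∈ s, (1 - PowerSeries.C (MvPowerSeries.X k) * PowerSeries.X) := by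
  rw [elemGen, ← Polynomial.coeToPowerSeries.ringHom_apply, map_prod]
  simp

theorem natDegree_elemGen_le {q : ℕ} (s : Finset (Fin q)) : (elemGen s).natDegree ≤ s.card := by
  refine (Polynomial.natDegree_prod_le _ _).trans ?_
  rw [Finset.card_eq_sum_ones]
  refine Finset.sum_le_sum fun k _ => ?_
  refine (Polynomial.natDegree_sub_le _ _).trans (max_le (by simp) ?_)
  simpa using Polynomial.natDegree_C_mul_X_pow_le (MvPowerSeries.X k : MvPowerSeries (Fin q) ℂ) 1

theorem mvX_injective (q : ℕ) :
    Function.Injective (MvPowerSeries.X : Fin q → MvPowerSeries (Fin q) ℂ) := by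
  intro i j h
  have h1 := congrArg (MvPowerSeries.coeff (Finsupp.single i 1)) h
  rw [MvPowerSeries.coeff_index_single_self_X, MvPowerSeries.coeff_index_single_X] at h1
  by_contra hne
  rw [if_neg hne] at h1
  exact one_ne_zero h1

/-! ### The Jacobi–Trudi identity -/

theorem schurInv_eq_aeval (q : ℕ) (mu : YoungDiagram) :
    schurInv q mu = MvPolynomial.aeval (fun k => (MvPowerSeries.X k : MvPowerSeries (Fin q) ℂ))
      (schur q mu) := by
  have h : (MvPolynomial.coeToMvPowerSeries.ringHom (σ := Fin q) (R := ℂ)).comp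
      (MvPolynomial.map (algebraMap ℝ ℂ)) = (MvPolynomial.aeval (R := ℝ)
        (fun k => (MvPowerSeries.X k : MvPowerSeries (Fin q) ℂ)) :
          MvPolynomial (Fin q) ℝ →+* MvPowerSeries (Fin q) ℂ) := by
    refine MvPolynomial.ringHom_ext (fun r => ?_) fun k => ?_
    · simp [MvPowerSeries.algebraMap_apply]
    · simp
  exact DFunLike.congr_fun h (schur q mu)

theorem altDet_X_pow {R : Type*} [CommRing R] [Algebra ℝ R] {n : ℕ} (lam : YoungDiagram)
    (x : Fin n → R) : altDet (fun k => Polynomial.X ^ k) n lam x =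
      Matrix.det (Matrix.of fun i j => x j ^ expo n lam i) := by
  simp [altDet]

theorem vdm_eq_det {R : Type*} [CommRing R] [Algebra ℝ R] {n : ℕ} (x : Fin n → R) :
    vdm x = Matrix.det (Matrix.of fun i j : Fin n => x i ^ (n - 1 - (j : ℕ))) := by
  have h := det_rev_eq_vdm (R := R) (φ := fun k => Polynomial.X ^ k)
    (fun k => Polynomial.natDegree_X_pow_le k) x
  simp only [Polynomial.coeff_X_pow_self, Finset.prod_const_one, map_one, one_mul, map_pow,
    Polynomial.aeval_X] at h
  rw [← h]
  congr 1
  ext i j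
  simp only [Matrix.of_apply]
  congr 1
  rw [Fin.val_rev]
  omega

/-- Multiplying the generating series of the h_m by ∏ (1 - X_l Y) over l ≠ k leaves 1/(1 - X_k Y),
whose coefficients are the powers of X_k. -/
theorem alternant_X_eq_mul {q : ℕ} (mu : YoungDiagram) :
    (Matrix.of fun i k : Fin q => (MvPowerSeries.X k : MvPowerSeries (Fin q) ℂ) ^ expo q mu i) =
      (Matrix.of fun i j : Fin q => completeInt q (shift mu ⊥ i j)) *
        Matrix.of fun j k : Fin q => (elemGen (Finset.univ.erase k)).coeff (q - 1 - (j : ℕ)) := by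
  ext1 i k
  rw [Matrix.mul_apply]
  simp only [Matrix.of_apply]
  rw [sum_completeInt_mul_coeff, coe_elemGen, ← coeff_completeGen_singleton]
  · have h := completeGen_union {k} (Finset.univ.erase k) (by simp)
    rw [← Finset.insert_eq, Finset.insert_erase (Finset.mem_univ k)] at h
    rw [h]
  · refine (natDegree_elemGen_le _).trans_lt ?_
    rw [Finset.card_erase_of_mem (Finset.mem_univ k), Finset.card_univ, Fintype.card_fin]
    have := k.2
    omega

/-- The Jacobi–Trudi identity. -/
theorem schurInv_eq_det {q n : ℕ} {mu : YoungDiagram} (hn : mu.colLen 0 ≤ n) :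
    schurInv q mu = Matrix.det (Matrix.of fun i j : Fin n => completeInt q (shift mu ⊥ i j)) := by
  have : IsDomain (MvPowerSeries (Fin q) ℂ) := NoZeroDivisors.to_isDomain _
  rw [det_skew_eq _ (completeInt_zero q) (completeInt_neg q) bot_le hn]
  by_cases hq : mu.colLen 0 ≤ q
  · rw [← det_skew_eq _ (completeInt_zero q) (completeInt_neg q) bot_le hq]
    have h1 := vdm_aeval_multiPoly (fun k => Polynomial.X ^ k) hq
      (MvPowerSeries.X : Fin q → MvPowerSeries (Fin q) ℂ)
    rw [altDet_X_pow, alternant_X_eq_mul, Matrix.det_mul] at h1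
    -- For the empty partition the complete symmetric factor is unitriangular, so the second factor
    -- has the Vandermonde product as its determinant, and this cancels.
    have h2 := congrArg Matrix.det (alternant_X_eq_mul (q := q) ⊥)
    rw [Matrix.det_mul, det_skew_bot _ (completeInt_zero q) (completeInt_neg q), one_mul] at h2
    have h3 : vdm (MvPowerSeries.X : Fin q → MvPowerSeries (Fin q) ℂ) =
        Matrix.det (Matrix.of fun i k : Fin q =>
          (MvPowerSeries.X k : MvPowerSeries (Fin q) ℂ) ^ expo q ⊥ i) := by
      rw [vdm_eq_det, ← Matrix.det_transpose]
      congr 1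
      ext1 i j
      simp [expo_bot]
    rw [← h2, ← h3, mul_comm _ (vdm _)] at h1
    have h4 := mul_left_cancel₀ (vdm_ne_zero (mvX_injective q)) h1
    rw [schurInv_eq_aeval]
    exact h4
  · have h0 : schurInv q mu = 0 := by
      rw [schurInv, schur, multiPoly, if_neg hq]
      simp
    rw [h0]
    symm
    set l := mu.colLen 0 with hl
    rw [not_le] at hq
    -- With fewer variables than rows, the coefficients of E(Y) = ∏ (1 - X_k Y) form a kernel
    -- vector: H(Y) E(Y) = 1, where H is the generating series of the h_m, has no terms at the
    -- exponents of μ, which are positive. The last entry of the vector is E(0) = 1.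
    refine Matrix.exists_mulVec_eq_zero_iff.1
      ⟨fun j => (elemGen (Finset.univ : Finset (Fin q))).coeff (l - 1 - (j : ℕ)), ?_, ?_⟩
    · intro h
      have h1 := congrFun h ⟨l - 1, by omega⟩
      simp only [Nat.sub_self, Pi.zero_apply, elemGen] at h1
      rw [Polynomial.coeff_zero_prod] at h1
      simp at h1
    · funext i
      simp only [Matrix.mulVec, dotProduct, Matrix.of_apply, Pi.zero_apply]
      rw [sum_completeInt_mul_coeff]
      · have h := completeGen_union ∅ (Finset.univ : Finset (Fin q)) (by simp)
        rw [Finset.empty_union, completeGen_empty] at h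
        rw [coe_elemGen, h, PowerSeries.coeff_one, if_neg]
        have h1 := rowLen_pos_of_lt_colLen (lam := mu) i.2
        unfold expo
        omega
      · refine (natDegree_elemGen_le _).trans_lt ?_
        rwa [Finset.card_univ, Fintype.card_fin]

/-! ### Truncation by degree and the Cauchy identity -/

/-- The ideal of series without terms of degree less than `K`. -/
def orderIdeal (q K : ℕ) : Ideal (MvPowerSeries (Fin q) ℂ) where
  carrier := {f | ∀ d : Fin q →₀ ℕ, d.degree < K → MvPowerSeries.coeff d f = 0}
  add_mem' := by
    intro f g hf hg d hd
    rw [map_add, hf d hd, hg d hd, add_zero]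
  zero_mem' := fun d _ => map_zero _
  smul_mem' := by
    intro f g hg d hd
    rw [smul_eq_mul, MvPowerSeries.coeff_mul]
    refine Finset.sum_eq_zero fun c hc => ?_
    rw [hg, mul_zero]
    rw [Finset.HasAntidiagonal.mem_antidiagonal] at hc
    rw [← hc, map_add] at hd
    omega

theorem mem_orderIdeal {q K : ℕ} {f : MvPowerSeries (Fin q) ℂ} : f ∈ orderIdeal q K ↔
    ∀ d : Fin q →₀ ℕ, d.degree < K → MvPowerSeries.coeff d f = 0 := Iff.rfl

/-- The determinants agree modulo the ideal. With `orderIdeal` this allows infinite series inside a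
determinant to be truncated. -/
theorem det_sub_det_mem {R : Type*} [CommRing R] (I : Ideal R) {n : ℕ}
    {A B : Matrix (Fin n) (Fin n) R} (h : ∀ i j, A i j - B i j ∈ I) : A.det - B.det ∈ I := by
  rw [← Ideal.Quotient.eq, RingHom.map_det, RingHom.map_det]
  congr 1
  ext i j
  exact Ideal.Quotient.eq.2 (h i j)

/-- Each term of the Jacobi–Trudi determinant contains an entry of the first row, which has degree
at least μ_1. This makes the sum over μ finite at every monomial. -/
theorem coeff_schurInv_eq_zero {q : ℕ} {mu : YoungDiagram} {d : Fin q →₀ ℕ}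
    (h : d.degree < mu.rowLen 0) : MvPowerSeries.coeff d (schurInv q mu) = 0 := by
  have hpos : 0 < mu.colLen 0 :=
    YoungDiagram.mem_iff_lt_colLen.1 (YoungDiagram.mem_iff_lt_rowLen.2 (Nat.zero_lt_of_lt h))
  suffices hm : schurInv q mu ∈ orderIdeal q (mu.rowLen 0) from mem_orderIdeal.1 hm d h
  rw [schurInv_eq_det le_rfl, ← Matrix.det_transpose, Matrix.det_apply]
  refine Ideal.sum_mem _ fun σ _ => ?_
  rw [Units.smul_def, zsmul_eq_mul]
  refine Ideal.mul_mem_left _ _ (Ideal.mem_of_dvd _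
    (Finset.dvd_prod_of_mem _ (Finset.mem_univ (⟨0, hpos⟩ : Fin (mu.colLen 0)))) ?_)
  rw [mem_orderIdeal]
  intro e he
  simp only [Matrix.transpose_apply, Matrix.of_apply]
  rw [coeff_completeInt, if_neg]
  simp only [shift, rowLen_bot]
  omega

/-- The Cauchy identity for Schur polynomials, in alternating form. -/
theorem cauchy_identity {N q L : ℕ} (x : Fin N → ℂ) {d : Fin q →₀ ℕ} (hd : d.degree < L) :
    vdm x * MvPowerSeries.coeff d (∏ i, geomSeries q (x i)) =
      ∑ mu ∈ boxes N L, altDet (fun k => Polynomial.X ^ k) N mu x *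
        MvPowerSeries.coeff d (schurInv q mu) := by
  let c : Fin N → MvPowerSeries (Fin q) ℂ := fun i => MvPowerSeries.C (x i)
  have h1 : MvPowerSeries.C (vdm x) * ∏ i, geomSeries q (x i) = Matrix.det
      (Matrix.of fun i j : Fin N => geomSeries q (x i) * c i ^ (N - 1 - (j : ℕ))) := by
    rw [map_vdm, vdm_eq_det, mul_comm]
    exact (Matrix.det_mul_column (fun i => geomSeries q (x i)) _).symm
  -- Column j of row i of the matrix in `h1` is the sum over k of x_i^k h_{k-(N-1-j)}. Cutting it
  -- off at k < N + L only changes terms of degree at least L.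
  have h2 := alternatingMap_sum_range (n := N) (L := L)
    (Matrix.detRowAlternating (R := MvPowerSeries (Fin q) ℂ) (n := Fin N)) (fun i k => c i ^ k)
    (fun k j => completeInt q ((k : ℤ) - (N - 1 - (j : ℕ) : ℕ)))
  have h3 : ∀ mu ∈ boxes N L, Matrix.det (Matrix.of fun i j => c i ^ expo N mu j) •
      Matrix.detRowAlternating (fun j => fun l : Fin N =>
        completeInt q ((expo N mu j : ℤ) - (N - 1 - (l : ℕ) : ℕ))) =
      MvPowerSeries.C (altDet (fun k => Polynomial.X ^ k) N mu x) * schurInv q mu := by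
    intro mu hmu
    rw [schurInv_eq_det (le_rect_iff.1 (mem_boxes.1 hmu)).1, smul_eq_mul, altDet_X_pow,
      ← Matrix.det_transpose, RingHom.map_det]
    congr 2
    · ext1 i j
      simp [c]
    · refine Matrix.ext fun i j => ?_
      simp only [Matrix.of_apply]
      rw [← expo_sub_expo N, expo_bot]
  rw [Finset.sum_congr rfl h3] at h2
  have h4 : MvPowerSeries.C (vdm x) * ∏ i, geomSeries q (x i) - ∑ mu ∈ boxes N L,
      MvPowerSeries.C (altDet (fun k => Polynomial.X ^ k) N mu x) * schurInv q mu ∈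
        orderIdeal q L := by
    rw [h1, ← h2]
    refine det_sub_det_mem _ fun i j => ?_
    rw [mem_orderIdeal]
    intro e he
    simp only [Matrix.of_apply, Finset.sum_apply, Pi.smul_apply, smul_eq_mul, c, ← map_pow]
    rw [map_sub, map_sum, mul_comm, sub_eq_zero]
    simp only [MvPowerSeries.coeff_C_mul, coeff_completeInt]
    rw [geomSeries, coeff_degSeries, if_pos (Finset.subset_univ _),
      Finset.sum_eq_single (e.degree + (N - 1 - (j : ℕ)))]
    · rw [if_pos (by omega), mul_one, ← pow_add, add_comm]
    · intro k _ hk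
      rw [if_neg (by omega), mul_zero]
    · intro hk
      rw [Finset.mem_range] at hk
      have := j.2
      omega
  have h5 := h4 d hd
  rw [map_sub, map_sum, sub_eq_zero] at h5
  simpa only [MvPowerSeries.coeff_C_mul] using h5

/-! ### Integrals of products of determinants -/

theorem det_mul_det_mul_prod {N : ℕ} (f g : Fin N → ℝ → ℝ) (w : ℝ → ℝ) (x : Fin N → ℝ) :
    Matrix.det (Matrix.of fun i j => f i (x j)) * Matrix.det (Matrix.of fun i j => g i (x j)) *
      ∏ j, w (x j) = ∑ σ : Equiv.Perm (Fin N), ∑ τ : Equiv.Perm (Fin N),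
        ((Equiv.Perm.sign σ : ℤ) : ℝ) * ((Equiv.Perm.sign τ : ℤ) : ℝ) *
          ∏ j, (f (σ j) (x j) * g (τ j) (x j) * w (x j)) := by
  rw [Matrix.det_apply', Matrix.det_apply', Finset.sum_mul_sum, Finset.sum_mul]
  refine Finset.sum_congr rfl fun σ _ => ?_
  rw [Finset.sum_mul]
  refine Finset.sum_congr rfl fun τ _ => ?_
  simp only [Matrix.of_apply, Finset.prod_mul_distrib]
  ring

theorem integrable_det_mul_det {N : ℕ} (f g : Fin N → ℝ → ℝ) (w : ℝ → ℝ)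
    (h : ∀ i j, Integrable fun x => f i x * g j x * w x) :
    Integrable fun x : Fin N → ℝ => Matrix.det (Matrix.of fun i j => f i (x j)) *
      Matrix.det (Matrix.of fun i j => g i (x j)) * ∏ j, w (x j) := by
  simp only [det_mul_det_mul_prod]
  exact integrable_finsetSum _ fun σ _ => integrable_finsetSum _ fun τ _ =>
    (Integrable.fintype_prod (f := fun j y => f (σ j) y * g (τ j) y * w y)
      fun j => h (σ j) (τ j)).const_mul _

/-- Andréief's identity. -/
theorem integral_det_mul_det {N : ℕ} (f g : Fin N → ℝ → ℝ) (w : ℝ → ℝ)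
    (h : ∀ i j, Integrable fun x => f i x * g j x * w x) :
    ∫ x : Fin N → ℝ, Matrix.det (Matrix.of fun i j => f i (x j)) *
      Matrix.det (Matrix.of fun i j => g i (x j)) * ∏ j, w (x j) =
    N.factorial * Matrix.det (Matrix.of fun i j => ∫ x, f i x * g j x * w x) := by
  simp only [det_mul_det_mul_prod]
  have hint : ∀ σ τ : Equiv.Perm (Fin N), Integrable fun x : Fin N → ℝ =>
      ((Equiv.Perm.sign σ : ℤ) : ℝ) * ((Equiv.Perm.sign τ : ℤ) : ℝ) *
          ∏ j, (f (σ j) (x j) * g (τ j) (x j) * w (x j)) := fun σ τ =>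
    (Integrable.fintype_prod (f := fun j y => f (σ j) y * g (τ j) y * w y)
      fun j => h (σ j) (τ j)).const_mul _
  rw [integral_finsetSum _ fun σ _ => integrable_finsetSum _ fun τ _ => hint σ τ]
  have hσ : ∀ σ : Equiv.Perm (Fin N), ∫ x : Fin N → ℝ, ∑ τ : Equiv.Perm (Fin N),
      ((Equiv.Perm.sign σ : ℤ) : ℝ) * ((Equiv.Perm.sign τ : ℤ) : ℝ) *
          ∏ j, (f (σ j) (x j) * g (τ j) (x j) * w (x j)) =
      Matrix.det (Matrix.of fun i j => ∫ x, f i x * g j x * w x) := by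
    intro σ
    rw [integral_finsetSum _ fun τ _ => hint σ τ, ← Matrix.det_transpose, Matrix.det_apply']
    -- Only τσ⁻¹ matters, so every σ contributes the same determinant; there are N! of them.
    refine Fintype.sum_equiv (Equiv.mulRight σ⁻¹) _ _ fun τ => ?_
    rw [integral_const_mul, integral_fintype_prod_volume_eq_prod
      (fun j y => f (σ j) y * g (τ j) y * w y)]
    congr 1
    · simp only [Equiv.coe_mulRight, Equiv.Perm.sign_mul, Equiv.Perm.sign_inv]
      push_cast
      ring
    · refine Fintype.prod_equiv σ _ _ fun j => ?_
      simp
  rw [Finset.sum_congr rfl fun σ _ => hσ σ]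
  simp [Fintype.card_perm]

/-! ### Integrals with respect to the law of the eigenvalues -/

/-- The density of the unnormalized law. -/
def jointDensity (w : ℝ → ℝ) (N : ℕ) (x : Fin N → ℝ) : ℝ :=
  (∏ i : Fin N, ∏ j ∈ Finset.Ioi i, (x i - x j) ^ 2) * ∏ i, w (x i)

theorem jointDensity_eq (w : ℝ → ℝ) {N : ℕ} (x : Fin N → ℝ) :
    jointDensity w N x = vdm x * vdm x * ∏ i, w (x i) := by
  rw [jointDensity, ← sq, vdm, ← Finset.prod_pow]
  simp only [Finset.prod_pow]

theorem jointDensity_nonneg {w : ℝ → ℝ} (hw : ∀ x, 0 ≤ w x) {N : ℕ} (x : Fin N → ℝ) :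
    0 ≤ jointDensity w N x :=
  mul_nonneg (Finset.prod_nonneg fun _ _ => Finset.prod_nonneg fun _ _ => sq_nonneg _)
    (Finset.prod_nonneg fun _ _ => hw _)

theorem measurable_jointDensity {w : ℝ → ℝ} (hw : Measurable w) (N : ℕ) :
    Measurable (jointDensity w N) := by
  unfold jointDensity
  fun_prop

/-- Integrability and `hne` make the total mass finite and nonzero, so the inverse in
`eigenvalueLaw` is a genuine normalisation and not a default value. -/
theorem integral_eigenvalueLaw {w : ℝ → ℝ} (hwm : Measurable w) (hw : ∀ x, 0 ≤ w x) {N : ℕ}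
    (hint : Integrable (jointDensity w N)) (hne : ∫ x, jointDensity w N x ≠ 0)
    {f : (Fin N → ℝ) → ℂ} (hf : Integrable fun x => (jointDensity w N x : ℂ) * f x) :
    Integrable f (eigenvalueLaw w N) ∧ ∫ x, f x ∂(eigenvalueLaw w N) =
      ((∫ x, jointDensity w N x : ℝ) : ℂ)⁻¹ * ∫ x, (jointDensity w N x : ℂ) * f x := by
  have hm : Measurable fun x => ENNReal.ofReal (jointDensity w N x) :=
    (measurable_jointDensity hwm N).ennreal_ofReal
  have hlaw : unnormalizedLaw w N = volume.withDensity fun x =>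
      ENNReal.ofReal (jointDensity w N x) := rfl
  have hsmul : ∀ x, (ENNReal.ofReal (jointDensity w N x)).toReal • f x =
      (jointDensity w N x : ℂ) * f x := by
    intro x
    rw [ENNReal.toReal_ofReal (jointDensity_nonneg hw x), Complex.real_smul]
  have hmass : unnormalizedLaw w N Set.univ = ENNReal.ofReal (∫ x, jointDensity w N x) := by
    rw [hlaw, withDensity_apply _ MeasurableSet.univ, Measure.restrict_univ,
      ofReal_integral_eq_lintegral_ofReal hint (ae_of_all _ (jointDensity_nonneg hw))]
  have hpos : 0 < ∫ x, jointDensity w N x :=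
    lt_of_le_of_ne (integral_nonneg (jointDensity_nonneg hw)) hne.symm
  have h1 : Integrable f (unnormalizedLaw w N) := by
    rw [hlaw, integrable_withDensity_iff_integrable_smul' hm (ae_of_all _ fun _ =>
      ENNReal.ofReal_lt_top)]
    simpa only [hsmul] using hf
  have h2 : ∫ x, f x ∂(unnormalizedLaw w N) = ∫ x, (jointDensity w N x : ℂ) * f x := by
    rw [hlaw, integral_withDensity_eq_integral_toReal_smul hm (ae_of_all _ fun _ =>
      ENNReal.ofReal_lt_top)]
    simp only [hsmul]
  constructor
  · exact h1.smul_measure (ENNReal.inv_ne_top.2 (by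
      rw [hmass]
      exact (ENNReal.ofReal_pos.2 hpos).ne'))
  · rw [eigenvalueLaw, integral_smul_measure, h2, hmass, ENNReal.toReal_inv,
      ENNReal.toReal_ofReal hpos.le, Complex.real_smul, Complex.ofReal_inv]

/-- Preimages under a symmetric function are permutation-invariant events, so `F` and `f` have the
same distribution on ℂ, and hence the same integral. -/
theorem IsEnsemble.integral_eq {Ω : Type*} [MeasurableSpace Ω] {P : Measure Ω} {w : ℝ → ℝ} {N : ℕ}
    {M : Ω → Matrix (Fin N) (Fin N) ℂ} (h : IsEnsemble P w M) {F : Ω → ℂ} (hF : Measurable F)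
    {f : (Fin N → ℝ) → ℂ} (hf : Measurable f)
    (hsymm : ∀ (σ : Equiv.Perm (Fin N)) (x : Fin N → ℝ), f (x ∘ σ) = f x)
    (heq : ∀ ω, F ω = f (h.isHermitian ω).eigenvalues)
    (hint : Integrable f (eigenvalueLaw w N)) :
    Integrable F P ∧ ∫ ω, F ω ∂P = ∫ x, f x ∂(eigenvalueLaw w N) := by
  have hmap : P.map F = (eigenvalueLaw w N).map f := by
    ext B hB
    rw [Measure.map_apply hF hB, Measure.map_apply hf hB, ← h.law _ (hf hB)]
    · congr 1
      ext ω
      simp [heq]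
    · intro σ x hx
      rwa [Set.mem_preimage, hsymm]
  have hid : AEStronglyMeasurable (id : ℂ → ℂ) (P.map F) :=
    measurable_id.aestronglyMeasurable
  constructor
  · have h1 := (integrable_map_measure (g := id) (hmap ▸ hid) hf.aemeasurable).2 hint
    rw [← hmap] at h1
    exact (integrable_map_measure (g := id) hid hF.aemeasurable).1 h1
  · have h1 := integral_map hF.aemeasurable hid
    have h2 := integral_map hf.aemeasurable (hmap ▸ hid)
    simp only [id] at h1 h2
    rw [← h1, ← h2, hmap]

/-! ### The characteristic polynomial ratio -/

/-- Every factor is read off from the characteristic polynomial, det(1 - XM) being its reverse. So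
`M` may be replaced by the diagonal matrix of its eigenvalues, in any order. -/
theorem charRatio_congr {N p q : ℕ} (t : Fin p → ℂ) {A B : Matrix (Fin N) (Fin N) ℂ}
    (h : A.charpoly = B.charpoly) : charRatio t q A = charRatio t q B := by
  have h1 : ∀ s, (Matrix.scalar (Fin N) s - A).det = (Matrix.scalar (Fin N) s - B).det := by
    intro s
    rw [← Matrix.eval_charpoly, h, Matrix.eval_charpoly]
  have h2 : ∀ (M : Matrix (Fin N) (Fin N) ℂ) (k : Fin q),
      (1 - (MvPowerSeries.X k : MvPowerSeries (Fin q) ℂ) • M.map MvPowerSeries.C).det =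
        Polynomial.eval₂RingHom MvPowerSeries.C (MvPowerSeries.X k) M.charpoly.reverse := by
    intro M k
    rw [Matrix.reverse_charpoly, Matrix.charpolyRev, RingHom.map_det]
    congr 1
    ext1 i j
    by_cases hij : i = j
    · subst hij
      simp only [Matrix.sub_apply, Matrix.one_apply_eq, Matrix.smul_apply, Matrix.map_apply,
        smul_eq_mul, RingHom.mapMatrix_apply, map_sub, map_one, Polynomial.X_mul_C]
      simp [mul_comm (MvPowerSeries.X k)]
    · simp only [Matrix.sub_apply, Matrix.one_apply_ne hij, Matrix.smul_apply, Matrix.map_apply,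
        smul_eq_mul, RingHom.mapMatrix_apply, map_sub, map_zero, Polynomial.X_mul_C]
      simp [mul_comm (MvPowerSeries.X k)]
  unfold charRatio
  simp only [h1, h2, h]

theorem charpoly_diagonal_comp {N : ℕ} (x : Fin N → ℝ) (σ : Equiv.Perm (Fin N)) :
    (Matrix.diagonal fun i => (((x ∘ σ) i : ℝ) : ℂ)).charpoly =
      (Matrix.diagonal fun i => (x i : ℂ)).charpoly := by
  rw [Matrix.charpoly_diagonal, Matrix.charpoly_diagonal]
  exact Fintype.prod_equiv σ _ _ fun _ => rfl

theorem charRatio_diagonal {N p q : ℕ} (t : Fin p → ℂ) (x : Fin N → ℝ) :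
    charRatio t q (Matrix.diagonal fun i => (x i : ℂ)) =
      (∏ k : Fin q, MvPowerSeries.X k ^ N) * (MvPowerSeries.C (∏ j, ∏ i, (t j - (x i : ℂ))) *
        ∏ i, geomSeries q (x i)) := by
  have h1 : ∀ s, (Matrix.scalar (Fin N) s - Matrix.diagonal fun i => (x i : ℂ)).det =
      ∏ i, (s - (x i : ℂ)) := by
    intro s
    rw [Matrix.scalar_apply, Matrix.diagonal_sub, Matrix.det_diagonal]
  have h2 : ∀ k : Fin q, (1 - (MvPowerSeries.X k : MvPowerSeries (Fin q) ℂ) •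
      (Matrix.diagonal fun i => (x i : ℂ)).map MvPowerSeries.C).det =
        ∏ i, (1 - MvPowerSeries.C (x i : ℂ) * MvPowerSeries.X k) := by
    intro k
    rw [← Matrix.det_diagonal]
    congr 1
    ext1 i j
    by_cases hij : i = j
    · subst hij
      simp [mul_comm]
    · simp [hij]
  unfold charRatio
  simp only [h1, h2]
  rw [Finset.prod_mul_distrib, mul_left_comm]
  congr 2
  have h3 : (∏ k : Fin q, ∏ i, (1 - MvPowerSeries.C (x i : ℂ) * MvPowerSeries.X k)) *
      ∏ i, geomSeries q (x i) = 1 := by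
    rw [Finset.prod_comm, ← Finset.prod_mul_distrib]
    exact Finset.prod_eq_one fun i _ => prod_mul_geomSeries q (x i)
  have h4 : (∏ k : Fin q, ∏ i, (1 - MvPowerSeries.C (x i : ℂ) * MvPowerSeries.X k)) *
      ∏ k : Fin q, (∏ i, (1 - MvPowerSeries.C (x i : ℂ) * MvPowerSeries.X k))⁻¹ = 1 := by
    rw [← Finset.prod_mul_distrib]
    refine Finset.prod_eq_one fun k _ => MvPowerSeries.mul_inv_cancel _ ?_
    rw [map_prod]
    refine Finset.prod_ne_zero_iff.2 fun i _ => ?_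
    simp
  have h5 := left_ne_zero_of_mul_eq_one h4
  exact mul_left_cancel₀ h5 (h4.trans h3.symm)

/-! ### Measurability of coefficients -/

/-- All coefficients of a family of power series are measurable. -/
def CoeffMeasurable {α : Type*} [MeasurableSpace α] {q : ℕ} (F : α → MvPowerSeries (Fin q) ℂ) :
    Prop :=
  ∀ d, Measurable fun a => MvPowerSeries.coeff d (F a)

section CoeffMeasurable

variable {α : Type*} [MeasurableSpace α] {q : ℕ}

theorem CoeffMeasurable.const (f : MvPowerSeries (Fin q) ℂ) :
    CoeffMeasurable fun _ : α => f := fun _ => measurable_const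

theorem CoeffMeasurable.C {g : α → ℂ} (hg : Measurable g) :
    CoeffMeasurable fun a => (MvPowerSeries.C (g a) : MvPowerSeries (Fin q) ℂ) := by
  intro d
  simp only [MvPowerSeries.coeff_C]
  split_ifs
  · exact hg
  · exact measurable_const

theorem CoeffMeasurable.sub {F G : α → MvPowerSeries (Fin q) ℂ} (hF : CoeffMeasurable F)
    (hG : CoeffMeasurable G) : CoeffMeasurable fun a => F a - G a := by
  intro d
  simp only [map_sub]
  exact (hF d).sub (hG d)

theorem CoeffMeasurable.mul {F G : α → MvPowerSeries (Fin q) ℂ} (hF : CoeffMeasurable F)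
    (hG : CoeffMeasurable G) : CoeffMeasurable fun a => F a * G a := by
  intro d
  simp only [MvPowerSeries.coeff_mul]
  exact Finset.measurable_sum _ fun c _ => (hF c.1).mul (hG c.2)

theorem CoeffMeasurable.sum {ι : Type*} {s : Finset ι} {F : ι → α → MvPowerSeries (Fin q) ℂ}
    (hF : ∀ i ∈ s, CoeffMeasurable (F i)) : CoeffMeasurable fun a => ∑ i ∈ s, F i a := by
  intro d
  simp only [map_sum]
  exact Finset.measurable_sum _ fun i hi => hF i hi d

theorem CoeffMeasurable.prod {ι : Type*} {s : Finset ι} {F : ι → α → MvPowerSeries (Fin q) ℂ}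
    (hF : ∀ i ∈ s, CoeffMeasurable (F i)) : CoeffMeasurable fun a => ∏ i ∈ s, F i a := by
  classical
  induction s using Finset.induction_on with
  | empty => simpa using CoeffMeasurable.const 1
  | insert i s hi ih =>
    simp only [Finset.prod_insert hi]
    exact (hF i (Finset.mem_insert_self _ _)).mul
      (ih fun j hj => hF j (Finset.mem_insert_of_mem hj))

theorem CoeffMeasurable.det {n : ℕ} {A : α → Matrix (Fin n) (Fin n) (MvPowerSeries (Fin q) ℂ)}
    (hA : ∀ i j, CoeffMeasurable fun a => A a i j) : CoeffMeasurable fun a => (A a).det := by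
  simp only [Matrix.det_apply']
  exact CoeffMeasurable.sum fun σ _ => (CoeffMeasurable.const _).mul
    (CoeffMeasurable.prod fun i _ => hA _ _)

/-- Induction on the degree: a coefficient of the inverse is a polynomial in coefficients of `F`,
inverse coefficients of lower degree and the inverse of the constant term. -/
theorem CoeffMeasurable.inv {F : α → MvPowerSeries (Fin q) ℂ} (hF : CoeffMeasurable F) :
    CoeffMeasurable fun a => (F a)⁻¹ := by
  classical
  have h0 : Measurable fun a => (MvPowerSeries.constantCoeff (F a))⁻¹ := by
    have h : Measurable fun a => (MvPowerSeries.coeff 0 (F a))⁻¹ := (hF 0).inv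
    simpa only [MvPowerSeries.coeff_zero_eq_constantCoeff_apply] using h
  have h : ∀ n, ∀ d : Fin q →₀ ℕ, d.degree = n →
      Measurable fun a => MvPowerSeries.coeff d (F a)⁻¹ := by
    intro n
    induction n using Nat.strong_induction_on with
    | _ n ih =>
      intro d hd
      rw [funext fun a => MvPowerSeries.coeff_inv d (F a)]
      split_ifs with h1
      · exact h0
      · refine h0.neg.mul (Finset.measurable_sum _ fun c hc => ?_)
        by_cases h2 : c.2 < d
        · simp only [if_pos h2]
          refine (hF c.1).mul (ih _ ?_ c.2 rfl)
          rw [← hd]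
          have h3 := tsub_add_cancel_of_le h2.le
          have h4 : (d - c.2).degree + c.2.degree = d.degree := by rw [← map_add, h3]
          have h5 : (d - c.2).degree ≠ 0 := by
            rw [Ne, Finsupp.degree_eq_zero_iff, tsub_eq_zero_iff_le]
            exact fun h => absurd h2 (not_lt_of_ge h)
          omega
        · simp only [if_neg h2]
          exact measurable_const
  exact fun d => h _ d rfl

theorem coeffMeasurable_charRatio {N p : ℕ} (t : Fin p → ℂ) {M : α → Matrix (Fin N) (Fin N) ℂ}
    (hM : ∀ i j, Measurable fun a => M a i j) : CoeffMeasurable fun a => charRatio t q (M a) := by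
  unfold charRatio
  refine (CoeffMeasurable.C ?_).mul (CoeffMeasurable.prod fun k _ =>
    (CoeffMeasurable.const _).mul (CoeffMeasurable.inv (CoeffMeasurable.det fun i j => ?_)))
  · refine Finset.measurable_prod _ fun j _ => ?_
    simp only [Matrix.det_apply']
    refine Finset.measurable_sum _ fun σ _ => measurable_const.mul
      (Finset.measurable_prod _ fun i _ => ?_)
    simp only [Matrix.sub_apply]
    exact measurable_const.sub (hM _ _)
  · simp only [Matrix.sub_apply, Matrix.smul_apply, Matrix.map_apply, smul_eq_mul]
    exact (CoeffMeasurable.const _).sub ((CoeffMeasurable.const _).mul (CoeffMeasurable.C (hM i j)))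

end CoeffMeasurable

/-! ### Expectations in terms of moments -/

/-- A weight with all moments, and the integrals `∫ x^m φ_n(x) w(x) dx` for a sequence of
polynomials `φ_n` of degree `n` orthogonal with respect to it. -/
structure IsOrthogonal (w : ℝ → ℝ) (φ : ℕ → Polynomial ℝ) (I : ℕ → ℕ → ℝ) : Prop where
  measurable : Measurable w
  nonneg : ∀ x, 0 ≤ w x
  integrable : ∀ m : ℕ, Integrable fun x => x ^ m * w x
  natDegree_le : ∀ n, (φ n).natDegree ≤ n
  coeff_ne_zero : ∀ n, (φ n).coeff n ≠ 0
  integral_eq : ∀ m n, ∫ x, x ^ m * (φ n).eval x * w x = I m n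
  eq_zero_of_lt : ∀ m n, m < n → I m n = 0
  diag_ne_zero : ∀ n, I n n ≠ 0

/-- The determinant of the matrix of the integrals `∫ x^{mu_i + N - i} φ_{nu_j + N - j} w`. -/
def momentDet (I : ℕ → ℕ → ℝ) (N : ℕ) (mu nu : YoungDiagram) : ℝ :=
  Matrix.det (Matrix.of fun i j : Fin N => I (expo N mu i) (expo N nu j))

section

variable {w : ℝ → ℝ} {φ : ℕ → Polynomial ℝ} {I : ℕ → ℕ → ℝ}

theorem integrable_pow_mul_eval (hw : ∀ m : ℕ, Integrable fun x => x ^ m * w x) (m : ℕ)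
    (f : Polynomial ℝ) : Integrable fun x => x ^ m * f.eval x * w x := by
  have h : (fun x => x ^ m * f.eval x * w x) = fun x => ∑ k ∈ f.support,
      f.coeff k * (x ^ (m + k) * w x) := by
    funext x
    rw [Polynomial.eval_eq_sum, Polynomial.sum, Finset.mul_sum, Finset.sum_mul]
    exact Finset.sum_congr rfl fun k _ => by ring
  rw [h]
  exact integrable_finsetSum _ fun k _ => (hw _).const_mul _

theorem integral_pow_mul_eval_sum (hw : ∀ m : ℕ, Integrable fun x => x ^ m * w x) (m n : ℕ)
    (c : ℕ → ℝ) : ∫ x, x ^ m * (∑ j ∈ Finset.range n,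
        Polynomial.C (c j) * Polynomial.X ^ j : Polynomial ℝ).eval x * w x =
      ∑ j ∈ Finset.range n, c j * ∫ x, x ^ (m + j) * w x := by
  have h : (fun x => x ^ m * (∑ j ∈ Finset.range n,
      Polynomial.C (c j) * Polynomial.X ^ j : Polynomial ℝ).eval x * w x) =
        fun x => ∑ j ∈ Finset.range n, c j * (x ^ (m + j) * w x) := by
    funext x
    simp only [Polynomial.eval_finsetSum, Polynomial.eval_mul, Polynomial.eval_C,
      Polynomial.eval_pow, Polynomial.eval_X]
    rw [Finset.mul_sum, Finset.sum_mul]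
    exact Finset.sum_congr rfl fun k _ => by ring
  rw [h, integral_finsetSum _ fun k _ => (hw _).const_mul _]
  simp only [integral_const_mul]

theorem IsOrthogonal.integrable_altDet (h : IsOrthogonal w φ I) (N : ℕ) (mu nu : YoungDiagram) :
    Integrable fun x : Fin N → ℝ => altDet (fun k => Polynomial.X ^ k) N mu x *
      altDet φ N nu x * ∏ j, w (x j) := by
  have := integrable_det_mul_det (fun i x => x ^ expo N mu i)
    (fun i x => (φ (expo N nu i)).eval x) w
    fun i j => integrable_pow_mul_eval h.integrable _ _
  simp only [altDet_X_pow]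
  simpa only [altDet, Polynomial.coe_aeval_eq_eval] using this

theorem IsOrthogonal.integral_altDet (h : IsOrthogonal w φ I) (N : ℕ) (mu nu : YoungDiagram) :
    ∫ x : Fin N → ℝ, altDet (fun k => Polynomial.X ^ k) N mu x *
      altDet φ N nu x * ∏ j, w (x j) = N.factorial * momentDet I N mu nu := by
  have := integral_det_mul_det (fun i x => x ^ expo N mu i)
    (fun i x => (φ (expo N nu i)).eval x) w
    fun i j => integrable_pow_mul_eval h.integrable _ _
  simp only [altDet_X_pow]
  simpa only [altDet, Polynomial.coe_aeval_eq_eval, h.integral_eq, momentDet] using this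

theorem altDet_bot {R : Type*} [CommRing R] [Algebra ℝ R] (hφ : ∀ k, (φ k).natDegree ≤ k) {N : ℕ}
    (x : Fin N → R) : altDet φ N ⊥ x =
      algebraMap ℝ R (∏ k ∈ Finset.range N, (φ k).coeff k) * vdm x := by
  rw [← det_rev_eq_vdm hφ, ← Matrix.det_transpose, altDet]
  congr 1
  ext1 i j
  simp only [Matrix.of_apply, Matrix.transpose_apply, expo_bot, Fin.val_rev]
  congr 2
  omega

theorem IsOrthogonal.momentDet_bot_ne_zero (h : IsOrthogonal w φ I) (N : ℕ) :
    momentDet I N ⊥ ⊥ ≠ 0 := by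
  rw [momentDet, det_skew_self (mu := ⊥)]
  · exact Finset.prod_ne_zero_iff.2 fun i _ => h.diag_ne_zero _
  · intro j k hjk
    exact h.eq_zero_of_lt _ _ ((expo_lt_iff_shift N ⊥ ⊥ j k).2 hjk)

/-- Orthogonality kills the entries of negative shift, which forces ν ⊆ μ. -/
theorem IsOrthogonal.momentDet_eq_zero (h : IsOrthogonal w φ I) {N : ℕ} {mu nu : YoungDiagram}
    (hnu : nu.colLen 0 ≤ N) (hle : ¬ nu ≤ mu) : momentDet I N mu nu = 0 :=
  det_eq_zero_of_not_le _ (fun j k hjk =>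
    h.eq_zero_of_lt _ _ ((expo_lt_iff_shift N mu nu j k).2 hjk)) hnu hle

theorem IsOrthogonal.leadProd_ne_zero (h : IsOrthogonal w φ I) (n : ℕ) :
    ∏ k ∈ Finset.range n, (φ k).coeff k ≠ 0 :=
  Finset.prod_ne_zero_iff.2 fun k _ => h.coeff_ne_zero k

/-- Writing both Vandermonde factors as alternants of the empty partition makes the normalisation an
instance of the same Andréief integral. -/
theorem IsOrthogonal.jointDensity_eq (h : IsOrthogonal w φ I) {N : ℕ} (x : Fin N → ℝ) :
    jointDensity w N x = (∏ k ∈ Finset.range N, (φ k).coeff k)⁻¹ *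
      (altDet (fun k => Polynomial.X ^ k) N ⊥ x * altDet φ N ⊥ x * ∏ j, w (x j)) := by
  rw [altDet_bot h.natDegree_le, altDet_bot fun k => Polynomial.natDegree_X_pow_le k,
    UnitaryEnsemble.jointDensity_eq]
  simp only [Polynomial.coeff_X_pow_self, Finset.prod_const_one, map_one, one_mul,
    Algebra.algebraMap_self, RingHom.id_apply]
  have := h.leadProd_ne_zero N
  field_simp

theorem IsOrthogonal.integrable_jointDensity (h : IsOrthogonal w φ I) (N : ℕ) :
    Integrable (jointDensity w N) := by
  rw [funext fun x => h.jointDensity_eq x]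
  exact (h.integrable_altDet N ⊥ ⊥).const_mul _

theorem IsOrthogonal.integral_jointDensity (h : IsOrthogonal w φ I) (N : ℕ) :
    ∫ x, jointDensity w N x = (∏ k ∈ Finset.range N, (φ k).coeff k)⁻¹ *
      (N.factorial * momentDet I N ⊥ ⊥) := by
  rw [funext fun x => h.jointDensity_eq x, integral_const_mul, h.integral_altDet]

/-- The coefficient of the expansion of the expectation that belongs to `(lam, mu)`. -/
def expansionCoeff (φ : ℕ → Polynomial ℝ) (I : ℕ → ℕ → ℝ) (p N : ℕ) (lam mu : YoungDiagram) : ℝ :=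
  (∏ j ∈ Finset.Ico N (p + N), (φ j).coeff j)⁻¹ * ((-1) ^ (tilde p N lam).card *
    (momentDet I N mu (tilde p N lam) / momentDet I N ⊥ ⊥))

/-- One Vandermonde factor is used for each Cauchy identity. Fixing the monomial makes the sum
finite, so it can be integrated termwise. -/
theorem IsOrthogonal.density_mul_eq (h : IsOrthogonal w φ I) {p q N L : ℕ} (t : Fin p → ℂ)
    {d : Fin q →₀ ℕ} (hd : d.degree < L) (x : Fin N → ℝ) :
    (jointDensity w N x : ℂ) * ((∏ j, ∏ i, (t j - (x i : ℂ))) *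
      MvPowerSeries.coeff d (∏ i, geomSeries q (x i : ℂ))) =
    ∑ lam ∈ boxes p N, ∑ mu ∈ boxes N L,
      (((∏ k ∈ Finset.range (p + N), (φ k).coeff k)⁻¹ * (-1) ^ (tilde p N lam).card : ℝ) *
        MvPolynomial.aeval t (multiPoly φ p lam) * MvPowerSeries.coeff d (schurInv q mu)) *
      ((altDet (fun k => Polynomial.X ^ k) N mu x * altDet φ N (tilde p N lam) x *
        ∏ j, w (x j) : ℝ) : ℂ) := by
  have h1 := dual_cauchy h.natDegree_le t x
  have h2 := cauchy_identity (fun i => (x i : ℂ)) hd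
  have h3 : (((∏ k ∈ Finset.range (p + N), (φ k).coeff k : ℝ)) : ℂ) ≠ 0 :=
    Complex.ofReal_ne_zero.2 (h.leadProd_ne_zero _)
  have h4 : vdm (fun i => (x i : ℂ)) = ((vdm x : ℝ) : ℂ) := (map_vdm Complex.ofRealHom x).symm
  have h5 : ∀ mu, altDet (fun k => Polynomial.X ^ k) N mu (fun i => (x i : ℂ)) =
      ((altDet (fun k => Polynomial.X ^ k) N mu x : ℝ) : ℂ) := fun mu =>
    (map_altDet Complex.ofRealAm (fun k => Polynomial.X ^ k) mu x).symm
  rw [h4] at h2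
  simp only [h5] at h2
  rw [UnitaryEnsemble.jointDensity_eq]
  have h6 : (((vdm x * vdm x * ∏ i, w (x i) : ℝ)) : ℂ) * ((∏ j, ∏ i, (t j - (x i : ℂ))) *
      MvPowerSeries.coeff d (∏ i, geomSeries q (x i : ℂ))) =
      ((∏ k ∈ Finset.range (p + N), (φ k).coeff k : ℝ) : ℂ)⁻¹ *
      ((((∏ k ∈ Finset.range (p + N), (φ k).coeff k : ℝ) : ℂ) *
        ((∏ j, ∏ i, (t j - (x i : ℂ))) * (vdm x : ℝ))) *
        (((vdm x : ℝ) : ℂ) * MvPowerSeries.coeff d (∏ i, geomSeries q (x i : ℂ)))) *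
        ((∏ i, w (x i) : ℝ) : ℂ) := by
    rw [mul_assoc (((∏ k ∈ Finset.range (p + N), (φ k).coeff k : ℝ)) : ℂ), inv_mul_cancel_left₀ h3,
      Complex.ofReal_mul, Complex.ofReal_mul]
    ring
  rw [h6, h1, h2, Finset.sum_mul_sum, Finset.mul_sum, Finset.sum_mul]
  refine Finset.sum_congr rfl fun lam _ => ?_
  rw [Finset.mul_sum, Finset.sum_mul]
  refine Finset.sum_congr rfl fun mu _ => ?_
  push_cast
  ring

theorem IsOrthogonal.expectation_coeff (h : IsOrthogonal w φ I) {p q N L : ℕ} (t : Fin p → ℂ)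
    {d : Fin q →₀ ℕ} (hd : d.degree < L) :
    Integrable (fun x : Fin N → ℝ => (∏ j, ∏ i, (t j - (x i : ℂ))) *
      MvPowerSeries.coeff d (∏ i, geomSeries q (x i : ℂ))) (eigenvalueLaw w N) ∧
    ∫ x : Fin N → ℝ, (∏ j, ∏ i, (t j - (x i : ℂ))) *
      MvPowerSeries.coeff d (∏ i, geomSeries q (x i : ℂ)) ∂(eigenvalueLaw w N) =
    ∑ lam ∈ boxes p N, ∑ mu ∈ boxes N L, (expansionCoeff φ I p N lam mu : ℂ) *
        MvPolynomial.aeval t (multiPoly φ p lam) * MvPowerSeries.coeff d (schurInv q mu) := by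
  have hne : ∫ x, jointDensity w N x ≠ 0 := by
    rw [h.integral_jointDensity]
    exact mul_ne_zero (inv_ne_zero (h.leadProd_ne_zero N))
      (mul_ne_zero (Nat.cast_ne_zero.2 N.factorial_ne_zero) (h.momentDet_bot_ne_zero N))
  have hterm : ∀ lam mu : YoungDiagram, Integrable fun x : Fin N → ℝ =>
      (((∏ k ∈ Finset.range (p + N), (φ k).coeff k)⁻¹ * (-1) ^ (tilde p N lam).card : ℝ) *
        MvPolynomial.aeval t (multiPoly φ p lam) * MvPowerSeries.coeff d (schurInv q mu)) *
      ((altDet (fun k => Polynomial.X ^ k) N mu x * altDet φ N (tilde p N lam) x *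
        ∏ j, w (x j) : ℝ) : ℂ) := fun lam mu =>
    (h.integrable_altDet N mu (tilde p N lam)).ofReal.const_mul _
  have hint := integral_eigenvalueLaw h.measurable h.nonneg (h.integrable_jointDensity N) hne
    (f := fun x : Fin N → ℝ => (∏ j, ∏ i, (t j - (x i : ℂ))) *
      MvPowerSeries.coeff d (∏ i, geomSeries q (x i : ℂ))) (by
    simp only [h.density_mul_eq t hd]
    exact integrable_finsetSum _ fun lam _ => integrable_finsetSum _ fun mu _ => hterm lam mu)
  refine ⟨hint.1, hint.2.trans ?_⟩
  simp only [h.density_mul_eq t hd]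
  rw [integral_finsetSum _ fun lam _ => integrable_finsetSum _ fun mu _ => hterm lam mu,
    Finset.mul_sum]
  refine Finset.sum_congr rfl fun lam _ => ?_
  rw [integral_finsetSum _ fun mu _ => hterm lam mu, Finset.mul_sum]
  refine Finset.sum_congr rfl fun mu _ => ?_
  rw [integral_const_mul, integral_complex_ofReal, h.integral_altDet, h.integral_jointDensity]
  -- The dual Cauchy identity involves the leading coefficients of degrees below p + N, the
  -- normalisation those below N; the quotient leaves the degrees from N to p + N - 1.
  have h1 : (∏ k ∈ Finset.range N, (φ k).coeff k) * ∏ j ∈ Finset.Ico N (p + N), (φ j).coeff j =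
      ∏ k ∈ Finset.range (p + N), (φ k).coeff k :=
    Finset.prod_range_mul_prod_Ico _ (Nat.le_add_left N p)
  have h2 : ((∏ k ∈ Finset.range N, (φ k).coeff k)⁻¹ * (N.factorial * momentDet I N ⊥ ⊥))⁻¹ *
      (((∏ k ∈ Finset.range (p + N), (φ k).coeff k)⁻¹ * (-1) ^ (tilde p N lam).card) *
        (N.factorial * momentDet I N mu (tilde p N lam))) = expansionCoeff φ I p N lam mu := by
    have h3 := h.leadProd_ne_zero N
    have h4 := h.leadProd_ne_zero (p + N)
    have h5 := h.momentDet_bot_ne_zero N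
    have h6 : (N.factorial : ℝ) ≠ 0 := Nat.cast_ne_zero.2 N.factorial_ne_zero
    have h7 : ∏ j ∈ Finset.Ico N (p + N), (φ j).coeff j ≠ 0 := by
      rw [← h1] at h4
      exact right_ne_zero_of_mul h4
    rw [expansionCoeff, ← h1]
    field_simp
  rw [← h2]
  push_cast
  ring

/-- The expansion of the expectation of the characteristic polynomial ratio, given the
coefficients. -/
theorem IsOrthogonal.expectation_charRatio (h : IsOrthogonal w φ I) {Ω : Type*}
    [MeasurableSpace Ω] {P : Measure Ω} {N p q : ℕ} (t : Fin p → ℂ)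
    {M : Ω → Matrix (Fin N) (Fin N) ℂ} (hM : IsEnsemble P w M) (a : ℝ) (c : Triple p N → ℝ)
    (hc : ∀ s, a * c s = expansionCoeff φ I p N s.lam s.mu) :
    HasExpectation P (fun ω => charRatio t q (M ω)) ∧
      ∃ S : MvPowerSeries (Fin q) ℂ,
        HasFormalSum (fun s : Triple p N => MvPowerSeries.C
          ((c s : ℂ) * MvPolynomial.aeval t (multiPoly φ p s.lam)) * schurInv q s.mu) S ∧
        expectation P (fun ω => charRatio t q (M ω)) =
          MvPowerSeries.C (a : ℂ) * (∏ k : Fin q, MvPowerSeries.X k ^ N) * S := by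
  have hX : (∏ k : Fin q, (MvPowerSeries.X k : MvPowerSeries (Fin q) ℂ) ^ N) =
      MvPowerSeries.monomial (∑ k : Fin q, Finsupp.single k N) 1 := by
    simp only [MvPowerSeries.X_pow_eq, MvPowerSeries.prod_monomial, Finset.prod_const_one]
  set e : Fin q →₀ ℕ := ∑ k : Fin q, Finsupp.single k N with he
  have hcoeff : ∀ (x : Fin N → ℝ) (d : Fin q →₀ ℕ), MvPowerSeries.coeff d
      (charRatio t q (Matrix.diagonal fun i => (x i : ℂ))) = if e ≤ d then
        (∏ j, ∏ i, (t j - (x i : ℂ))) *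
          MvPowerSeries.coeff (d - e) (∏ i, geomSeries q (x i : ℂ)) else 0 := by
    intro x d
    rw [charRatio_diagonal, hX, MvPowerSeries.coeff_monomial_mul, one_mul,
      MvPowerSeries.coeff_C_mul]
  have hlaw : ∀ d, Integrable (fun ω => MvPowerSeries.coeff d (charRatio t q (M ω))) P ∧
      ∫ ω, MvPowerSeries.coeff d (charRatio t q (M ω)) ∂P = if e ≤ d then
        ∫ x : Fin N → ℝ, (∏ j, ∏ i, (t j - (x i : ℂ))) * MvPowerSeries.coeff (d - e)
          (∏ i, geomSeries q (x i : ℂ)) ∂(eigenvalueLaw w N) else 0 := by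
    intro d
    have hint : Integrable (fun x : Fin N → ℝ => MvPowerSeries.coeff d
        (charRatio t q (Matrix.diagonal fun i => (x i : ℂ)))) (eigenvalueLaw w N) := by
      simp only [hcoeff]
      split_ifs
      · exact (h.expectation_coeff t (Nat.lt_succ_self _)).1
      · exact integrable_zero _ _ _
    have h1 := hM.integral_eq (coeffMeasurable_charRatio (q := q) t hM.measurable d)
      (f := fun x : Fin N → ℝ => MvPowerSeries.coeff d
        (charRatio t q (Matrix.diagonal fun i => (x i : ℂ))))
      (coeffMeasurable_charRatio t (fun i j => by
        by_cases hij : i = j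
        · subst hij
          simp only [Matrix.diagonal_apply_eq]
          fun_prop
        · simp only [Matrix.diagonal_apply_ne _ hij]
          exact measurable_const) d)
      (fun σ x => by rw [charRatio_congr t (charpoly_diagonal_comp x σ)])
      (fun ω => by
        change MvPowerSeries.coeff d (charRatio t q (M ω)) = _
        rw [charRatio_congr t (A := M ω)]
        rw [(hM.isHermitian ω).charpoly_eq, Matrix.charpoly_diagonal]
        rfl) hint
    refine ⟨h1.1, h1.2.trans ?_⟩
    simp only [hcoeff]
    split_ifs
    · rfl
    · simp
  obtain ⟨S, hS⟩ : ∃ S : MvPowerSeries (Fin q) ℂ, ∀ d, MvPowerSeries.coeff d S =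
      ∑ᶠ s : Triple p N, MvPowerSeries.coeff d (MvPowerSeries.C
        ((c s : ℂ) * MvPolynomial.aeval t (multiPoly φ p s.lam)) * schurInv q s.mu) :=
    ⟨fun d => ∑ᶠ s : Triple p N, MvPowerSeries.coeff d (MvPowerSeries.C
        ((c s : ℂ) * MvPolynomial.aeval t (multiPoly φ p s.lam)) * schurInv q s.mu), fun _ => rfl⟩
  -- A triple is determined by λ and μ, since ν = λ̃.
  let pair : Triple p N → YoungDiagram × YoungDiagram := fun s => (s.lam, s.mu)
  have hpair : Function.Injective pair := by
    rintro ⟨l, m, n, _, h1, _, _⟩ ⟨l', m', n', _, h1', _, _⟩ hs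
    simp only [pair, Prod.mk.injEq] at hs
    obtain ⟨rfl, rfl⟩ := hs
    subst h1
    subst h1'
    rfl
  have hsupp : ∀ d : Fin q →₀ ℕ, (Function.support fun s : Triple p N => MvPowerSeries.coeff d
      (MvPowerSeries.C ((c s : ℂ) * MvPolynomial.aeval t (multiPoly φ p s.lam)) *
        schurInv q s.mu)) ⊆
      ((boxes p N ×ˢ boxes N (d.degree + 1)).preimage pair hpair.injOn : Set _) := by
    intro d s hs
    rw [Finset.mem_coe, Finset.mem_preimage, Finset.mem_product]
    refine ⟨mem_boxes.2 s.lam_le, mem_boxes.2 (le_rect_iff.2 ⟨s.length_le, fun i => ?_⟩)⟩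
    by_contra hlt
    apply hs
    change MvPowerSeries.coeff d _ = 0
    rw [MvPowerSeries.coeff_C_mul, coeff_schurInv_eq_zero, mul_zero]
    have h1 := s.mu.rowLen_anti 0 i (Nat.zero_le i)
    change ¬ s.mu.rowLen i ≤ _ at hlt
    omega
  refine ⟨fun d => (hlaw d).1, S, ?_, ?_⟩
  · exact fun d => ⟨(Finset.finite_toSet _).subset (hsupp d), (hS d).symm⟩
  · refine MvPowerSeries.ext fun d => ?_
    rw [mul_assoc, MvPowerSeries.coeff_C_mul, hX, MvPowerSeries.coeff_monomial_mul, one_mul]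
    refine (hlaw d).2.trans ?_
    split_ifs with hed
    swap
    · rw [mul_zero]
    rw [(h.expectation_coeff t (Nat.lt_succ_self _)).2, ← Finset.sum_product']
    rw [hS, finsum_eq_sum_of_support_subset _ (hsupp (d - e)), Finset.mul_sum]
    rw [← Finset.sum_preimage pair _ hpair.injOn]
    · refine Finset.sum_congr rfl fun s _ => ?_
      rw [MvPowerSeries.coeff_C_mul]
      simp only [pair]
      rw [← hc]
      push_cast
      ring
    -- A pair that comes from no triple has λ̃ ⊄ μ, and its moment determinant vanishes.
    · rintro ⟨lam, mu⟩ hm hr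
      simp only [Finset.mem_product, mem_boxes] at hm
      have hle : ¬ tilde p N lam ≤ mu := fun hle =>
        hr ⟨⟨lam, mu, _, hm.1, rfl, hle, (le_rect_iff.1 hm.2).1⟩, rfl⟩
      simp only [expansionCoeff, h.momentDet_eq_zero (tilde_colLen_le p N lam) hle]
      simp

end

/-! ### The Hermite case -/

theorem integrable_pow_mul_gaussianWeight (m : ℕ) :
    Integrable fun x : ℝ => x ^ m * gaussianWeight x := by
  have h := integrable_rpow_mul_exp_neg_mul_sq (b := 1 / 2) (by norm_num) (s := m)
    (by have := Nat.cast_nonneg (α := ℝ) m; linarith)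
  refine h.congr (ae_of_all _ fun x => ?_)
  simp only [Real.rpow_natCast, gaussianWeight]
  congr 2
  ring

theorem hasDerivAt_gaussianWeight (x : ℝ) : HasDerivAt gaussianWeight (-x * gaussianWeight x) x := by
  have h : HasDerivAt (fun y : ℝ => -y ^ 2 / 2) (-x) x := by
    have := ((hasDerivAt_pow 2 x).neg).div_const 2
    convert! this using 1
    simp
    ring
  convert! h.exp using 1
  rw [gaussianWeight]
  ring

/-- The integrand is the derivative of f(x) e^{-x²/2}. This gives both the recursion of the moments
and the step from H_n to H_{n+1}. -/
theorem integral_derivative_gaussian (f : Polynomial ℝ) :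
    ∫ x, (f.derivative.eval x - x * f.eval x) * gaussianWeight x = 0 := by
  have hint : ∀ g : Polynomial ℝ, Integrable fun x => g.eval x * gaussianWeight x := fun g => by
    simpa using integrable_pow_mul_eval integrable_pow_mul_gaussianWeight 0 g
  refine integral_eq_zero_of_hasDerivAt_of_integrable (f := fun x => f.eval x * gaussianWeight x)
    (fun x => ?_) ?_ (hint f)
  · convert! (f.hasDerivAt x).mul (hasDerivAt_gaussianWeight x) using 1
    ring
  · have := hint (f.derivative - Polynomial.X * f)
    simpa using this

/-- The integrals `∫ x^m H_n(x) e^{-x²/2} dx`. -/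
def hermiteMoment (m n : ℕ) : ℝ :=
  if n ≤ m ∧ Even (m - n) then
    Real.sqrt (2 * Real.pi) * m.factorial / (((m - n) / 2).factorial * 2 ^ ((m - n) / 2)) else 0

theorem integral_pow_gaussian (m : ℕ) : ∫ x, x ^ m * gaussianWeight x = hermiteMoment m 0 := by
  induction m using Nat.twoStepInduction with
  | zero =>
    have h := integral_gaussian (1 / 2)
    simp only [pow_zero, one_mul, hermiteMoment, gaussianWeight]
    rw [if_pos ⟨le_rfl, by simp⟩]
    have h2 : ∀ x : ℝ, -x ^ 2 / 2 = -(1 / 2) * x ^ 2 := fun x => by ring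
    simp only [h2, h]
    simp [mul_comm]
  | one =>
    have h := integral_derivative_gaussian 1
    simp only [Polynomial.derivative_one, Polynomial.eval_zero, Polynomial.eval_one, mul_one,
      zero_sub, neg_mul, integral_neg, neg_eq_zero] at h
    simp [hermiteMoment, h]
  | more m ih _ =>
    have h := integral_derivative_gaussian (Polynomial.X ^ (m + 1))
    have h1 : ∀ x : ℝ, ((Polynomial.X ^ (m + 1) : Polynomial ℝ).derivative.eval x -
        x * (Polynomial.X ^ (m + 1) : Polynomial ℝ).eval x) * gaussianWeight x =
        (m + 1) * (x ^ m * gaussianWeight x) - x ^ (m + 2) * gaussianWeight x := by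
      intro x
      simp
      ring
    simp only [h1] at h
    rw [integral_sub ((integrable_pow_mul_gaussianWeight m).const_mul _)
      (integrable_pow_mul_gaussianWeight _), integral_const_mul, ih, sub_eq_zero] at h
    rw [← h]
    simp only [hermiteMoment, Nat.zero_le, true_and, Nat.sub_zero]
    have he : Even (m + 2) ↔ Even m := by
      simp [Nat.even_add]
    simp only [he]
    split_ifs with hm
    · obtain ⟨k, rfl⟩ := hm
      have e1 : (k + k) / 2 = k := by omega
      have e2 : (k + k + 2) / 2 = k + 1 := by omega
      rw [e1, e2, Nat.factorial_succ, Nat.factorial_succ (k + k), Nat.factorial_succ k]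
      have := Nat.cast_ne_zero (R := ℝ).2 k.factorial_ne_zero
      have h3 : ((k : ℝ) + 1) ≠ 0 := by positivity
      push_cast
      field_simp
      ring
    · simp

theorem hermitePoly_succ (n : ℕ) : hermitePoly (n + 1) =
    Polynomial.X * hermitePoly n - (hermitePoly n).derivative := by
  simp [hermitePoly, Polynomial.hermite_succ, Polynomial.derivative_map]

/-- Since H_{n+1} = x H_n - H_n', integration by parts turns ∫ x^m H_{n+1} w into m ∫ x^{m-1} H_n w.
Iteration reduces to n = 0, or to zero once the power is exhausted. -/
theorem integral_pow_mul_hermite (m n : ℕ) :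
    ∫ x, x ^ m * (hermitePoly n).eval x * gaussianWeight x = hermiteMoment m n := by
  induction n generalizing m with
  | zero =>
    rw [← integral_pow_gaussian]
    simp [hermitePoly]
  | succ n ih =>
    have hint := integrable_pow_mul_eval integrable_pow_mul_gaussianWeight
    have h := integral_derivative_gaussian (Polynomial.X ^ m * hermitePoly n)
    have h1 : ∀ x : ℝ, ((Polynomial.X ^ m * hermitePoly n).derivative.eval x -
        x * (Polynomial.X ^ m * hermitePoly n).eval x) * gaussianWeight x =
        m * (x ^ (m - 1) * (hermitePoly n).eval x * gaussianWeight x) -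
          x ^ m * (hermitePoly (n + 1)).eval x * gaussianWeight x := by
      intro x
      rw [hermitePoly_succ, Polynomial.derivative_mul, Polynomial.derivative_X_pow]
      simp
      ring
    simp only [h1] at h
    rw [integral_sub ((hint _ _).const_mul _) (hint _ _), integral_const_mul, ih, sub_eq_zero] at h
    rw [← h]
    cases m with
    | zero => simp [hermiteMoment]
    | succ m =>
      simp only [hermiteMoment, Nat.add_sub_cancel, Nat.add_le_add_iff_right, Nat.add_sub_add_right]
      split_ifs
      · rw [Nat.factorial_succ]
        push_cast
        ring
      · simp

theorem hermite_isOrthogonal : IsOrthogonal gaussianWeight hermitePoly hermiteMoment where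
  measurable := by
    unfold gaussianWeight
    fun_prop
  nonneg x := (Real.exp_pos _).le
  integrable := integrable_pow_mul_gaussianWeight
  natDegree_le n := Polynomial.natDegree_map_le.trans Polynomial.natDegree_hermite.le
  coeff_ne_zero n := by simp [hermitePoly]
  integral_eq := integral_pow_mul_hermite
  eq_zero_of_lt m n h := if_neg fun h' => by omega
  diag_ne_zero n := by
    have := Real.pi_pos
    have := n.factorial_pos
    simp only [hermiteMoment, le_refl, Nat.sub_self, Even.zero, and_self, if_true]
    positivity

/-! ### The Laguerre case -/

theorem measurable_laguerreWeight (γ : ℝ) : Measurable (laguerreWeight γ) := by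
  unfold laguerreWeight
  exact Measurable.ite measurableSet_Ioi (by fun_prop) measurable_const

theorem pow_mul_laguerreWeight (γ : ℝ) (m : ℕ) (x : ℝ) : x ^ m * laguerreWeight γ x =
    (Set.Ioi (0 : ℝ)).indicator (fun x => Real.exp (-x) * x ^ (m + γ + 1 - 1)) x := by
  unfold laguerreWeight
  rw [Set.indicator_apply]
  by_cases hx : 0 < x
  · rw [if_pos hx, if_pos (Set.mem_Ioi.2 hx), add_sub_cancel_right, Real.rpow_add hx,
      Real.rpow_natCast]
    ring
  · rw [if_neg hx, if_neg (show x ∉ Set.Ioi 0 from hx), mul_zero]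

theorem integrable_pow_mul_laguerreWeight {γ : ℝ} (hγ : -1 < γ) (m : ℕ) :
    Integrable fun x : ℝ => x ^ m * laguerreWeight γ x := by
  have hm := Nat.cast_nonneg (α := ℝ) m
  simp only [pow_mul_laguerreWeight]
  exact (integrable_indicator_iff measurableSet_Ioi).2
    (Real.GammaIntegral_convergent (by linarith))

theorem integral_pow_mul_laguerreWeight {γ : ℝ} (hγ : -1 < γ) (m : ℕ) :
    ∫ x, x ^ m * laguerreWeight γ x = Real.Gamma (m + γ + 1) := by
  have hm := Nat.cast_nonneg (α := ℝ) m
  simp only [pow_mul_laguerreWeight]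
  rw [integral_indicator measurableSet_Ioi, ← Real.Gamma_eq_integral (by linarith)]

theorem sum_neg_one_pow_choose_succ (n : ℕ) (F : ℕ → ℝ) :
    ∑ j ∈ Finset.range (n + 2), (-1) ^ j * ((n + 1).choose j : ℝ) * F j =
      ∑ j ∈ Finset.range (n + 1), (-1) ^ j * (n.choose j : ℝ) * F j -
        ∑ j ∈ Finset.range (n + 1), (-1) ^ j * (n.choose j : ℝ) * F (j + 1) := by
  have h1 : ∑ j ∈ Finset.range (n + 1), (-1) ^ j * (n.choose j : ℝ) * F j =
      ∑ j ∈ Finset.range (n + 2), (-1) ^ j * (n.choose j : ℝ) * F j := by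
    rw [Finset.sum_range_succ _ (n + 1), Nat.choose_succ_self]
    simp
  rw [h1, Finset.sum_range_succ', Finset.sum_range_succ' _ (n + 1), add_sub_right_comm,
    ← Finset.sum_sub_distrib, Nat.choose_zero_right, Nat.choose_zero_right]
  congr 1
  refine Finset.sum_congr rfl fun j _ => ?_
  rw [Nat.choose_succ_succ]
  push_cast
  ring

/-- An n-th finite difference. Replacing j by j + 1 amounts to replacing γ by γ + 1, so Pascal's
rule expresses case n + 1 as the difference of case n at γ and at γ + 1. -/
theorem sum_choose_mul_Gamma (n m : ℕ) {γ : ℝ} (hγ : -1 < γ) :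
    ∑ j ∈ Finset.range (n + 1), (-1) ^ j * (n.choose j : ℝ) *
      (Real.Gamma ((m + j : ℕ) + γ + 1) / Real.Gamma (j + γ + 1)) =
    (-1) ^ n * (m.descFactorial n : ℝ) * (Real.Gamma (m + γ + 1) / Real.Gamma (n + γ + 1)) := by
  induction n generalizing γ with
  | zero => simp
  | succ n ih =>
    have hn := Nat.cast_nonneg (α := ℝ) n
    have hm := Nat.cast_nonneg (α := ℝ) m
    have h2 := ih (γ := γ + 1) (by linarith)
    have h3 : ∀ j : ℕ, Real.Gamma ((m + (j + 1) : ℕ) + γ + 1) / Real.Gamma ((j + 1 : ℕ) + γ + 1) =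
        Real.Gamma ((m + j : ℕ) + (γ + 1) + 1) / Real.Gamma (j + (γ + 1) + 1) := by
      intro j
      push_cast
      congr 2 <;> ring
    rw [sum_neg_one_pow_choose_succ, ih hγ]
    simp only [h3]
    rw [h2]
    have e1 : (m : ℝ) + (γ + 1) + 1 = (m + γ + 1) + 1 := by ring
    have e2 : (n : ℝ) + (γ + 1) + 1 = (n + γ + 1) + 1 := by ring
    have e3 : ((n + 1 : ℕ) : ℝ) + γ + 1 = (n + γ + 1) + 1 := by push_cast; ring
    have hm0 : (m : ℝ) + γ + 1 ≠ 0 := by linarith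
    have hn0 : (n : ℝ) + γ + 1 ≠ 0 := by linarith
    rw [e1, e2, e3, Real.Gamma_add_one hm0, Real.Gamma_add_one hn0, Nat.descFactorial_succ]
    have hg : Real.Gamma ((n : ℝ) + γ + 1) ≠ 0 := (Real.Gamma_pos_of_pos (by linarith)).ne'
    rcases le_or_gt n m with h | h
    · push_cast [Nat.cast_sub h]
      field_simp
      ring
    · rw [Nat.descFactorial_of_lt h]
      simp

/-- The integrals `∫ x^m L_n^{(γ)}(x) x^γ e^{-x} dx`. -/
def laguerreMoment (γ : ℝ) (m n : ℕ) : ℝ :=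
  (-1) ^ n * (m.descFactorial n : ℝ) / n.factorial * Real.Gamma (m + γ + 1)

theorem integral_pow_mul_laguerre {γ : ℝ} (hγ : -1 < γ) (m n : ℕ) :
    ∫ x, x ^ m * (laguerrePoly γ n).eval x * laguerreWeight γ x = laguerreMoment γ m n := by
  have hn := Nat.cast_nonneg (α := ℝ) n
  have hg : Real.Gamma ((n : ℝ) + γ + 1) ≠ 0 := (Real.Gamma_pos_of_pos (by linarith)).ne'
  rw [laguerrePoly, integral_pow_mul_eval_sum (integrable_pow_mul_laguerreWeight hγ)]
  have h : laguerreMoment γ m n = Real.Gamma (n + γ + 1) / n.factorial *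
      ((-1) ^ n * (m.descFactorial n : ℝ) *
        (Real.Gamma (m + γ + 1) / Real.Gamma (n + γ + 1))) := by
    rw [laguerreMoment]
    field_simp
  rw [h, ← sum_choose_mul_Gamma n m hγ, Finset.mul_sum]
  refine Finset.sum_congr rfl fun j hj => ?_
  rw [integral_pow_mul_laguerreWeight hγ,
    Nat.cast_choose ℝ (Nat.lt_succ_iff.1 (Finset.mem_range.1 hj))]
  have h1 := Nat.cast_ne_zero (R := ℝ).2 n.factorial_ne_zero
  have h2 := Nat.cast_ne_zero (R := ℝ).2 j.factorial_ne_zero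
  have h3 := Nat.cast_ne_zero (R := ℝ).2 (n - j).factorial_ne_zero
  have h4 : Real.Gamma ((j : ℝ) + γ + 1) ≠ 0 :=
    (Real.Gamma_pos_of_pos (by have := Nat.cast_nonneg (α := ℝ) j; linarith)).ne'
  field_simp

theorem natDegree_sum_C_mul_X_pow_le (c : ℕ → ℝ) (n : ℕ) :
    (∑ j ∈ Finset.range (n + 1), Polynomial.C (c j) * Polynomial.X ^ j).natDegree ≤ n := by
  refine Polynomial.natDegree_sum_le_of_forall_le _ _ fun j hj => ?_
  exact (Polynomial.natDegree_C_mul_X_pow_le _ _).trans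
    (Nat.lt_succ_iff.1 (Finset.mem_range.1 hj))

theorem coeff_sum_C_mul_X_pow (c : ℕ → ℝ) (n : ℕ) :
    (∑ j ∈ Finset.range (n + 1), Polynomial.C (c j) * Polynomial.X ^ j).coeff n = c n := by
  rw [Polynomial.finsetSum_coeff, Finset.sum_eq_single n]
  · simp
  · intro j _ hj
    rw [Polynomial.coeff_C_mul_X_pow, if_neg hj.symm]
  · intro h
    exact absurd (Finset.self_mem_range_succ n) h

theorem coeff_laguerrePoly {γ : ℝ} (hγ : -1 < γ) (n : ℕ) :
    (laguerrePoly γ n).coeff n = (-1) ^ n / n.factorial := by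
  have hn := Nat.cast_nonneg (α := ℝ) n
  have hg : Real.Gamma ((n : ℝ) + γ + 1) ≠ 0 := (Real.Gamma_pos_of_pos (by linarith)).ne'
  rw [laguerrePoly, coeff_sum_C_mul_X_pow, Nat.sub_self, Nat.factorial_zero, Nat.cast_one, mul_one]
  field_simp

theorem laguerre_isOrthogonal {γ : ℝ} (hγ : -1 < γ) :
    IsOrthogonal (laguerreWeight γ) (laguerrePoly γ) (laguerreMoment γ) where
  measurable := measurable_laguerreWeight γ
  nonneg x := by
    unfold laguerreWeight
    split_ifs
    · positivity
    · exact le_rfl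
  integrable := integrable_pow_mul_laguerreWeight hγ
  natDegree_le n := natDegree_sum_C_mul_X_pow_le _ n
  coeff_ne_zero n := by
    rw [coeff_laguerrePoly hγ]
    exact div_ne_zero (by simp) (Nat.cast_ne_zero.2 n.factorial_ne_zero)
  integral_eq := integral_pow_mul_laguerre hγ
  eq_zero_of_lt m n h := by simp [laguerreMoment, Nat.descFactorial_of_lt h]
  diag_ne_zero n := by
    have hn := Nat.cast_nonneg (α := ℝ) n
    have hg : Real.Gamma ((n : ℝ) + γ + 1) ≠ 0 := (Real.Gamma_pos_of_pos (by linarith)).ne'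
    have := Nat.cast_ne_zero (R := ℝ).2 n.factorial_ne_zero
    rw [laguerreMoment, Nat.descFactorial_self]
    exact mul_ne_zero (div_ne_zero (mul_ne_zero (by simp) this) this) hg

/-! ### The Jacobi case -/

theorem pow_mul_jacobiWeight {γ₁ γ₂ : ℝ} (h₁ : -1 < γ₁) (h₂ : -1 < γ₂) (m : ℕ) (x : ℝ) :
    x ^ m * jacobiWeight γ₁ γ₂ x = ProbabilityTheory.beta (m + γ₁ + 1) (γ₂ + 1) *
      ProbabilityTheory.betaPDFReal (m + γ₁ + 1) (γ₂ + 1) x := by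
  have hm := Nat.cast_nonneg (α := ℝ) m
  have hb := (ProbabilityTheory.beta_pos (α := m + γ₁ + 1) (β := γ₂ + 1) (by linarith)
    (by linarith)).ne'
  unfold jacobiWeight ProbabilityTheory.betaPDFReal
  split_ifs with hx
  · rw [add_sub_cancel_right, add_sub_cancel_right, Real.rpow_add hx.1, Real.rpow_natCast]
    field_simp
  · simp

theorem integrable_betaPDFReal {a b : ℝ} (ha : 0 < a) (hb : 0 < b) :
    Integrable (ProbabilityTheory.betaPDFReal a b) ∧
      ∫ x, ProbabilityTheory.betaPDFReal a b x = 1 := by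
  have h0 : ∀ x, 0 ≤ ProbabilityTheory.betaPDFReal a b x := by
    intro x
    by_cases hx : 0 < x ∧ x < 1
    · exact (ProbabilityTheory.betaPDFReal_pos hx.1 hx.2 ha hb).le
    · rw [ProbabilityTheory.betaPDFReal, if_neg hx]
  have h1 : ∫⁻ x, ENNReal.ofReal (ProbabilityTheory.betaPDFReal a b x) = 1 :=
    ProbabilityTheory.lintegral_betaPDF_eq_one ha hb
  have hm := (ProbabilityTheory.stronglyMeasurable_betaPDFReal a b).aestronglyMeasurable
    (μ := volume)
  constructor
  · refine ⟨hm, ?_⟩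
    rw [hasFiniteIntegral_iff_ofReal (ae_of_all _ h0), h1]
    exact ENNReal.one_lt_top
  · rw [integral_eq_lintegral_of_nonneg_ae (ae_of_all _ h0) hm, h1, ENNReal.toReal_one]

theorem integrable_pow_mul_jacobiWeight {γ₁ γ₂ : ℝ} (h₁ : -1 < γ₁) (h₂ : -1 < γ₂) (m : ℕ) :
    Integrable fun x : ℝ => x ^ m * jacobiWeight γ₁ γ₂ x := by
  have hm := Nat.cast_nonneg (α := ℝ) m
  simp only [pow_mul_jacobiWeight h₁ h₂]
  exact (integrable_betaPDFReal (by linarith) (by linarith)).1.const_mul _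

theorem integral_pow_mul_jacobiWeight {γ₁ γ₂ : ℝ} (h₁ : -1 < γ₁) (h₂ : -1 < γ₂) (m : ℕ) :
    ∫ x, x ^ m * jacobiWeight γ₁ γ₂ x =
      Real.Gamma (m + γ₁ + 1) * Real.Gamma (γ₂ + 1) / Real.Gamma (m + γ₁ + γ₂ + 2) := by
  have hm := Nat.cast_nonneg (α := ℝ) m
  simp only [pow_mul_jacobiWeight h₁ h₂]
  rw [integral_const_mul, (integrable_betaPDFReal (by linarith) (by linarith)).2, mul_one,
    ProbabilityTheory.beta]
  congr 2
  ring

theorem ascPochhammer_succ_eval_left (n : ℕ) (x : ℝ) :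
    (ascPochhammer ℝ (n + 1)).eval x = x * (ascPochhammer ℝ n).eval (x + 1) := by
  simp [ascPochhammer_succ_left]

/-- The coefficients of the Jacobi polynomials. -/
def jacobiCoeff (γ₁ γ₂ : ℝ) (n j : ℕ) : ℝ :=
  (-1) ^ j * (n.choose j : ℝ) / n.factorial * (ascPochhammer ℝ j).eval (n + γ₁ + γ₂ + 1) *
    (Real.Gamma (n + γ₁ + 1) / Real.Gamma (j + γ₁ + 1))

theorem jacobiPoly_eq (γ₁ γ₂ : ℝ) (n : ℕ) : jacobiPoly γ₁ γ₂ n =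
    ∑ j ∈ Finset.range (n + 1), Polynomial.C (jacobiCoeff γ₁ γ₂ n j) * Polynomial.X ^ j := by
  refine Finset.sum_congr rfl fun j hj => ?_
  rw [jacobiCoeff, Nat.cast_choose ℝ (Nat.lt_succ_iff.1 (Finset.mem_range.1 hj))]
  have h1 := Nat.cast_ne_zero (R := ℝ).2 n.factorial_ne_zero
  congr 4
  field_simp

theorem jacobiCoeff_succ_zero {γ₁ : ℝ} (h₁ : -1 < γ₁) (γ₂ : ℝ) (n : ℕ) :
    (n + 1) * jacobiCoeff γ₁ γ₂ (n + 1) 0 =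
      (γ₁ + 1) * jacobiCoeff (γ₁ + 1) (γ₂ + 1) n 0 := by
  have h2 : γ₁ + 1 ≠ 0 := by linarith
  have h3 : Real.Gamma (γ₁ + 1) ≠ 0 := (Real.Gamma_pos_of_pos (by linarith)).ne'
  have h4 := Nat.cast_ne_zero (R := ℝ).2 n.factorial_ne_zero
  have h5 : (n : ℝ) + 1 ≠ 0 := by positivity
  simp only [jacobiCoeff, Nat.factorial_succ, pow_zero, Nat.choose_zero_right, ascPochhammer_zero,
    Polynomial.eval_one]
  push_cast
  have e1 : (n : ℝ) + 1 + γ₁ + 1 = n + (γ₁ + 1) + 1 := by ring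
  have e2 : (0 : ℝ) + (γ₁ + 1) + 1 = γ₁ + 1 + 1 := by ring
  rw [e1, e2, zero_add, Real.Gamma_add_one h2]
  field_simp

/-- Together with `jacobiCoeff_succ_zero` this is the coefficient form of (n+1) J_{n+1} w = d/dx
[x(1-x) w J_n⁺], where w = x^{γ₁}(1-x)^{γ₂} and J_n⁺ has both parameters raised by 1. -/
theorem jacobiCoeff_succ_succ {γ₁ : ℝ} (h₁ : -1 < γ₁) (γ₂ : ℝ) (n j : ℕ) :
    (n + 1) * jacobiCoeff γ₁ γ₂ (n + 1) (j + 1) =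
      (γ₁ + 2 + j) * jacobiCoeff (γ₁ + 1) (γ₂ + 1) n (j + 1) -
        (γ₁ + γ₂ + 2 + j) * jacobiCoeff (γ₁ + 1) (γ₂ + 1) n j := by
  have hj := Nat.cast_nonneg (α := ℝ) j
  have h4 := Nat.cast_ne_zero (R := ℝ).2 n.factorial_ne_zero
  have h5 : (n : ℝ) + 1 ≠ 0 := by positivity
  have h2 : (j : ℝ) + γ₁ + 2 ≠ 0 := by linarith
  have h3 : Real.Gamma ((j : ℝ) + γ₁ + 2) ≠ 0 := (Real.Gamma_pos_of_pos (by linarith)).ne'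
  have hc : (n.choose (j + 1) : ℝ) * (j + 1) = n.choose j * (n - j) := by
    rcases le_or_gt j n with h | h
    · have := Nat.choose_succ_right_eq n j
      rw [← Nat.cast_sub h]
      exact_mod_cast this
    · rw [Nat.choose_eq_zero_of_lt h, Nat.choose_eq_zero_of_lt (h.trans (Nat.lt_succ_self j))]
      simp
  have e1 : (n : ℝ) + 1 + γ₁ + 1 = n + γ₁ + 2 := by ring
  have e2 : (n : ℝ) + (γ₁ + 1) + 1 = n + γ₁ + 2 := by ring
  have e3 : (j : ℝ) + 1 + γ₁ + 1 = j + γ₁ + 2 := by ring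
  have e4 : (j : ℝ) + 1 + (γ₁ + 1) + 1 = (j + γ₁ + 2) + 1 := by ring
  have e5 : (j : ℝ) + (γ₁ + 1) + 1 = j + γ₁ + 2 := by ring
  have e6 : (n : ℝ) + 1 + γ₁ + γ₂ + 1 = n + γ₁ + γ₂ + 2 := by ring
  have e7 : (n : ℝ) + (γ₁ + 1) + (γ₂ + 1) + 1 = n + γ₁ + γ₂ + 2 + 1 := by ring
  simp only [jacobiCoeff, Nat.factorial_succ, Nat.choose_succ_succ]
  push_cast
  rw [e1, e2, e3, e4, e5, e6, e7, Real.Gamma_add_one h2, ascPochhammer_succ_eval_left,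
    ascPochhammer_succ_eval]
  set E := (ascPochhammer ℝ j).eval (n + γ₁ + γ₂ + 2 + 1)
  set G := Real.Gamma (n + γ₁ + 2)
  set K := Real.Gamma (j + γ₁ + 2)
  have h6 : ((n : ℝ) + 1) * ((-1) ^ (j + 1) * (n.choose j + n.choose (j + 1)) /
      ((n + 1) * n.factorial) * ((n + γ₁ + γ₂ + 2) * E) * (G / K)) =
      (-1) ^ (j + 1) / n.factorial * E * (G / K) *
        ((n.choose j + n.choose (j + 1)) * (n + γ₁ + γ₂ + 2)) := by
    field_simp
  have h7 : (γ₁ + 2 + j) * ((-1) ^ (j + 1) * (n.choose (j + 1) : ℝ) / n.factorial *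
      (E * (n + γ₁ + γ₂ + 2 + 1 + j)) * (G / ((j + γ₁ + 2) * K))) =
      (-1) ^ (j + 1) / n.factorial * E * (G / K) *
        (n.choose (j + 1) * (n + γ₁ + γ₂ + 2 + 1 + j)) := by
    field_simp
    ring
  have h8 : (γ₁ + γ₂ + 2 + j) * ((-1) ^ j * (n.choose j : ℝ) / n.factorial * E * (G / K)) =
      -((-1) ^ (j + 1) / n.factorial * E * (G / K) * (n.choose j * (γ₁ + γ₂ + 2 + j))) := by
    ring
  rw [h6, h7, h8]
  linear_combination (-((-1) ^ (j + 1) / n.factorial * E * (G / K))) * hc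

/-- The integrals `∫ x^m J_n^{(γ₁,γ₂)}(x) x^{γ₁} (1-x)^{γ₂} dx`. -/
def jacobiMoment (γ₁ γ₂ : ℝ) (m n : ℕ) : ℝ :=
  (-1) ^ n * (m.descFactorial n : ℝ) / n.factorial * (Real.Gamma (m + γ₁ + 1) *
    Real.Gamma (n + γ₂ + 1) / Real.Gamma (m + n + γ₁ + γ₂ + 2))

/-- The moments of the Jacobi weight. -/
def jacobiPowMoment (γ₁ γ₂ : ℝ) (m : ℕ) : ℝ :=
  Real.Gamma (m + γ₁ + 1) * Real.Gamma (γ₂ + 1) / Real.Gamma (m + γ₁ + γ₂ + 2)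

/-- Integration by parts of x^m against d/dx [x^{j+γ₁+1}(1-x)^{γ₂+1}], carried out on Gamma values.
At m = 0 the truncated `m - 1` is harmless because of the factor m. -/
theorem jacobiPowMoment_sub {γ₁ γ₂ : ℝ} (h₁ : -1 < γ₁) (h₂ : -1 < γ₂) (m j : ℕ) :
    (γ₁ + 1 + j) * jacobiPowMoment γ₁ γ₂ (m + j) -
        (γ₁ + γ₂ + 2 + j) * jacobiPowMoment γ₁ γ₂ (m + j + 1) =
      -m * jacobiPowMoment (γ₁ + 1) (γ₂ + 1) (m - 1 + j) := by
  have hj := Nat.cast_nonneg (α := ℝ) j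
  have hm := Nat.cast_nonneg (α := ℝ) m
  have g1 : (m : ℝ) + j + γ₁ + 1 ≠ 0 := by linarith
  have g2 : (m : ℝ) + j + γ₁ + γ₂ + 2 ≠ 0 := by linarith
  have g3 : γ₂ + 1 ≠ 0 := by linarith
  have g4 : Real.Gamma ((m : ℝ) + j + γ₁ + γ₂ + 2) ≠ 0 :=
    (Real.Gamma_pos_of_pos (by linarith)).ne'
  have h : jacobiPowMoment γ₁ γ₂ (m + j + 1) = jacobiPowMoment γ₁ γ₂ (m + j) *
      ((m + j + γ₁ + 1) / (m + j + γ₁ + γ₂ + 2)) := by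
    unfold jacobiPowMoment
    push_cast
    have e1 : (m : ℝ) + j + 1 + γ₁ + 1 = (m + j + γ₁ + 1) + 1 := by ring
    have e2 : (m : ℝ) + j + 1 + γ₁ + γ₂ + 2 = (m + j + γ₁ + γ₂ + 2) + 1 := by ring
    rw [e1, e2, Real.Gamma_add_one g1, Real.Gamma_add_one g2]
    field_simp
  have h' : m * jacobiPowMoment (γ₁ + 1) (γ₂ + 1) (m - 1 + j) =
      m * (jacobiPowMoment γ₁ γ₂ (m + j) * ((γ₂ + 1) / (m + j + γ₁ + γ₂ + 2))) := by
    cases m with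
    | zero => simp
    | succ m =>
      congr 1
      unfold jacobiPowMoment
      push_cast at g1 g2 g4 ⊢
      have e1 : (m : ℝ) + j + (γ₁ + 1) + 1 = m + 1 + j + γ₁ + 1 := by ring
      have e2 : (m : ℝ) + j + (γ₁ + 1) + (γ₂ + 1) + 2 = (m + 1 + j + γ₁ + γ₂ + 2) + 1 := by ring
      rw [e1, e2, Real.Gamma_add_one g3, Real.Gamma_add_one g2]
      field_simp
  rw [h, neg_mul, h']
  field_simp
  ring

/-- By the derivative formula above, ∫ x^m J_{n+1} w equals -m/(n+1) times the integral of x^{m-1}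
J_n with both parameters raised, which gives the induction on n. -/
theorem sum_jacobiCoeff_mul {γ₁ γ₂ : ℝ} (h₁ : -1 < γ₁) (h₂ : -1 < γ₂) (m n : ℕ) :
    ∑ j ∈ Finset.range (n + 1), jacobiCoeff γ₁ γ₂ n j * jacobiPowMoment γ₁ γ₂ (m + j) =
      jacobiMoment γ₁ γ₂ m n := by
  induction n generalizing m γ₁ γ₂ with
  | zero =>
    have h3 : Real.Gamma (γ₁ + 1) ≠ 0 := (Real.Gamma_pos_of_pos (by linarith)).ne'
    simp [jacobiCoeff, jacobiPowMoment, jacobiMoment, h3]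
  | succ n ih =>
    have hn : (n : ℝ) + 1 ≠ 0 := by positivity
    have hshift : ∑ j ∈ Finset.range (n + 1), (γ₁ + 2 + j) *
        jacobiCoeff (γ₁ + 1) (γ₂ + 1) n (j + 1) * jacobiPowMoment γ₁ γ₂ (m + (j + 1)) +
        (γ₁ + 1) * jacobiCoeff (γ₁ + 1) (γ₂ + 1) n 0 * jacobiPowMoment γ₁ γ₂ (m + 0) =
        ∑ j ∈ Finset.range (n + 1), (γ₁ + 1 + j) * jacobiCoeff (γ₁ + 1) (γ₂ + 1) n j *
          jacobiPowMoment γ₁ γ₂ (m + j) := by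
      have h0 : jacobiCoeff (γ₁ + 1) (γ₂ + 1) n (n + 1) = 0 := by simp [jacobiCoeff]
      have h3 := Finset.sum_range_succ (fun j : ℕ => (γ₁ + 1 + j) *
        jacobiCoeff (γ₁ + 1) (γ₂ + 1) n j * jacobiPowMoment γ₁ γ₂ (m + j)) (n + 1)
      have h4 := Finset.sum_range_succ' (fun j : ℕ => (γ₁ + 1 + j) *
        jacobiCoeff (γ₁ + 1) (γ₂ + 1) n j * jacobiPowMoment γ₁ γ₂ (m + j)) (n + 1)
      rw [h0, mul_zero, zero_mul, add_zero] at h3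
      rw [← h3, h4]
      congr 1
      · refine Finset.sum_congr rfl fun j _ => ?_
        push_cast
        ring
      · simp
    have key : (n + 1) * ∑ j ∈ Finset.range (n + 1 + 1),
        jacobiCoeff γ₁ γ₂ (n + 1) j * jacobiPowMoment γ₁ γ₂ (m + j) =
        -m * jacobiMoment (γ₁ + 1) (γ₂ + 1) (m - 1) n := by
      rw [← ih (by linarith) (by linarith), Finset.mul_sum, Finset.mul_sum,
        Finset.sum_range_succ']
      simp only [← mul_assoc]
      rw [jacobiCoeff_succ_zero h₁]
      simp only [jacobiCoeff_succ_succ h₁, sub_mul]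
      rw [Finset.sum_sub_distrib, sub_add_eq_add_sub, hshift, ← Finset.sum_sub_distrib]
      refine Finset.sum_congr rfl fun j _ => ?_
      have h3 := jacobiPowMoment_sub h₁ h₂ m j
      rw [← add_assoc]
      linear_combination jacobiCoeff (γ₁ + 1) (γ₂ + 1) n j * h3
    refine mul_left_cancel₀ hn (key.trans ?_)
    cases m with
    | zero => simp [jacobiMoment]
    | succ m =>
      have hf := Nat.cast_ne_zero (R := ℝ).2 n.factorial_ne_zero
      rw [Nat.add_sub_cancel, jacobiMoment, jacobiMoment, Nat.succ_descFactorial_succ,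
        Nat.factorial_succ, pow_succ]
      push_cast
      have e1 : (m : ℝ) + (γ₁ + 1) + 1 = m + 1 + γ₁ + 1 := by ring
      have e2 : (n : ℝ) + (γ₂ + 1) + 1 = n + 1 + γ₂ + 1 := by ring
      have e3 : (m : ℝ) + n + (γ₁ + 1) + (γ₂ + 1) + 2 = m + 1 + (n + 1) + γ₁ + γ₂ + 2 := by ring
      rw [e1, e2, e3]
      field_simp

theorem integral_pow_mul_jacobi {γ₁ γ₂ : ℝ} (h₁ : -1 < γ₁) (h₂ : -1 < γ₂) (m n : ℕ) :
    ∫ x, x ^ m * (jacobiPoly γ₁ γ₂ n).eval x * jacobiWeight γ₁ γ₂ x =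
      jacobiMoment γ₁ γ₂ m n := by
  rw [jacobiPoly_eq, integral_pow_mul_eval_sum (integrable_pow_mul_jacobiWeight h₁ h₂),
    ← sum_jacobiCoeff_mul h₁ h₂]
  refine Finset.sum_congr rfl fun j _ => ?_
  rw [integral_pow_mul_jacobiWeight h₁ h₂, jacobiPowMoment]

theorem coeff_jacobiPoly {γ₁ γ₂ : ℝ} (h₁ : -1 < γ₁) (n : ℕ) :
    (jacobiPoly γ₁ γ₂ n).coeff n =
      (-1) ^ n / n.factorial * (ascPochhammer ℝ n).eval (n + γ₁ + γ₂ + 1) := by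
  have hn := Nat.cast_nonneg (α := ℝ) n
  have hg : Real.Gamma ((n : ℝ) + γ₁ + 1) ≠ 0 := (Real.Gamma_pos_of_pos (by linarith)).ne'
  rw [jacobiPoly_eq, coeff_sum_C_mul_X_pow, jacobiCoeff, Nat.choose_self, div_self hg]
  simp

/-- For n ≥ 1 the argument is positive; for n = 0 it need not be, but the product is empty. -/
theorem ascPochhammer_eval_pos_of_jacobi {γ₁ γ₂ : ℝ} (h₁ : -1 < γ₁) (h₂ : -1 < γ₂) (n : ℕ) :
    0 < (ascPochhammer ℝ n).eval (n + γ₁ + γ₂ + 1) := by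
  cases n with
  | zero => simp
  | succ n =>
    have hn := Nat.cast_nonneg (α := ℝ) n
    exact ascPochhammer_pos _ _ (by push_cast; linarith)

theorem jacobi_isOrthogonal {γ₁ γ₂ : ℝ} (h₁ : -1 < γ₁) (h₂ : -1 < γ₂) :
    IsOrthogonal (jacobiWeight γ₁ γ₂) (jacobiPoly γ₁ γ₂) (jacobiMoment γ₁ γ₂) where
  measurable := by
    unfold jacobiWeight
    exact Measurable.ite measurableSet_Ioo (by fun_prop) measurable_const
  nonneg x := by
    unfold jacobiWeight
    split_ifs with hx
    · exact mul_nonneg (Real.rpow_nonneg hx.1.le _) (Real.rpow_nonneg (sub_nonneg.2 hx.2.le) _)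
    · exact le_rfl
  integrable := integrable_pow_mul_jacobiWeight h₁ h₂
  natDegree_le n := by
    rw [jacobiPoly_eq]
    exact natDegree_sum_C_mul_X_pow_le _ n
  coeff_ne_zero n := by
    rw [coeff_jacobiPoly h₁]
    exact mul_ne_zero (div_ne_zero (by simp) (Nat.cast_ne_zero.2 n.factorial_ne_zero))
      (ascPochhammer_eval_pos_of_jacobi h₁ h₂ n).ne'
  integral_eq := integral_pow_mul_jacobi h₁ h₂
  eq_zero_of_lt m n h := by simp [jacobiMoment, Nat.descFactorial_of_lt h]
  diag_ne_zero n := by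
    have hn := Nat.cast_nonneg (α := ℝ) n
    have g1 : Real.Gamma ((n : ℝ) + γ₁ + 1) ≠ 0 := (Real.Gamma_pos_of_pos (by linarith)).ne'
    have g2 : Real.Gamma ((n : ℝ) + γ₂ + 1) ≠ 0 := (Real.Gamma_pos_of_pos (by linarith)).ne'
    have g3 : Real.Gamma ((n : ℝ) + n + γ₁ + γ₂ + 2) ≠ 0 :=
      (Real.Gamma_pos_of_pos (by linarith)).ne'
    have := Nat.cast_ne_zero (R := ℝ).2 n.factorial_ne_zero
    rw [jacobiMoment, Nat.descFactorial_self]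
    exact mul_ne_zero (div_ne_zero (mul_ne_zero (by simp) this) this)
      (div_ne_zero (mul_ne_zero g1 g2) g3)

/-! ### The constants -/

theorem sum_rowLen {N : ℕ} {mu : YoungDiagram} (h : mu.colLen 0 ≤ N) :
    ∑ i : Fin N, mu.rowLen i = mu.card := by
  rw [Fin.sum_univ_eq_sum_range fun i => mu.rowLen i, YoungDiagram.card,
    Finset.card_eq_sum_card_fiberwise (f := Prod.fst) (t := Finset.range N)]
  · refine Finset.sum_congr rfl fun i _ => ?_
    rw [YoungDiagram.rowLen_eq_card]
    rfl
  · rintro ⟨i, j⟩ hc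
    have h1 : j < mu.rowLen i := YoungDiagram.mem_iff_lt_rowLen.1 hc
    rw [Finset.coe_range, Set.mem_Iio]
    by_contra hi
    rw [rowLen_eq_zero_of_colLen_le (h.trans (not_lt.1 hi))] at h1
    exact Nat.not_lt_zero _ h1

theorem prod_pow_expo {N : ℕ} {mu : YoungDiagram} (h : mu.colLen 0 ≤ N) (r : ℝ) :
    ∏ i, r ^ expo N mu i = r ^ mu.card * ∏ i, r ^ expo N ⊥ i := by
  rw [← sum_rowLen h, ← Finset.prod_pow_eq_pow_sum, ← Finset.prod_mul_distrib]
  refine Finset.prod_congr rfl fun i _ => ?_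
  rw [← pow_add, expo_bot, expo]

/-- The sign of the dual Cauchy identity cancels the signs of the Laguerre and Jacobi moments, up to
a constant shared with the normalisation. Hermite moments carry no sign, so there (-1)^{|ν|}
survives. -/
theorem neg_one_pow_card_mul_prod {N : ℕ} {nu : YoungDiagram} (h : nu.colLen 0 ≤ N) :
    (-1 : ℝ) ^ nu.card * ∏ i, (-1 : ℝ) ^ expo N nu i = ∏ i, (-1 : ℝ) ^ expo N ⊥ i := by
  rw [prod_pow_expo h, ← mul_assoc, ← pow_add, Even.neg_one_pow ⟨_, rfl⟩, one_mul]

/-- The product of the factorials of the exponents of a partition. -/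
def factProd (N : ℕ) (mu : YoungDiagram) : ℝ := ∏ i, ((expo N mu i).factorial : ℝ)

theorem factProd_ne_zero (N : ℕ) (mu : YoungDiagram) : factProd N mu ≠ 0 :=
  Finset.prod_ne_zero_iff.2 fun _ _ => Nat.cast_ne_zero.2 (Nat.factorial_ne_zero _)

theorem constC_eq (N : ℕ) (mu : YoungDiagram) : constC N mu = factProd N mu / factProd N ⊥ := by
  rw [constC, Finset.prod_div_distrib, factProd, factProd]
  simp only [expo_bot]
  rfl

theorem constG_eq (N : ℕ) (γ : ℝ) (mu : YoungDiagram) :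
    constG N γ mu = ∏ i, Real.Gamma (expo N mu i + γ + 1) := by
  refine Finset.prod_congr rfl fun j _ => ?_
  have h : ((N - 1 - (j : ℕ) : ℕ) : ℝ) = N - ((j : ℕ) + 1) := by
    rw [Nat.sub_sub, add_comm 1, Nat.cast_sub (Nat.succ_le_of_lt j.2)]
    push_cast
    ring
  rw [expo, Nat.cast_add, h]

theorem constG_ne_zero (N : ℕ) {γ : ℝ} (hγ : -1 < γ) (mu : YoungDiagram) : constG N γ mu ≠ 0 := by
  rw [constG_eq]
  refine Finset.prod_ne_zero_iff.2 fun i _ => (Real.Gamma_pos_of_pos ?_).ne'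
  have := Nat.cast_nonneg (α := ℝ) (expo N mu i)
  linarith

theorem det_mul_mul {n : ℕ} (u v : Fin n → ℝ) (A : Fin n → Fin n → ℝ) :
    Matrix.det (Matrix.of fun i j => u i * v j * A i j) =
      (∏ i, u i) * (∏ j, v j) * Matrix.det (Matrix.of A) := by
  rw [mul_assoc, ← Matrix.det_mul_row, ← Matrix.det_mul_column]
  congr 1
  ext i j
  simp [mul_assoc]

theorem expo_le_iff_shift (n : ℕ) (mu nu : YoungDiagram) (j k : Fin n) :
    expo n nu k ≤ expo n mu j ↔ 0 ≤ shift mu nu j k := by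
  rw [← expo_sub_expo]
  omega

theorem toNat_shift (n : ℕ) (mu nu : YoungDiagram) (j k : Fin n) :
    (shift mu nu j k).toNat = expo n mu j - expo n nu k := by
  rw [← expo_sub_expo]
  omega

/-! ### Factoring the moment determinants -/

/-- The entries of `detH`. -/
def skewEntryH (a : ℤ) : ℝ := if 0 ≤ a ∧ Even a then ((a.toNat / 2).factorial : ℝ)⁻¹ else 0

/-- The entries of `detL`. -/
def skewEntryL (a : ℤ) : ℝ := if 0 ≤ a then (a.toNat.factorial : ℝ)⁻¹ else 0

theorem skewEntryH_zero : skewEntryH 0 = 1 := by simp [skewEntryH]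

theorem skewEntryH_neg (a : ℤ) (h : a < 0) : skewEntryH a = 0 :=
  if_neg fun h' => absurd h (not_lt.2 h'.1)

theorem skewEntryL_zero : skewEntryL 0 = 1 := by simp [skewEntryL]

theorem skewEntryL_neg (a : ℤ) (h : a < 0) : skewEntryL a = 0 := if_neg (not_le.2 h)

theorem detH_eq {N : ℕ} {mu nu : YoungDiagram} (hle : nu ≤ mu) (hmu : mu.colLen 0 ≤ N) :
    detH mu nu = Matrix.det (Matrix.of fun j k : Fin N => skewEntryH (shift mu nu j k)) :=
  (det_skew_eq skewEntryH skewEntryH_zero skewEntryH_neg hle hmu).symm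

theorem detL_eq {N : ℕ} {mu nu : YoungDiagram} (hle : nu ≤ mu) (hmu : mu.colLen 0 ≤ N) :
    detL mu nu = Matrix.det (Matrix.of fun j k : Fin N => skewEntryL (shift mu nu j k)) :=
  (det_skew_eq skewEntryL skewEntryL_zero skewEntryL_neg hle hmu).symm

/-- Writing 2^{(m-n)/2} as √2^m / √2^n separates the power of two into a row factor and a column
factor. -/
theorem hermiteMoment_eq (N : ℕ) (mu nu : YoungDiagram) (i j : Fin N) :
    hermiteMoment (expo N mu i) (expo N nu j) =
      (Real.sqrt (2 * Real.pi) * ((expo N mu i).factorial / Real.sqrt 2 ^ expo N mu i)) *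
        Real.sqrt 2 ^ expo N nu j * skewEntryH (shift mu nu i j) := by
  have h2 : Real.sqrt 2 ≠ 0 := by positivity
  have he : (expo N nu j ≤ expo N mu i ∧ Even (expo N mu i - expo N nu j)) ↔
      (0 ≤ shift mu nu i j ∧ Even (shift mu nu i j)) := by
    rw [expo_le_iff_shift]
    refine and_congr_right fun h => ?_
    rw [← toNat_shift, ← Int.even_coe_nat, Int.toNat_of_nonneg h]
  simp only [hermiteMoment, skewEntryH, he, toNat_shift]
  split_ifs with h
  · obtain ⟨h3, k, hk⟩ := he.2 h
    have e1 : expo N mu i = expo N nu j + (k + k) := by omega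
    have e2 : (k + k) / 2 = k := by omega
    have e3 : Real.sqrt 2 ^ (expo N nu j + (k + k)) = Real.sqrt 2 ^ expo N nu j * 2 ^ k := by
      rw [pow_add, pow_add, ← mul_pow, Real.mul_self_sqrt (by norm_num)]
    have hf := Nat.cast_ne_zero (R := ℝ).2 k.factorial_ne_zero
    rw [hk, e2]
    have e4 : Real.sqrt 2 ^ expo N mu i = Real.sqrt 2 ^ expo N nu j * 2 ^ k := by rw [e1, e3]
    rw [e4]
    field_simp
  · simp

theorem momentDet_hermite {N : ℕ} {mu nu : YoungDiagram} (hle : nu ≤ mu)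
    (hmu : mu.colLen 0 ≤ N) : momentDet hermiteMoment N mu nu =
      (∏ _i : Fin N, Real.sqrt (2 * Real.pi)) * (factProd N mu / ∏ i, Real.sqrt 2 ^ expo N mu i) *
        (∏ j, Real.sqrt 2 ^ expo N nu j) * detH mu nu := by
  rw [momentDet]
  simp only [hermiteMoment_eq]
  rw [det_mul_mul, detH_eq hle hmu, Finset.prod_mul_distrib, Finset.prod_div_distrib, factProd]

theorem descFactorial_eq_skewEntryL (N : ℕ) (mu nu : YoungDiagram) (i j : Fin N) :
    ((expo N mu i).descFactorial (expo N nu j) : ℝ) =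
      (expo N mu i).factorial * skewEntryL (shift mu nu i j) := by
  rw [skewEntryL]
  split_ifs with h
  · have h1 := (expo_le_iff_shift N mu nu i j).2 h
    have h2 := Nat.factorial_mul_descFactorial h1
    have h3 := Nat.cast_ne_zero (R := ℝ).2 (expo N mu i - expo N nu j).factorial_ne_zero
    rw [toNat_shift, ← h2]
    push_cast
    field_simp
  · rw [← expo_le_iff_shift, not_le] at h
    rw [Nat.descFactorial_of_lt h]
    simp

theorem momentDet_laguerre (γ : ℝ) {N : ℕ} {mu nu : YoungDiagram} (hle : nu ≤ mu)
    (hmu : mu.colLen 0 ≤ N) : momentDet (laguerreMoment γ) N mu nu =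
      factProd N mu * constG N γ mu * ((∏ j, (-1) ^ expo N nu j) / factProd N nu) *
        detL mu nu := by
  have h : ∀ i j : Fin N, laguerreMoment γ (expo N mu i) (expo N nu j) =
      ((expo N mu i).factorial * Real.Gamma (expo N mu i + γ + 1)) *
        ((-1) ^ expo N nu j / (expo N nu j).factorial) * skewEntryL (shift mu nu i j) := by
    intro i j
    rw [laguerreMoment, descFactorial_eq_skewEntryL]
    ring
  rw [momentDet]
  simp only [h]
  rw [det_mul_mul, detL_eq hle hmu, Finset.prod_mul_distrib, Finset.prod_div_distrib, factProd,
    factProd, constG_eq]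

theorem detJ_eq (N : ℕ) (γ₁ γ₂ : ℝ) (mu nu : YoungDiagram) : detJ N γ₁ γ₂ mu nu =
    Matrix.det (Matrix.of fun i j : Fin N => skewEntryL (shift mu nu i j) *
      (Real.Gamma (expo N mu i + expo N nu j + γ₁ + γ₂ + 2))⁻¹) := by
  rw [detJ]
  congr 1
  ext1 i j
  have h : ∀ (ka : YoungDiagram) (k : Fin N),
      (expo N ka k : ℝ) = ka.rowLen k + (N - ((k : ℕ) + 1)) := by
    intro ka k
    rw [expo, Nat.sub_sub, add_comm 1, Nat.cast_add, Nat.cast_sub (Nat.succ_le_of_lt k.2)]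
    push_cast
    ring
  simp only [Matrix.of_apply, skewEntryL, h]
  split_ifs
  · rw [mul_inv]
    congr 3
    ring
  · simp

theorem momentDet_jacobi (γ₁ γ₂ : ℝ) (N : ℕ) (mu nu : YoungDiagram) :
    momentDet (jacobiMoment γ₁ γ₂) N mu nu =
      factProd N mu * constG N γ₁ mu *
        ((∏ j, (-1) ^ expo N nu j) / factProd N nu * constG N γ₂ nu) *
          detJ N γ₁ γ₂ mu nu := by
  have h : ∀ i j : Fin N, jacobiMoment γ₁ γ₂ (expo N mu i) (expo N nu j) =
      ((expo N mu i).factorial * Real.Gamma (expo N mu i + γ₁ + 1)) *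
        ((-1) ^ expo N nu j / (expo N nu j).factorial * Real.Gamma (expo N nu j + γ₂ + 1)) *
          (skewEntryL (shift mu nu i j) *
            (Real.Gamma (expo N mu i + expo N nu j + γ₁ + γ₂ + 2))⁻¹) := by
    intro i j
    rw [jacobiMoment, descFactorial_eq_skewEntryL]
    ring
  rw [momentDet]
  simp only [h]
  rw [det_mul_mul, detJ_eq, Finset.prod_mul_distrib, Finset.prod_mul_distrib,
    Finset.prod_div_distrib, factProd, factProd, constG_eq, constG_eq]

/-- The matrix is triangular; its diagonal is the origin of the prefactor ∏ Γ(2k + γ₁ + γ₂ + 2),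
which has no counterpart in the other two cases. -/
theorem detJ_bot (N : ℕ) (γ₁ γ₂ : ℝ) : detJ N γ₁ γ₂ ⊥ ⊥ =
    (∏ k ∈ Finset.range N, Real.Gamma (2 * k + γ₁ + γ₂ + 2))⁻¹ := by
  rw [detJ_eq, det_skew_self (mu := ⊥), ← Finset.prod_inv_distrib, Finset.prod_range]
  · refine Fintype.prod_equiv Fin.revPerm _ _ fun j => ?_
    have h : shift ⊥ ⊥ (j : ℕ) j = 0 := by
      simp [shift]
    have h1 : ((Fin.rev j : Fin N) : ℕ) = N - 1 - j := by
      rw [Fin.val_rev]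
      omega
    rw [Matrix.of_apply, h, skewEntryL_zero, one_mul, Fin.revPerm_apply, h1, expo_bot]
    congr 2
    ring
  · intro j k hjk
    rw [Matrix.of_apply, skewEntryL_neg _ hjk, zero_mul]

theorem Triple.tilde_colLen_le {p N : ℕ} (s : Triple p N) : s.nu.colLen 0 ≤ N :=
  s.tilde_eq ▸ UnitaryEnsemble.tilde_colLen_le p N s.lam

theorem bot_colLen_le (N : ℕ) : (⊥ : YoungDiagram).colLen 0 ≤ N :=
  (le_rect_iff.1 (bot_le : ⊥ ≤ rect N 0)).1

theorem detH_bot : detH ⊥ ⊥ = 1 :=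
  det_skew_bot skewEntryH skewEntryH_zero skewEntryH_neg _

theorem detL_bot : detL ⊥ ⊥ = 1 :=
  det_skew_bot skewEntryL skewEntryL_zero skewEntryL_neg _

/-! ### Coefficients of the three expansions -/

theorem sqrt_two_pow_div (a b : ℕ) :
    (2 : ℝ) ^ (((a : ℝ) - b) / 2) = Real.sqrt 2 ^ a / Real.sqrt 2 ^ b := by
  rw [Real.sqrt_eq_rpow, ← Real.rpow_natCast, ← Real.rpow_natCast, ← Real.rpow_mul (by norm_num),
    ← Real.rpow_mul (by norm_num), ← Real.rpow_sub (by norm_num)]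
  congr 1
  ring

theorem expansionCoeff_hermite {p N : ℕ} (s : Triple p N) :
    expansionCoeff hermitePoly hermiteMoment p N s.lam s.mu =
      (-1) ^ s.nu.card / (2 : ℝ) ^ (((s.mu.card : ℝ) - s.nu.card) / 2) *
        constC N s.mu * detH s.mu s.nu := by
  have h2 : Real.sqrt 2 ≠ 0 := by positivity
  have hpi : Real.sqrt (2 * Real.pi) ≠ 0 := by
    have := Real.pi_pos
    positivity
  have hlead : ∀ j, (hermitePoly j).coeff j = 1 := fun j => by simp [hermitePoly]
  rw [expansionCoeff, s.tilde_eq, momentDet_hermite s.nu_le s.length_le,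
    momentDet_hermite le_rfl (bot_colLen_le N), detH_bot, constC_eq, sqrt_two_pow_div,
    prod_pow_expo s.length_le, prod_pow_expo s.tilde_colLen_le]
  simp only [hlead, Finset.prod_const_one, inv_one, one_mul]
  have h3 : ∏ i : Fin N, Real.sqrt 2 ^ expo N ⊥ i ≠ 0 :=
    Finset.prod_ne_zero_iff.2 fun i _ => pow_ne_zero _ h2
  have h4 : ∏ _i : Fin N, Real.sqrt (2 * Real.pi) ≠ 0 :=
    Finset.prod_ne_zero_iff.2 fun i _ => hpi
  have h5 := factProd_ne_zero N ⊥
  field_simp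

theorem expansionCoeff_laguerre {γ : ℝ} (hγ : -1 < γ) {p N : ℕ} (s : Triple p N) :
    (∏ j ∈ Finset.Ico N (p + N), (-1) ^ j * (j.factorial : ℝ)) *
        (constG N γ s.mu / constG N γ ⊥ * (constC N s.mu / constC N s.nu) * detL s.mu s.nu) =
      expansionCoeff (laguerrePoly γ) (laguerreMoment γ) p N s.lam s.mu := by
  have hlead : (∏ j ∈ Finset.Ico N (p + N), (laguerrePoly γ j).coeff j)⁻¹ =
      ∏ j ∈ Finset.Ico N (p + N), (-1) ^ j * (j.factorial : ℝ) := by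
    rw [← Finset.prod_inv_distrib]
    refine Finset.prod_congr rfl fun j _ => ?_
    rw [coeff_laguerrePoly hγ, inv_div, div_eq_mul_inv, ← inv_pow, mul_comm]
    norm_num
  rw [expansionCoeff, s.tilde_eq, hlead, momentDet_laguerre γ s.nu_le s.length_le,
    momentDet_laguerre γ le_rfl (bot_colLen_le N), detL_bot, constC_eq, constC_eq]
  have h1 := neg_one_pow_card_mul_prod s.tilde_colLen_le
  have h2 : ∏ i, (-1 : ℝ) ^ expo N ⊥ i ≠ 0 := Finset.prod_ne_zero_iff.2 fun i _ => by simp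
  have h3 := factProd_ne_zero N ⊥
  have h4 := factProd_ne_zero N s.nu
  have h5 := constG_ne_zero N hγ ⊥
  congr 1
  rw [← h1] at h2 ⊢
  field_simp

theorem Gamma_add_nat_eq {x : ℝ} (hx : 0 < x) (n : ℕ) :
    Real.Gamma (x + n) = (ascPochhammer ℝ n).eval x * Real.Gamma x := by
  induction n with
  | zero => simp
  | succ n ih =>
    have : x + n ≠ 0 := by positivity
    rw [ascPochhammer_succ_eval, Nat.cast_succ, ← add_assoc, Real.Gamma_add_one this, ih]
    ring

theorem expansionCoeff_jacobi {γ₁ γ₂ : ℝ} (h₁ : -1 < γ₁) (h₂ : -1 < γ₂) {p N : ℕ} (hN : 1 ≤ N)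
    (s : Triple p N) :
    ((∏ j ∈ Finset.Ico N (p + N), (-1) ^ j * (j.factorial : ℝ) *
        (Real.Gamma (j + γ₁ + γ₂ + 1) / Real.Gamma (2 * j + γ₁ + γ₂ + 1))) *
          ∏ k ∈ Finset.range N, Real.Gamma (2 * k + γ₁ + γ₂ + 2)) *
        (constG N γ₁ s.mu / constG N γ₁ ⊥ * (constG N γ₂ s.nu / constG N γ₂ ⊥) *
          (constC N s.mu / constC N s.nu) * detJ N γ₁ γ₂ s.mu s.nu) =
      expansionCoeff (jacobiPoly γ₁ γ₂) (jacobiMoment γ₁ γ₂) p N s.lam s.mu := by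
  have hlead : (∏ j ∈ Finset.Ico N (p + N), (jacobiPoly γ₁ γ₂ j).coeff j)⁻¹ =
      ∏ j ∈ Finset.Ico N (p + N), (-1) ^ j * (j.factorial : ℝ) *
        (Real.Gamma (j + γ₁ + γ₂ + 1) / Real.Gamma (2 * j + γ₁ + γ₂ + 1)) := by
    rw [← Finset.prod_inv_distrib]
    refine Finset.prod_congr rfl fun j hj => ?_
    -- This is where N ≥ 1 enters: for j ≥ 1 the argument j + γ₁ + γ₂ + 1 is positive, whereas for j
    -- = 0 it could be a pole of Γ.
    have hj1 : (1 : ℝ) ≤ j := by exact_mod_cast hN.trans (Finset.mem_Ico.1 hj).1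
    have hx : 0 < (j : ℝ) + γ₁ + γ₂ + 1 := by linarith
    have e : 2 * (j : ℝ) + γ₁ + γ₂ + 1 = j + γ₁ + γ₂ + 1 + j := by ring
    have hG := (Real.Gamma_pos_of_pos hx).ne'
    have hA := (ascPochhammer_eval_pos_of_jacobi h₁ h₂ j).ne'
    have hf := Nat.cast_ne_zero (R := ℝ).2 j.factorial_ne_zero
    have hs : ((-1 : ℝ) ^ j)⁻¹ = (-1) ^ j := by
      rw [← inv_pow]
      norm_num
    rw [coeff_jacobiPoly h₁, e, Gamma_add_nat_eq hx, mul_inv, inv_div, div_eq_mul_inv, hs]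
    field_simp
  rw [expansionCoeff, s.tilde_eq, hlead, momentDet_jacobi, momentDet_jacobi, detJ_bot,
    constC_eq, constC_eq]
  have h1 := neg_one_pow_card_mul_prod s.tilde_colLen_le
  have h2 : ∏ i, (-1 : ℝ) ^ expo N ⊥ i ≠ 0 := Finset.prod_ne_zero_iff.2 fun i _ => by simp
  have h3 := factProd_ne_zero N ⊥
  have h4 := factProd_ne_zero N s.nu
  have h5 := constG_ne_zero N h₁ ⊥
  have h6 := constG_ne_zero N h₂ ⊥
  have h7 : ∏ k ∈ Finset.range N, Real.Gamma (2 * k + γ₁ + γ₂ + 2) ≠ 0 := by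
    refine Finset.prod_ne_zero_iff.2 fun k _ => (Real.Gamma_pos_of_pos ?_).ne'
    have := Nat.cast_nonneg (α := ℝ) k
    linarith
  rw [mul_assoc]
  congr 1
  rw [← h1] at h2 ⊢
  field_simp

end UnitaryEnsemble

end

open UnitaryEnsemble in
theorem mainTheorem9 {Ω : Type*} [MeasurableSpace Ω] (P : MeasureTheory.Measure Ω)
    [MeasureTheory.IsProbabilityMeasure P] (N p q : ℕ) (hN : 1 ≤ N) (t : Fin p → ℂ)
    (M : Ω → Matrix (Fin N) (Fin N) ℂ) :
    (IsEnsemble P gaussianWeight M →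
      HasExpectation P (fun ω => charRatio t q (M ω)) ∧
      ∃ S : MvPowerSeries (Fin q) ℂ,
        HasFormalSum (fun s : Triple p N =>
          MvPowerSeries.C
            ((((-1) ^ s.nu.card / (2 : ℝ) ^ (((s.mu.card : ℝ) - s.nu.card) / 2) *
              constC N s.mu * detH s.mu s.nu : ℝ) : ℂ) * multiHermite s.lam t) *
            schurInv q s.mu) S ∧
        expectation P (fun ω => charRatio t q (M ω)) =
          (∏ k : Fin q, MvPowerSeries.X k ^ N) * S) ∧
    (∀ γ : ℝ, -1 < γ → IsEnsemble P (laguerreWeight γ) M →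
      HasExpectation P (fun ω => charRatio t q (M ω)) ∧
      ∃ S : MvPowerSeries (Fin q) ℂ,
        HasFormalSum (fun s : Triple p N =>
          MvPowerSeries.C
            (((constG N γ s.mu / constG N γ ⊥ * (constC N s.mu / constC N s.nu) *
              detL s.mu s.nu : ℝ) : ℂ) * multiLaguerre γ s.lam t) *
            schurInv q s.mu) S ∧
        expectation P (fun ω => charRatio t q (M ω)) =
          MvPowerSeries.C
              ((∏ j ∈ Finset.Ico N (p + N), (-1) ^ j * (j.factorial : ℝ) : ℝ) : ℂ) *
            (∏ k : Fin q, MvPowerSeries.X k ^ N) * S) ∧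
    (∀ γ₁ γ₂ : ℝ, -1 < γ₁ → -1 < γ₂ → IsEnsemble P (jacobiWeight γ₁ γ₂) M →
      HasExpectation P (fun ω => charRatio t q (M ω)) ∧
      ∃ S : MvPowerSeries (Fin q) ℂ,
        HasFormalSum (fun s : Triple p N =>
          MvPowerSeries.C
            (((constG N γ₁ s.mu / constG N γ₁ ⊥ * (constG N γ₂ s.nu / constG N γ₂ ⊥) *
              (constC N s.mu / constC N s.nu) * detJ N γ₁ γ₂ s.mu s.nu : ℝ) : ℂ) *
              multiJacobi γ₁ γ₂ s.lam t) *
            schurInv q s.mu) S ∧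
        expectation P (fun ω => charRatio t q (M ω)) =
          MvPowerSeries.C
              (((∏ j ∈ Finset.Ico N (p + N), (-1) ^ j * (j.factorial : ℝ) *
                  (Real.Gamma (j + γ₁ + γ₂ + 1) / Real.Gamma (2 * j + γ₁ + γ₂ + 1))) *
                ∏ k ∈ Finset.range N, Real.Gamma (2 * k + γ₁ + γ₂ + 2) : ℝ) : ℂ) *
            (∏ k : Fin q, MvPowerSeries.X k ^ N) * S) := by
  refine ⟨fun hM => ?_, fun γ hγ hM => ?_, fun γ₁ γ₂ h₁ h₂ hM => ?_⟩
  -- The Hermite polynomials are monic, so the prefactor is 1.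
  · simpa only [multiHermite, Complex.ofReal_one, map_one, one_mul] using
      hermite_isOrthogonal.expectation_charRatio (q := q) t hM 1 _
        fun s => (one_mul _).trans (expansionCoeff_hermite s).symm
  · exact (laguerre_isOrthogonal hγ).expectation_charRatio (q := q) t hM _ _
      (expansionCoeff_laguerre hγ)
  · exact (jacobi_isOrthogonal h₁ h₂).expectation_charRatio (q := q) t hM _ _
      (expansionCoeff_jacobi h₁ h₂ hN)
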